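/- Let $F$ be either $\mathbb R$ or a non-archimedean local field of characteristic zero, with normalized absolute value $|\cdot|$, and let $\psi$ be a non-trivial continuous unitary character of $F$. Let $\pi_1,\pi_2$ be irreducible admissible representations of $\mathrm{GL}_2(F)$ (irreducible admissible $(\mathfrak{gl}_2(\mathbb R),\mathrm O(2))$-modules if $F=\mathbb R$) whose central characters satisfy $\omega_{\pi_1}\omega_{\pi_2}=1$, and let $\mathcal W(\pi_i,\psi)$ be their $\psi$-Whittaker models (consisting, for $F=\mathbb R$, of functions of moderate growth); these are $0$ if $\pi_i$ is not generic. Let $V=M_2(F)$ with the quadratic form $\det$ and the bilinear form $(x,y)=\det(x+y)-\det x-\det y$. Let $\omega$ be the Weil representation of $\mathrm{Sp}_4(F)$ on Schwartz–Bruhat functions on $V^2$, given by $$\omega\begin{pmatrix}a&\\&{}^ta^{-1}\end{pmatrix}\varphi(x)=|\det a|^2\varphi(xa),\qquad \omega\begin{pmatrix}1&b\\&1\end{pmatrix}\varphi(x)=\psi\Big(\tfrac12\sum_{i,j}b_{ij}(x_j,x_i)\Big)\varphi(x),$$ $$\omega\begin{pmatrix}&1\\-1&\end{pmatrix}\varphi(x)=\int_{V^2}\varphi(y)\,\psi\Big(\sum_i(x_i,y_i)\Big)\,dy$$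 with $dy$ self-dual. Let $\mathrm{GSp}_4(F)$ be the group of $g$ with ${}^tgJg=\nu(g)J$, $J=\begin{pmatrix}&I_2\\-I_2&\end{pmatrix}$, and for $g\in\mathrm{GSp}_4(F)$ and $h_1,h_2\in \mathrm{GL}_2(F)$ with $\det h_1/\det h_2=\nu(g)$ put $$\omega(g,h_1,h_2)f=|\nu(g)|^{-2}\;\omega\Big(g\begin{pmatrix}I_2&\\&\nu(g)I_2\end{pmatrix}^{-1}\Big)\big(x\mapsto f(h_1^{-1}xh_2)\big).$$ Let $H_1(F)$ be the group of transformations $x\mapsto h_1xh_2^{-1}$ of $V$ with $\det h_1=\det h_2$, that is, the group of pairs $(h_1,h_2)\in\mathrm{GL}_2(F)^2$ with $\det h_1=\det h_2$ modulo the scalar pairs $(z,z)$, and let $\hat N(F)\subset H_1(F)$ be the subgroup of the classes of the pairs $\left(\begin{pmatrix}1&x\\&1\end{pmatrix},\begin{pmatrix}1&x\\&1\end{pmatrix}\right)$. Let $\epsilon=\begin{pmatrix}1&\\&-1\end{pmatrix}$. **Proposition.** For all $W_i\in\mathcal W(\pi_i,\psi)$ ($i=1,2$), every Schwartz–Bruhat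 function $f$ on $V^2=M_2(F)^2$ (in particular every $K$-finite one), and every $g\in\mathrm{GSp}_4(F)$, the integral $$\mathbb W(W_1,W_2;f)(g)=\int_{\hat N(F)\backslash H_1(F)}W_1\Big(\epsilon h_1\begin{pmatrix}\nu(g)&\\&1\end{pmatrix}\Big)W_2(h_2)\;\omega\Big(g,h_1\begin{pmatrix}\nu(g)&\\&1\end{pmatrix},h_2\Big)f\left(\begin{pmatrix}0&-1\\0&0\end{pmatrix},I_2\right)d(h_1,h_2)$$ with respect to a right $H_1(F)$-invariant Radon measure is well defined (the integrand is left $\hat N(F)$-invariant and depends only on the class of $(h_1,h_2)$ in $H_1(F)$) and converges absolutely. -/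

import Mathlib

open MeasureTheory Matrix
open scoped Topology SchwartzMap

noncomputable section

namespace ThetaWhittaker

universe u v

/-! ### Elements of `GL₂(F)` -/

section GLTwo

variable {F : Type u} [Field F]

/-- The upper triangular unipotent matrix `[1, x; 0, 1]`. -/
def unip (x : F) : GL (Fin 2) F where
  val := !![1, x; 0, 1]
  inv := !![1, -x; 0, 1]
  val_inv := by ext i j; fin_cases i <;> fin_cases j <;> simp
  inv_val := by ext i j; fin_cases i <;> fin_cases j <;> simp

/-- The diagonal matrix `[a, 0; 0, b]`. -/
def diag (a b : Fˣ) : GL (Fin 2) F where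
  val := !![(a : F), 0; 0, (b : F)]
  inv := !![((a⁻¹ : Fˣ) : F), 0; 0, ((b⁻¹ : Fˣ) : F)]
  val_inv := by ext i j; fin_cases i <;> fin_cases j <;> simp
  inv_val := by ext i j; fin_cases i <;> fin_cases j <;> simp

/-- `ε = [1, 0; 0, -1]`. -/
def eps : GL (Fin 2) F := diag 1 (-1)

end GLTwo

/-! ### The group `H₁` and the space `N̂ \ H₁` -/

section Quotient

variable (F : Type u) [Field F]

/-- Pairs `(h₁, h₂)` in `GL₂(F) × GL₂(F)` with `det h₁ = det h₂`.  Such a pair acts on `M₂(F)` by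
`x ↦ h₁ x h₂⁻¹`; the group `H₁(F)` of these transformations is the quotient of the group of pairs
by the scalar pairs `(z, z)`. -/
def DetPairs : Subgroup (GL (Fin 2) F × GL (Fin 2) F) where
  carrier := {h | GeneralLinearGroup.det h.1 = GeneralLinearGroup.det h.2}
  one_mem' := by simp
  mul_mem' := by
    intro a b ha hb
    simp only [Set.mem_ofPred_eq, Prod.fst_mul, Prod.snd_mul, map_mul] at *
    rw [ha, hb]
  inv_mem' := by
    intro a ha
    simp only [Set.mem_ofPred_eq, Prod.fst_inv, Prod.snd_inv, map_inv] at *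
    rw [ha]

/-- The inverse image of `N̂(F) = {(n(x), n(x))}` in the group of pairs: all `(z n(x), z n(x))`
with `z` a scalar. -/
def NHat : Subgroup (DetPairs F) where
  carrier := {h | ∃ (z : Fˣ) (x : F), h.1 = (diag z z * unip x, diag z z * unip x)}
  one_mem' := by
    refine ⟨1, 0, ?_⟩
    have : (1 : GL (Fin 2) F) = diag 1 1 * unip 0 := by
      ext i j; fin_cases i <;> fin_cases j <;> simp [diag, unip]
    rw [← this]; rfl
  mul_mem' := by
    rintro a b ⟨z, x, hz⟩ ⟨w, y, hw⟩
    refine ⟨z * w, x + y, ?_⟩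
    have : (diag z z * unip x) * (diag w w * unip y) = diag (z * w) (z * w) * unip (x + y) := by
      ext i j
      fin_cases i <;> fin_cases j <;> simp [diag, unip, Matrix.mul_apply, Fin.sum_univ_two] <;> ring
    rw [Subgroup.coe_mul, hz, hw, Prod.mk_mul_mk, this]
  inv_mem' := by
    rintro a ⟨z, x, hz⟩
    refine ⟨z⁻¹, -x, ?_⟩
    have : (diag z z * unip x)⁻¹ = diag z⁻¹ z⁻¹ * unip (-x) := by
      rw [inv_eq_iff_mul_eq_one]
      ext i j
      fin_cases i <;> fin_cases j <;>
        simp [diag, unip, Matrix.mul_apply, Fin.sum_univ_two, mul_comm, mul_left_comm]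
    rw [Subgroup.coe_inv, hz, Prod.inv_mk, this]

/-- The space of orbits `N̂(F) \ H₁(F)` (left multiplication by `N̂`). -/
def NHatQuot : Type u := Quotient (QuotientGroup.rightRel (NHat F))

/-- The projection `H₁(F) → N̂(F) \ H₁(F)`. -/
def NHatQuot.mk (h : DetPairs F) : NHatQuot F :=
  Quotient.mk (QuotientGroup.rightRel (NHat F)) h

/-- Right translation by `k` on `N̂(F) \ H₁(F)`. -/
def NHatQuot.rightMul (k : DetPairs F) : NHatQuot F → NHatQuot F :=
  Quotient.map (fun h => h * k) (by
    intro a b hab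
    have hab' : QuotientGroup.rightRel (NHat F) a b := hab
    change QuotientGroup.rightRel (NHat F) (a * k) (b * k)
    rw [QuotientGroup.rightRel_apply] at hab' ⊢
    simpa [mul_assoc] using hab')

variable [TopologicalSpace F]

instance : TopologicalSpace (NHatQuot F) :=
  inferInstanceAs (TopologicalSpace (Quotient (QuotientGroup.rightRel (NHat F))))

instance : MeasurableSpace (NHatQuot F) := borel _

instance : BorelSpace (NHatQuot F) := ⟨rfl⟩

variable {F}

/-- `μ` is a right `H₁(F)`-invariant measure on `N̂(F) \ H₁(F)`, finite on compact sets. -/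
structure IsInvariantMeasure (μ : Measure (NHatQuot F)) : Prop where
  finite_on_compacts : ∀ C : Set (NHatQuot F), IsCompact C → μ C < ⊤
  invariant : ∀ (k : DetPairs F) (A : Set (NHatQuot F)), MeasurableSet A →
    μ (NHatQuot.rightMul F k ⁻¹' A) = μ A

/-- The integral over `N̂(F) \ H₁(F)` of the expression `Φ(h)` is well defined (the expression is
invariant under left translation by `N̂(F)`) and absolutely convergent. -/
def ConvergesAbsolutely (μ : Measure (NHatQuot F)) (Φ : DetPairs F → ℂ) : Prop :=
  ∃ Φ' : NHatQuot F → ℂ, (∀ h, Φ' (NHatQuot.mk F h) = Φ h) ∧ Integrable Φ' μ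

end Quotient

/-! ### The quadratic space and the Weil representation -/

/-- The alternating form `J = [0, 1; -1, 0]`. -/
def sympJ (F : Type u) [Field F] : Matrix (Fin 2 ⊕ Fin 2) (Fin 2 ⊕ Fin 2) F :=
  fromBlocks 0 1 (-1) 0

/-- For `(A, C)` the left half of a symplectic matrix with `C` singular, some `A + S C` with `S`
symmetric is invertible. -/
theorem exists_symm_isUnit {F : Type u} [Field F] (A B C D : Matrix (Fin 2) (Fin 2) F)
    (h1 : Aᵀ * C = Cᵀ * A) (h2 : Aᵀ * D - Cᵀ * B = 1) (hC : C.det = 0) :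
    ∃ S : Matrix (Fin 2) (Fin 2) F, Sᵀ = S ∧ IsUnit (A + S * C).det := by
  by_contra hcon
  push Not at hcon
  have s0 := hcon 0 (by simp)
  have s1 := hcon !![1, 0; 0, 0] (by ext i j; fin_cases i <;> fin_cases j <;> simp)
  have s2 := hcon !![0, 0; 0, 1] (by ext i j; fin_cases i <;> fin_cases j <;> simp)
  have g1 := congrFun (congrFun h1 0) 1
  have k00 := congrFun (congrFun h2 0) 0
  have k01 := congrFun (congrFun h2 0) 1
  have k10 := congrFun (congrFun h2 1) 0
  have k11 := congrFun (congrFun h2 1) 1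
  simp only [isUnit_iff_ne_zero, ne_eq, not_not, det_fin_two, Matrix.add_apply, Matrix.sub_apply,
    Matrix.mul_apply, Fin.sum_univ_two, transpose_apply, Matrix.of_apply,
    cons_val', cons_val_zero, cons_val_one, cons_val_fin_one, zero_mul, one_mul, add_zero, zero_add,
    Matrix.one_apply, Fin.isValue, one_ne_zero, zero_ne_one, if_true, if_false] at s0 s1 s2 g1 k00 k01 k10 k11 hC
  have m1 : C 0 0 * A 1 1 - C 0 1 * A 1 0 = 0 := by linear_combination s1 - s0
  have m2 : A 0 0 * C 1 1 - A 0 1 * C 1 0 = 0 := by linear_combination s2 - s0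
  have m3 : A 1 0 * C 1 1 - A 1 1 * C 1 0 = -(A 0 0 * C 0 1 - A 0 1 * C 0 0) := by
    linear_combination g1
  have m4 : A 0 0 * C 0 1 - A 0 1 * C 0 0 = 0 := by
    have : (A 0 0 * C 0 1 - A 0 1 * C 0 0) ^ 2 = 0 := by
      grind
    simpa using this
  have m5 : A 1 0 * C 1 1 - A 1 1 * C 1 0 = 0 := by rw [m3, m4, neg_zero]
  have : (1 : F) = 0 := by
    have e : (1 : F) = (A 0 0 * D 0 0 + A 1 0 * D 1 0 - (C 0 0 * B 0 0 + C 1 0 * B 1 0)) *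
        (A 0 1 * D 0 1 + A 1 1 * D 1 1 - (C 0 1 * B 0 1 + C 1 1 * B 1 1)) -
        (A 0 0 * D 0 1 + A 1 0 * D 1 1 - (C 0 0 * B 0 1 + C 1 0 * B 1 1)) *
        (A 0 1 * D 0 0 + A 1 1 * D 1 0 - (C 0 1 * B 0 0 + C 1 1 * B 1 0)) := by
      rw [k00, k01, k10, k11]; ring
    rw [e]
    linear_combination (D 0 0 * D 1 1 - D 0 1 * D 1 0) * s0 + (B 0 0 * B 1 1 - B 0 1 * B 1 0) * hC
      + (-(D 0 0 * B 0 1 - D 0 1 * B 0 0)) * m4 + (-(D 1 0 * B 1 1 - D 1 1 * B 1 0)) * m5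
      + (-(D 0 0 * B 1 1 - D 0 1 * B 1 0)) * m2 + (D 1 0 * B 0 1 - D 1 1 * B 0 0) * m1
  exact one_ne_zero this

section Weil

/-- `V² = M₂(F)²`. -/
abbrev VSq (F : Type u) : Type u := Fin 2 → Matrix (Fin 2) (Fin 2) F

instance (F : Type u) [TopologicalSpace F] : MeasurableSpace (VSq F) := borel _

instance (F : Type u) [TopologicalSpace F] : BorelSpace (VSq F) := ⟨rfl⟩

variable {F : Type u} [Field F]

/-- The symmetric bilinear form on `M₂(F)` with `(x, x) = 2 det x`. -/
def form (x y : Matrix (Fin 2) (Fin 2) F) : F := (x + y).det - x.det - y.det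

/-- `x a = (x₁, x₂) (aᵢⱼ)`. -/
def rightAct (x : VSq F) (a : Matrix (Fin 2) (Fin 2) F) : VSq F := fun j => ∑ i, a i j • x i

variable [TopologicalSpace F]

/-- The Fourier transform `∫ φ(y) ψ(tr (x, y)) dy` on `V²`. -/
def fourier (ψ : AddChar F Circle) (m : Measure (VSq F)) (φ : VSq F → ℂ) : VSq F → ℂ :=
  fun x => ∫ y, φ y * (ψ (∑ i, form (x i) (y i)) : ℂ) ∂m

/-- `m` is the Haar measure on `V²` that is self-dual for the pairing `ψ(tr (x, y))`: Fourier
inversion holds. -/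
structure IsSelfDual (ψ : AddChar F Circle) (m : Measure (VSq F)) : Prop where
  haar : m.IsAddHaarMeasure
  inversion : ∀ φ : VSq F → ℂ, Continuous φ → Integrable φ m → Integrable (fourier ψ m φ) m →
    ∀ x, fourier ψ m (fourier ψ m φ) x = φ (-x)

variable [IsTopologicalRing F] [LocallyCompactSpace F]

/-- The normalized absolute value on `Fˣ`: the factor by which multiplication by `a` scales the
Haar measure of `F`. -/
def absF (a : Fˣ) : ℝ := (distribHaarChar F a : ℝ)

/-- The operators of the Weil representation of `Sp₄(F)` attached to the split quadratic space
`M₂(F)`, given on the generators `diag(a, ᵗa⁻¹)`, `[1, b; 0, 1]` and `[0, 1; -1, 0]` and extended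
to products.  (For this space the constant in front of the Fourier transform is `1`.) -/
inductive IsWeilOperator (ψ : AddChar F Circle) (m : Measure (VSq F)) :
    Matrix (Fin 2 ⊕ Fin 2) (Fin 2 ⊕ Fin 2) F → ((VSq F → ℂ) → (VSq F → ℂ)) → Prop
  | levi (a : GL (Fin 2) F) :
      IsWeilOperator ψ m
        (fromBlocks (a : Matrix (Fin 2) (Fin 2) F) 0 0
          ((a⁻¹ : GL (Fin 2) F) : Matrix (Fin 2) (Fin 2) F)ᵀ)
        (fun φ x => ((absF (GeneralLinearGroup.det a) ^ 2 : ℝ) : ℂ) *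
          φ (rightAct x (a : Matrix (Fin 2) (Fin 2) F)))
  | siegel (b : Matrix (Fin 2) (Fin 2) F) (hb : bᵀ = b) :
      IsWeilOperator ψ m (fromBlocks 1 b 0 1)
        (fun φ x => (ψ (2⁻¹ * ∑ i, ∑ j, b i j * form (x j) (x i)) : ℂ) * φ x)
  | weyl : IsWeilOperator ψ m (fromBlocks 0 1 (-1) 0) (fourier ψ m)
  | comp {s t : Matrix (Fin 2 ⊕ Fin 2) (Fin 2 ⊕ Fin 2) F}
      {S T : (VSq F → ℂ) → (VSq F → ℂ)} :
      IsWeilOperator ψ m s S → IsWeilOperator ψ m t T → IsWeilOperator ψ m (s * t) (S ∘ T)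

/-- If the lower left block of a symplectic matrix is invertible, it is a product of generators. -/
theorem exists_isWeilOperator_of_isUnit (ψ : AddChar F Circle) (m : Measure (VSq F))
    (A B C D : Matrix (Fin 2) (Fin 2) F)
    (hs : (fromBlocks A B C D)ᵀ * sympJ F * fromBlocks A B C D = sympJ F) (hC : IsUnit C.det) :
    ∃ T, IsWeilOperator ψ m (fromBlocks A B C D) T := by
  have hJJ : sympJ F * sympJ F = -1 := by
    simp [sympJ, fromBlocks_multiply, ← fromBlocks_one, fromBlocks_neg]
  have hs' : fromBlocks A B C D * sympJ F * (fromBlocks A B C D)ᵀ = sympJ F := by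
    have h1 : (-(sympJ F * (fromBlocks A B C D)ᵀ * sympJ F)) * fromBlocks A B C D = 1 := by
      rw [Matrix.neg_mul, Matrix.mul_assoc (sympJ F), Matrix.mul_assoc (sympJ F), hs, hJJ, neg_neg]
    have h2 := mul_eq_one_comm.mp h1
    have h3 : fromBlocks A B C D * sympJ F * (fromBlocks A B C D)ᵀ * (sympJ F * sympJ F)
        = sympJ F * (sympJ F * sympJ F) * (-1) * (-1) := by
      have : fromBlocks A B C D * sympJ F * (fromBlocks A B C D)ᵀ * (sympJ F * sympJ F)
          = -(fromBlocks A B C D * -(sympJ F * (fromBlocks A B C D)ᵀ * sympJ F)) * sympJ F := by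
        simp [Matrix.mul_assoc]
      rw [this, h2, hJJ]; simp
    rw [hJJ] at h3
    simpa using h3
  simp only [sympJ, fromBlocks_transpose, fromBlocks_multiply, Matrix.mul_zero, Matrix.mul_one,
    Matrix.mul_neg, zero_add, add_zero, Matrix.neg_mul, fromBlocks_inj] at hs hs'
  obtain ⟨h11, h12, -, -⟩ := hs
  obtain ⟨-, -, -, k22⟩ := hs'
  have e1 : Aᵀ * C = Cᵀ * A := by rw [← sub_eq_zero, ← h11]; abel
  have e2 : Cᵀ * B = Aᵀ * D - 1 := by rw [← h12]; abel
  have e3 : C * Dᵀ = D * Cᵀ := by rw [← sub_eq_zero, ← k22]; abel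
  have hCt : IsUnit Cᵀ.det := by rwa [det_transpose]
  have c1 : C * C⁻¹ = 1 := mul_nonsing_inv C hC
  have c2 : C⁻¹ * C = 1 := nonsing_inv_mul C hC
  have c3 : Cᵀ * C⁻¹ᵀ = 1 := by rw [← transpose_mul, c2, transpose_one]
  have c4 : C⁻¹ᵀ * Cᵀ = 1 := by rw [← transpose_mul, c1, transpose_one]
  have symX : (A * C⁻¹)ᵀ = A * C⁻¹ := by
    rw [transpose_mul]
    calc C⁻¹ᵀ * Aᵀ = C⁻¹ᵀ * (Aᵀ * C) * C⁻¹ := by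
          rw [Matrix.mul_assoc, Matrix.mul_assoc, c1, Matrix.mul_one]
      _ = A * C⁻¹ := by rw [e1, ← Matrix.mul_assoc, c4, Matrix.one_mul]
  have symb : (C⁻¹ * D)ᵀ = C⁻¹ * D := by
    rw [transpose_mul]
    calc Dᵀ * C⁻¹ᵀ = C⁻¹ * (C * Dᵀ) * C⁻¹ᵀ := by
          rw [← Matrix.mul_assoc, c2, Matrix.one_mul]
      _ = C⁻¹ * D := by rw [e3, Matrix.mul_assoc, Matrix.mul_assoc, c3, Matrix.mul_one]
  let a : GL (Fin 2) F := ⟨-C, -C⁻¹, by simp [c1], by simp [c2]⟩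
  have hB : B = A * C⁻¹ * D - C⁻¹ᵀ := by
    calc B = C⁻¹ᵀ * (Cᵀ * B) := by rw [← Matrix.mul_assoc, c4, Matrix.one_mul]
      _ = C⁻¹ᵀ * (Aᵀ * D - 1) := by rw [e2]
      _ = (A * C⁻¹)ᵀ * D - C⁻¹ᵀ := by
        rw [Matrix.mul_sub, Matrix.mul_one, transpose_mul, Matrix.mul_assoc]
      _ = _ := by rw [symX]
  have key : fromBlocks A B C D = fromBlocks 1 (A * C⁻¹) 0 1 * (fromBlocks 0 1 (-1) 0 *
      (fromBlocks (a : Matrix (Fin 2) (Fin 2) F) 0 0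
        ((a⁻¹ : GL (Fin 2) F) : Matrix (Fin 2) (Fin 2) F)ᵀ * fromBlocks 1 (C⁻¹ * D) 0 1)) := by
    have ha : (a : Matrix (Fin 2) (Fin 2) F) = -C := rfl
    have ha' : ((a⁻¹ : GL (Fin 2) F) : Matrix (Fin 2) (Fin 2) F) = -C⁻¹ := rfl
    rw [ha, ha']
    simp only [fromBlocks_multiply, Matrix.mul_zero, Matrix.mul_one, Matrix.one_mul,
      Matrix.zero_mul, add_zero, zero_add, Matrix.neg_mul, neg_neg, transpose_neg, neg_zero]
    rw [fromBlocks_inj]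
    refine ⟨?_, ?_, rfl, ?_⟩
    · rw [Matrix.mul_assoc, c2, Matrix.mul_one]
    · rw [← Matrix.mul_assoc C, c1, Matrix.one_mul, hB]; abel
    · rw [← Matrix.mul_assoc, c1, Matrix.one_mul]
  rw [key]
  exact ⟨_, .comp (.siegel _ symX) (.comp .weyl (.comp (.levi a) (.siegel _ symb)))⟩

/-- Every element of `Sp₄(F)` is a product of generators. -/
theorem exists_isWeilOperator (ψ : AddChar F Circle) (m : Measure (VSq F))
    (s : Matrix (Fin 2 ⊕ Fin 2) (Fin 2 ⊕ Fin 2) F) (hs : sᵀ * sympJ F * s = sympJ F) :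
    ∃ T, IsWeilOperator ψ m s T := by
  obtain ⟨A, B, C, D, rfl⟩ : ∃ A B C D, s = fromBlocks A B C D :=
    ⟨_, _, _, _, (fromBlocks_toBlocks s).symm⟩
  by_cases hC : C.det = 0
  · have hb := hs
    simp only [sympJ, fromBlocks_transpose, fromBlocks_multiply, Matrix.mul_zero, Matrix.mul_one,
      Matrix.mul_neg, zero_add, add_zero, Matrix.neg_mul, fromBlocks_inj] at hb
    obtain ⟨h11, h12, -, -⟩ := hb
    obtain ⟨S, hS, hU⟩ := exists_symm_isUnit A B C D
      (by rw [← sub_eq_zero, ← h11]; abel) (by rw [← h12]; abel) hC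
    have hJ : (sympJ F)ᵀ * sympJ F * sympJ F = sympJ F := by
      simp [sympJ, fromBlocks_transpose, fromBlocks_multiply]
    have hN : (fromBlocks 1 S 0 1)ᵀ * sympJ F * fromBlocks 1 S 0 1 = sympJ F := by
      simp [sympJ, fromBlocks_transpose, fromBlocks_multiply, hS]
    have hs' : (sympJ F * (fromBlocks 1 S 0 1 * fromBlocks A B C D))ᵀ * sympJ F *
        (sympJ F * (fromBlocks 1 S 0 1 * fromBlocks A B C D)) = sympJ F := by
      calc _ = (fromBlocks A B C D)ᵀ * ((fromBlocks 1 S 0 1)ᵀ *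
            ((sympJ F)ᵀ * sympJ F * sympJ F) * fromBlocks 1 S 0 1) * fromBlocks A B C D := by
            simp only [transpose_mul, Matrix.mul_assoc]
        _ = sympJ F := by rw [hJ, hN, hs]
    have hform : sympJ F * (fromBlocks 1 S 0 1 * fromBlocks A B C D) =
        fromBlocks C D (-(A + S * C)) (-(B + S * D)) := by
      simp [sympJ, fromBlocks_multiply]
    rw [hform] at hs'
    obtain ⟨T, hT⟩ := exists_isWeilOperator_of_isUnit ψ m _ _ _ _ hs'
      (by rw [det_neg]; simpa using hU)
    rw [← hform] at hT
    have key : fromBlocks A B C D = fromBlocks 1 (-S) 0 1 * (fromBlocks 0 1 (-1) 0 *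
        (fromBlocks 0 1 (-1) 0 * (fromBlocks 0 1 (-1) 0 *
          (sympJ F * (fromBlocks 1 S 0 1 * fromBlocks A B C D))))) := by
      simp [sympJ, fromBlocks_multiply]
    rw [key]
    exact ⟨_, .comp (.siegel _ (by simp [hS])) (.comp .weyl (.comp .weyl (.comp .weyl hT)))⟩
  · exact exists_isWeilOperator_of_isUnit ψ m A B C D hs (isUnit_iff_ne_zero.mpr hC)

open Classical in
/-- `ω(s)` for `s ∈ Sp₄(F)`: the operator obtained by writing `s` as a product of the generators.
When `m` is self-dual, its effect on Schwartz-Bruhat functions does not depend on how `s` is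
written, because the formulas on generators define a representation. -/
def weilOp (ψ : AddChar F Circle) (m : Measure (VSq F))
    (s : Matrix (Fin 2 ⊕ Fin 2) (Fin 2 ⊕ Fin 2) F) : (VSq F → ℂ) → (VSq F → ℂ) :=
  if h : ∃ T, IsWeilOperator ψ m s T then h.choose else id

theorem weilOp_spec (ψ : AddChar F Circle) (m : Measure (VSq F))
    (s : Matrix (Fin 2 ⊕ Fin 2) (Fin 2 ⊕ Fin 2) F) (hs : sᵀ * sympJ F * s = sympJ F) :
    IsWeilOperator ψ m s (weilOp ψ m s) := by
  have h := exists_isWeilOperator ψ m s hs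
  rw [weilOp, dif_pos h]
  exact h.choose_spec

end Weil

section GSp

variable (F : Type u) [Field F]

/-- `GSp₄(F)`: matrices `g` with `ᵗg J g = ν(g) J`, `ν(g) ∈ Fˣ`. -/
structure GSp4 where
  mat : Matrix (Fin 2 ⊕ Fin 2) (Fin 2 ⊕ Fin 2) F
  nu : Fˣ
  similitude : matᵀ * sympJ F * mat = (nu : F) • sympJ F

variable {F}

/-- `g · diag(1, 1, ν(g), ν(g))⁻¹ ∈ Sp₄(F)`. -/
def GSp4.toSp (g : GSp4 F) : Matrix (Fin 2 ⊕ Fin 2) (Fin 2 ⊕ Fin 2) F :=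
  g.mat * fromBlocks 1 0 0 ((g.nu : F)⁻¹ • 1)

theorem GSp4.toSp_mem (g : GSp4 F) : g.toSpᵀ * sympJ F * g.toSp = sympJ F := by
  have hd : (fromBlocks 1 0 0 ((g.nu : F)⁻¹ • 1) :
      Matrix (Fin 2 ⊕ Fin 2) (Fin 2 ⊕ Fin 2) F)ᵀ * sympJ F *
      fromBlocks 1 0 0 ((g.nu : F)⁻¹ • 1) = (g.nu : F)⁻¹ • sympJ F := by
    simp [sympJ, fromBlocks_transpose, fromBlocks_multiply, fromBlocks_smul]
  calc _ = (fromBlocks 1 0 0 ((g.nu : F)⁻¹ • 1))ᵀ * (g.matᵀ * sympJ F * g.mat) *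
        fromBlocks 1 0 0 ((g.nu : F)⁻¹ • 1) := by
        simp only [GSp4.toSp, transpose_mul, Matrix.mul_assoc]
    _ = sympJ F := by
        rw [g.similitude, Matrix.mul_smul, Matrix.smul_mul, hd, smul_smul,
          mul_inv_cancel₀ g.nu.ne_zero, one_smul]

/-- The action `x ↦ h₁⁻¹ x h₂` of `(h₁, h₂)⁻¹` on `V²`. -/
def invAct (h₁ h₂ : GL (Fin 2) F) (x : VSq F) : VSq F := fun i =>
  ((h₁⁻¹ : GL (Fin 2) F) : Matrix (Fin 2) (Fin 2) F) * x i * (h₂ : Matrix (Fin 2) (Fin 2) F)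

variable [TopologicalSpace F] [IsTopologicalRing F] [LocallyCompactSpace F]

/-- The extended Weil representation, for `ν(g) = ν(h) = det h₁ / det h₂`:
`ω(g, h₁, h₂) f = |ν(g)|⁻² ω(g diag(1, ν(g))⁻¹) (f ∘ (h₁, h₂)⁻¹)`. -/
def extWeil (ψ : AddChar F Circle) (m : Measure (VSq F)) (g : GSp4 F) (h₁ h₂ : GL (Fin 2) F)
    (f : VSq F → ℂ) : VSq F → ℂ :=
  fun x => (((absF g.nu ^ 2)⁻¹ : ℝ) : ℂ) * weilOp ψ m g.toSp (fun y => f (invAct h₁ h₂ y)) x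

/-- The integrand of `𝕎(W₁, W₂; f)(g)`, as a function of `h = (h₁, h₂)`. -/
def integrand (ψ : AddChar F Circle) (m : Measure (VSq F)) (W₁ W₂ : GL (Fin 2) F → ℂ)
    (f : VSq F → ℂ) (g : GSp4 F) (h : DetPairs F) : ℂ :=
  W₁ (eps * h.1.1 * diag g.nu 1) * W₂ h.1.2 *
    extWeil ψ m g (h.1.1 * diag g.nu 1) h.1.2 f ![!![0, -1; 0, 0], 1]

end GSp

/-! ### Schwartz-Bruhat functions -/

/-- Schwartz-Bruhat functions on `V²`, non-archimedean case. -/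
def IsSchwartzBruhat {F : Type u} [TopologicalSpace F] [Zero F] (f : VSq F → ℂ) : Prop :=
  IsLocallyConstant f ∧ HasCompactSupport f

/-- Schwartz functions on `V²`, real case. -/
def IsRealSchwartz (f : VSq ℝ → ℂ) : Prop :=
  ∃ φ : 𝓢(Fin 2 → Fin 2 → Fin 2 → ℝ, ℂ), ∀ x : VSq ℝ, f x = φ (fun i j k => x i j k)

/-! ### Non-archimedean representations and Whittaker models -/

section NonArch

variable {F : Type u} [Field F] [TopologicalSpace F]
variable {E : Type v} [AddCommGroup E] [Module ℂ E]

/-- Irreducible admissible representations of `GL₂(F)`. -/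
structure IsIrredAdmissible (π : Representation ℂ (GL (Fin 2) F) E) : Prop where
  smooth : ∀ e : E, IsOpen {g : GL (Fin 2) F | π g e = e}
  admissible : ∀ U : Subgroup (GL (Fin 2) F), IsOpen (U : Set (GL (Fin 2) F)) →
    ∃ B : Submodule ℂ E, FiniteDimensional ℂ B ∧ ∀ e : E, (∀ g ∈ U, π g e = e) → e ∈ B
  irreducible : π.IsIrreducible

/-- `ω` is the central character of `π`. -/
def HasCentralChar (π : Representation ℂ (GL (Fin 2) F) E) (ω : Fˣ →* ℂˣ) : Prop :=
  ∀ (z : Fˣ) (e : E), π (diag z z) e = (ω z : ℂ) • e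

/-- The Whittaker model `𝒲(π, ψ)`: the functions `g ↦ l(π(g) e)`, with `l` a `ψ`-Whittaker
functional on `π`. -/
def whittakerModel (π : Representation ℂ (GL (Fin 2) F) E) (ψ : AddChar F Circle) :
    Set (GL (Fin 2) F → ℂ) :=
  {W | ∃ l : E →ₗ[ℂ] ℂ, (∀ (x : F) (e : E), l (π (unip x) e) = (ψ x : ℂ) * l e) ∧
    ∃ e : E, ∀ g, W g = l (π g e)}

end NonArch

/-! ### Real representations and Whittaker models -/

section Arch

/-- The maximal compact subgroup `K = O(2)` of `GL₂(ℝ)`. -/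
abbrev O2 : Type := Matrix.orthogonalGroup (Fin 2) ℝ

/-- `𝔤 = 𝔤𝔩₂(ℝ)`. -/
abbrev gl2 : Type := Matrix (Fin 2) (Fin 2) ℝ

/-- `exp(tX)` as an element of `GL₂(ℝ)`. -/
def expGL (X : gl2) (t : ℝ) : GL (Fin 2) ℝ := (Matrix.isUnit_exp (t • X)).unit

/-- A `(𝔤, K)`-module for `GL₂(ℝ)` on the complex vector space `E`. -/
structure GKModule (E : Type v) [AddCommGroup E] [Module ℂ E] where
  lie : gl2 → Module.End ℂ E
  rep : Representation ℂ O2 E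
  lie_add : ∀ X Y, lie (X + Y) = lie X + lie Y
  lie_smul : ∀ (r : ℝ) X, lie (r • X) = (r : ℂ) • lie X
  lie_bracket : ∀ X Y, lie (X * Y - Y * X) = lie X * lie Y - lie Y * lie X
  locally_finite : ∀ e : E, FiniteDimensional ℂ (Submodule.span ℂ (Set.range fun k => rep k e))
  continuous : ∀ (e : E) (l : E →ₗ[ℂ] ℂ), Continuous fun k => l (rep k e)
  differential : ∀ X : gl2, Xᵀ = -X → ∀ c : ℝ → O2,
    (∀ t, (c t : gl2) = NormedSpace.exp (t • X)) →
    ∀ (e : E) (l : E →ₗ[ℂ] ℂ), HasDerivAt (fun t => l (rep (c t) e)) (l (lie X e)) 0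
  adjoint : ∀ (k : O2) (X : gl2) (e : E),
    rep k (lie X e) = lie ((k : gl2) * X * (k : gl2)ᵀ) (rep k e)

namespace GKModule

variable {E : Type v} [AddCommGroup E] [Module ℂ E]

/-- Irreducible admissible `(𝔤, K)`-modules: every irreducible representation of `K` occurs with
finite multiplicity, and there is no proper non-zero submodule. -/
structure IsIrredAdmissible (π : GKModule E) : Prop where
  admissible : ∀ (n : ℕ) (τ : Representation ℂ O2 (Fin n → ℂ)), τ.IsIrreducible →
    FiniteDimensional ℂ (τ.IntertwiningMap π.rep)
  nontrivial : Nontrivial E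
  irreducible : ∀ S : Submodule ℂ E, (∀ X, ∀ e ∈ S, π.lie X e ∈ S) →
    (∀ k, ∀ e ∈ S, π.rep k e ∈ S) → S = ⊥ ∨ S = ⊤

/-- `ω` is the central character of `π`: it is read off from the action of `-1 ∈ K` and of the
scalar matrices in `𝔤`. -/
def HasCentralChar (π : GKModule E) (ω : ℝˣ →* ℂˣ) : Prop :=
  (∀ e, π.rep (-1) e = (ω (-1) : ℂ) • e) ∧
    ∃ s : ℂ, (∀ e, π.lie 1 e = s • e) ∧
      ∀ z : ℝˣ, 0 < (z : ℝ) → (ω z : ℂ) = Complex.exp (s * Real.log (z : ℝ))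

/-- Moderate growth: `|W(g)| ≤ C ‖g‖ᴺ` with `‖g‖` the sum of the absolute values of the entries of
`g` and `g⁻¹`. -/
def ModerateGrowth (W : GL (Fin 2) ℝ → ℂ) : Prop :=
  ∃ (C : ℝ) (N : ℕ), ∀ g : GL (Fin 2) ℝ,
    ‖W g‖ ≤ C * (∑ i, ∑ j, (|(g : gl2) i j| + |((g⁻¹ : GL (Fin 2) ℝ) : gl2) i j|)) ^ N

/-- The Whittaker model `𝒲(π, ψ)`: the images of vectors of `π` under a `(𝔤, K)`-map `ℓ` into the
space of functions of moderate growth with `W(n(x) g) = ψ(x) W(g)`, on which `K` and `𝔤` act by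
right translation and its derivative.  (The functions `ℓ e` are then automatically smooth.) -/
def whittakerModel (π : GKModule E) (ψ : AddChar ℝ Circle) : Set (GL (Fin 2) ℝ → ℂ) :=
  {W | ∃ ℓ : E →ₗ[ℂ] (GL (Fin 2) ℝ → ℂ),
    (∀ e, Continuous (ℓ e)) ∧
    (∀ e, ModerateGrowth (ℓ e)) ∧
    (∀ e (x : ℝ) g, ℓ e (unip x * g) = (ψ x : ℂ) * ℓ e g) ∧
    (∀ e (k : O2) g, ℓ (π.rep k e) g = ℓ e (g * Unitary.toUnits k)) ∧
    (∀ e (X : gl2) g, HasDerivAt (fun t : ℝ => ℓ e (g * expGL X t)) (ℓ (π.lie X e) g) 0) ∧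
    ∃ e, W = ℓ e}

end GKModule

end Arch

end ThetaWhittaker

end

open ThetaWhittaker

/-!
The Weil representation preserves the space of test functions, so up to a constant the integrand is
`W₁(ε h₁ d) W₂(h₂) φ(h₁⁻¹ x₀ h₂)` for a test function `φ` and the base point `x₀ = (-n, 1)`, where
`n = [0, 1; 0, 0]`. The two components of `h₁⁻¹ x₀ h₂` are `-h₁⁻¹ n h₂` and `h₁⁻¹ h₂`; hence where
`φ` is not small, `h₁⁻¹ h₂` and `h₂⁻¹ n h₂` are bounded. Modulo scalars and unipotents, `h₂` is a
diagonal matrix `diag (a, 1)` times an element of a compact group, and the size of `h₂⁻¹ n h₂` is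
`|a|⁻¹`; this leaves only the direction `|a| → ∞`, which has to be controlled by `W₂`.

Over a non-archimedean field `W₂` vanishes for large `|a|`: a vector fixed by a small unipotent
subgroup on which `ψ (a ·)` is non-trivial is killed by the Whittaker functional. The integrand is
then continuous with compact support.

Over the reals the Casimir operator acts on the finite-dimensional `K`-span of a vector by a scalar,
so that in the variable `u = log a` the Whittaker functions satisfy a second order system whose
leading coefficient grows like `exp (2 u)`. Comparison with `v'' = M² v`, together with moderate
growth, shows that they decay faster than every `exp (-M u)`. The product with `φ` then decays
faster than any power of the size of `(h₁, h₂)`, whereas the volume of the pairs of size at most `R`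
in the quotient grows at most polynomially, as one sees by covering them with finitely many right
translates of a fixed compact set.
-/

namespace ThetaWhittaker

/-! ### The orthogonal action on `V²` -/

instance {F : Type*} [TopologicalSpace F] [LocallyCompactSpace F] :
    LocallyCompactSpace (VSq F) :=
  inferInstanceAs (LocallyCompactSpace (Fin 2 → Fin 2 → Fin 2 → F))

instance {F : Type*} [TopologicalSpace F] [SecondCountableTopology F] :
    SecondCountableTopology (VSq F) :=
  inferInstanceAs (SecondCountableTopology (Fin 2 → Fin 2 → Fin 2 → F))

section Isometry

variable {F : Type*} [Field F]

theorem form_eq (x y : Matrix (Fin 2) (Fin 2) F) :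
    form x y = x 0 0 * y 1 1 + x 1 1 * y 0 0 - x 0 1 * y 1 0 - x 1 0 * y 0 1 := by
  simp only [form, det_fin_two, Matrix.add_apply]
  ring

theorem form_add_left (x y z : Matrix (Fin 2) (Fin 2) F) :
    form (x + y) z = form x z + form y z := by
  simp only [form_eq, Matrix.add_apply]
  ring

theorem form_add_right (x y z : Matrix (Fin 2) (Fin 2) F) :
    form x (y + z) = form x y + form x z := by
  simp only [form_eq, Matrix.add_apply]
  ring

theorem form_mul_mul (a b x y : Matrix (Fin 2) (Fin 2) F) :
    form (a * x * b) (a * y * b) = a.det * b.det * form x y := by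
  simp only [form, ← Matrix.add_mul, ← Matrix.mul_add, det_mul]
  ring

theorem form_invAct {h₁ h₂ : GL (Fin 2) F}
    (h : GeneralLinearGroup.det h₁ = GeneralLinearGroup.det h₂) (x y : VSq F) (i j : Fin 2) :
    form (invAct h₁ h₂ x i) (invAct h₁ h₂ y j) = form (x i) (y j) := by
  have hdet : ((h₁⁻¹ : GL (Fin 2) F) : Matrix (Fin 2) (Fin 2) F).det *
      (h₂ : Matrix (Fin 2) (Fin 2) F).det = 1 := by
    rw [← GeneralLinearGroup.val_det_apply, ← GeneralLinearGroup.val_det_apply, map_inv, h,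
      Units.inv_mul]
  rw [invAct, invAct, form_mul_mul, hdet, one_mul]

theorem invAct_mul (a₁ a₂ b₁ b₂ : GL (Fin 2) F) (x : VSq F) :
    invAct (a₁ * b₁) (a₂ * b₂) x = invAct b₁ b₂ (invAct a₁ a₂ x) := by
  funext i
  simp only [invAct, _root_.mul_inv_rev, Units.val_mul, Matrix.mul_assoc]

@[simp]
theorem invAct_one (x : VSq F) : invAct 1 1 x = x := by
  funext i
  simp [invAct]

theorem invAct_add (h₁ h₂ : GL (Fin 2) F) (x y : VSq F) :
    invAct h₁ h₂ (x + y) = invAct h₁ h₂ x + invAct h₁ h₂ y := by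
  funext i
  simp [invAct, Matrix.mul_add, Matrix.add_mul]

theorem rightAct_rightAct (x : VSq F) (a b : Matrix (Fin 2) (Fin 2) F) :
    rightAct (rightAct x a) b = rightAct x (a * b) := by
  funext j
  simp only [rightAct, Finset.smul_sum, smul_smul, Matrix.mul_apply, Finset.sum_smul, mul_comm]
  exact Finset.sum_comm

@[simp]
theorem rightAct_one (x : VSq F) : rightAct x 1 = x := by
  funext j
  simp [rightAct, Matrix.one_apply]

theorem invAct_rightAct (h₁ h₂ : GL (Fin 2) F) (x : VSq F) (a : Matrix (Fin 2) (Fin 2) F) :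
    invAct h₁ h₂ (rightAct x a) = rightAct (invAct h₁ h₂ x) a := by
  funext i
  simp [invAct, rightAct, Matrix.mul_add, Matrix.add_mul]

variable [TopologicalSpace F] [IsTopologicalRing F]

theorem continuous_form_apply (i j : Fin 2) : Continuous fun x : VSq F => form (x i) (x j) := by
  simp only [form_eq]
  fun_prop

theorem continuous_invAct (h₁ h₂ : GL (Fin 2) F) : Continuous (invAct h₁ h₂) := by
  unfold invAct
  fun_prop

theorem continuous_rightAct (a : Matrix (Fin 2) (Fin 2) F) :
    Continuous fun x : VSq F => rightAct x a := by
  unfold rightAct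
  fun_prop

/-- The automorphism `x ↦ h₁⁻¹ x h₂` of the topological group `V²`. -/
def invActEquiv (h₁ h₂ : GL (Fin 2) F) : VSq F ≃ₜ+ VSq F where
  toFun := invAct h₁ h₂
  invFun := invAct h₁⁻¹ h₂⁻¹
  left_inv x := by rw [← invAct_mul, mul_inv_cancel, mul_inv_cancel, invAct_one]
  right_inv x := by rw [← invAct_mul, inv_mul_cancel, inv_mul_cancel, invAct_one]
  map_add' := invAct_add h₁ h₂
  continuous_toFun := continuous_invAct h₁ h₂
  continuous_invFun := continuous_invAct h₁⁻¹ h₂⁻¹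

/-- The homeomorphism `x ↦ x a` of `V²`. -/
def rightActHomeomorph (a : GL (Fin 2) F) : VSq F ≃ₜ VSq F where
  toFun x := rightAct x (a : Matrix (Fin 2) (Fin 2) F)
  invFun x := rightAct x ((a⁻¹ : GL (Fin 2) F) : Matrix (Fin 2) (Fin 2) F)
  left_inv x := by simp only [rightAct_rightAct, Units.mul_inv, rightAct_one]
  right_inv x := by simp only [rightAct_rightAct, Units.inv_mul, rightAct_one]
  continuous_toFun := continuous_rightAct _
  continuous_invFun := continuous_rightAct _

end Isometry

/-! ### Weil operators on a space of test functions -/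

section Weil

variable {F : Type*} [Field F] [TopologicalSpace F]

/-- A space of test functions on `V²` which is stable under the Weil representation, lies in the
domain of Fourier inversion and is not reduced to `0`. It stands for the Schwartz–Bruhat functions
of either kind of field. -/
structure IsTestSpace (ψ : AddChar F Circle) (m : Measure (VSq F)) (S : Set (VSq F → ℂ)) :
    Prop where
  continuous : ∀ f ∈ S, Continuous f
  integrable : ∀ f ∈ S, Integrable f m
  exists_ne_zero : ∃ f ∈ S, ∃ x, f x ≠ 0
  smul : ∀ (c : ℂ), ∀ f ∈ S, (fun x => c * f x) ∈ S
  comp_rightAct : ∀ a : GL (Fin 2) F, ∀ f ∈ S,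
    (fun x => f (rightAct x (a : Matrix (Fin 2) (Fin 2) F))) ∈ S
  comp_invAct : ∀ h₁ h₂ : GL (Fin 2) F, ∀ f ∈ S, (fun x => f (invAct h₁ h₂ x)) ∈ S
  siegel_mul : ∀ b : Matrix (Fin 2) (Fin 2) F, ∀ f ∈ S,
    (fun x => (ψ (2⁻¹ * ∑ i, ∑ j, b i j * form (x j) (x i)) : ℂ) * f x) ∈ S
  fourier : ∀ f ∈ S, fourier ψ m f ∈ S

variable {ψ : AddChar F Circle} {m : Measure (VSq F)} {S : Set (VSq F → ℂ)}

theorem fourier_const_mul (c : ℂ) (φ : VSq F → ℂ) (x : VSq F) :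
    fourier ψ m (fun y => c * φ y) x = c * fourier ψ m φ x := by
  simp only [fourier, mul_assoc, integral_const_mul]

theorem IsTestSpace.fourier_fourier (hS : IsTestSpace ψ m S) (hm : IsSelfDual ψ m)
    {f : VSq F → ℂ} (hf : f ∈ S) (x : VSq F) :
    ThetaWhittaker.fourier ψ m (ThetaWhittaker.fourier ψ m f) x = f (-x) :=
  hm.inversion f (hS.continuous f hf) (hS.integrable f hf) (hS.integrable _ (hS.fourier f hf)) x

variable [IsTopologicalRing F] [LocallyCompactSpace F]

theorem addEquivAddHaarChar_mul_fourier_comp_invAct [SecondCountableTopology F]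
    [m.IsAddHaarMeasure] {h₁ h₂ : GL (Fin 2) F}
    (h : GeneralLinearGroup.det h₁ = GeneralLinearGroup.det h₂) (φ : VSq F → ℂ) (x : VSq F) :
    (addEquivAddHaarChar (invActEquiv h₁ h₂) : ℂ) *
        fourier ψ m (fun y => φ (invAct h₁ h₂ y)) x = fourier ψ m φ (invAct h₁ h₂ x) := by
  set A := invActEquiv h₁ h₂
  let G : VSq F → ℂ := fun y => φ y * (ψ (∑ i, form (invAct h₁ h₂ x i) (y i)) : ℂ)
  have hG : fourier ψ m (fun y => φ (invAct h₁ h₂ y)) x = ∫ y, G y ∂m.map A := by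
    refine Eq.trans ?_ (A.toHomeomorph.measurableEmbedding.integral_map (μ := m) G).symm
    exact integral_congr_ae (ae_of_all _ fun y => by
      simp only [G, ← form_invAct h x y]
      rfl)
  calc (addEquivAddHaarChar A : ℂ) * fourier ψ m (fun y => φ (invAct h₁ h₂ y)) x
      = ∫ y, G y ∂(addEquivAddHaarChar A • m.map A) := by
        rw [hG, integral_smul_nnreal_measure]
        rfl
    _ = fourier ψ m φ (invAct h₁ h₂ x) := by
        rw [addEquivAddHaarChar_smul_map]
        rfl

/-- Both sides agree up to a positive constant; applying the Fourier transform twice gives back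
the function up to sign, so the constant is `1`. -/
theorem IsTestSpace.fourier_comp_invAct [SecondCountableTopology F] (hS : IsTestSpace ψ m S)
    (hm : IsSelfDual ψ m) {h₁ h₂ : GL (Fin 2) F}
    (h : GeneralLinearGroup.det h₁ = GeneralLinearGroup.det h₂) (φ : VSq F → ℂ) (x : VSq F) :
    ThetaWhittaker.fourier ψ m (fun y => φ (invAct h₁ h₂ y)) x =
      ThetaWhittaker.fourier ψ m φ (invAct h₁ h₂ x) := by
  have := hm.haar
  set c := addEquivAddHaarChar (invActEquiv h₁ h₂)
  have scale : ∀ (φ : VSq F → ℂ) x, (c : ℂ) * ThetaWhittaker.fourier ψ m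
      (fun y => φ (invAct h₁ h₂ y)) x = ThetaWhittaker.fourier ψ m φ (invAct h₁ h₂ x) :=
    fun φ x => addEquivAddHaarChar_mul_fourier_comp_invAct h φ x
  suffices hc : c = 1 by simpa [hc] using scale φ x
  obtain ⟨f, hf, x₀, hx₀⟩ := hS.exists_ne_zero
  obtain ⟨x₁, hx₁⟩ := (invActEquiv h₁ h₂).surjective x₀
  have twice : (c : ℂ) * (c * f x₀) = f x₀ :=
    calc (c : ℂ) * (c * f x₀)
        = c * (c * ThetaWhittaker.fourier ψ m (ThetaWhittaker.fourier ψ m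
            fun y => f (invAct h₁ h₂ y)) (-x₁)) := by
          rw [hS.fourier_fourier hm (hS.comp_invAct h₁ h₂ f hf), neg_neg, ← hx₁]
          rfl
      _ = c * ThetaWhittaker.fourier ψ m
            (fun y => ThetaWhittaker.fourier ψ m f (invAct h₁ h₂ y)) (-x₁) := by
          rw [← fourier_const_mul]
          simp only [scale]
      _ = ThetaWhittaker.fourier ψ m (ThetaWhittaker.fourier ψ m f) (invAct h₁ h₂ (-x₁)) :=
          scale _ _
      _ = f x₀ := by
          rw [hS.fourier_fourier hm hf, ← hx₁]
          exact congrArg f ((congrArg Neg.neg (map_neg (invActEquiv h₁ h₂) x₁)).trans (neg_neg _))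
  have hcc : (c : ℂ) * c = 1 := mul_right_cancel₀ hx₀ (by rw [mul_assoc, twice, one_mul])
  have hsq : c ^ 2 = 1 := by rw [sq]; exact_mod_cast hcc
  exact (pow_eq_one_iff_of_nonneg zero_le two_ne_zero).mp hsq

variable {s : Matrix (Fin 2 ⊕ Fin 2) (Fin 2 ⊕ Fin 2) F} {T : (VSq F → ℂ) → (VSq F → ℂ)}

theorem IsTestSpace.weilOperator_mem (hS : IsTestSpace ψ m S) (hT : IsWeilOperator ψ m s T)
    {f : VSq F → ℂ} (hf : f ∈ S) : T f ∈ S := by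
  induction hT generalizing f with
  | levi a => exact hS.smul _ _ (hS.comp_rightAct a f hf)
  | siegel b => exact hS.siegel_mul b f hf
  | weyl => exact hS.fourier f hf
  | comp _ _ ih₁ ih₂ => exact ih₁ (ih₂ hf)

theorem IsTestSpace.weilOperator_comp_invAct [SecondCountableTopology F] (hS : IsTestSpace ψ m S)
    (hm : IsSelfDual ψ m) (hT : IsWeilOperator ψ m s T) {h₁ h₂ : GL (Fin 2) F}
    (h : GeneralLinearGroup.det h₁ = GeneralLinearGroup.det h₂) (f : VSq F → ℂ) :
    T (fun x => f (invAct h₁ h₂ x)) = fun x => T f (invAct h₁ h₂ x) := by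
  induction hT generalizing f with
  | levi a => simp only [invAct_rightAct]
  | siegel b => simp only [form_invAct h]
  | weyl => exact funext (hS.fourier_comp_invAct hm h f)
  | comp _ _ ih₁ ih₂ => simp only [Function.comp_apply, ih₂, ih₁]

/-- The point of `V²` at which the theta kernel is evaluated. -/
def basePoint (F : Type*) [Field F] : VSq F := ![!![0, -1; 0, 0], 1]

/-- The similitude part of `ω(g, h₁, h₂)` can be moved into the test function, after which `ω`
commutes with the isometry `(h₁, h₂)`. -/
theorem IsTestSpace.exists_integrand_eq [SecondCountableTopology F] (hS : IsTestSpace ψ m S)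
    (hm : IsSelfDual ψ m) {f : VSq F → ℂ} (hf : f ∈ S) (g : GSp4 F) (W₁ W₂ : GL (Fin 2) F → ℂ) :
    ∃ φ ∈ S, ∀ h : DetPairs F, integrand ψ m W₁ W₂ f g h =
      W₁ (eps * h.1.1 * diag g.nu 1) * W₂ h.1.2 * φ (invAct h.1.1 h.1.2 (basePoint F)) := by
  have hT := weilOp_spec ψ m g.toSp g.toSp_mem
  refine ⟨_, hS.smul (((absF g.nu ^ 2)⁻¹ : ℝ) : ℂ) _
    (hS.weilOperator_mem hT (hS.comp_invAct (diag g.nu 1) 1 f hf)), fun h => ?_⟩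
  have hcomm := hS.weilOperator_comp_invAct hm hT h.2 fun x => f (invAct (diag g.nu 1) 1 x)
  simp only [← invAct_mul, mul_one] at hcomm
  rw [integrand, extWeil, hcomm]
  rfl

end Weil

/-! ### The quotient by `N̂` -/

section Invariance

variable {F : Type*} [Field F]

theorem eps_mul_diag_mul_unip_mul (z : Fˣ) (x : F) (g : GL (Fin 2) F) :
    eps * (diag z z * unip x * g) = diag z z * unip (-x) * (eps * g) := by
  simp only [← mul_assoc]
  congr 1
  ext i j
  fin_cases i <;> fin_cases j <;> simp [eps, diag, unip, Matrix.mul_apply, Fin.sum_univ_two]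

theorem invAct_self_eq {g : GL (Fin 2) F} {x : VSq F}
    (h : ∀ i, Commute (x i) (g : Matrix (Fin 2) (Fin 2) F)) : invAct g g x = x := by
  funext i
  rw [invAct, Matrix.mul_assoc, (h i).eq, ← Matrix.mul_assoc, Units.inv_mul, Matrix.one_mul]

theorem invAct_basePoint (z : Fˣ) (x : F) :
    invAct (diag z z * unip x) (diag z z * unip x) (basePoint F) = basePoint F := by
  refine invAct_self_eq fun i => ?_
  fin_cases i
  · ext i j
    fin_cases i <;> fin_cases j <;>
      simp [basePoint, diag, unip, Matrix.mul_apply, Fin.sum_univ_two]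
  · exact Commute.one_left _

/-- Equivariance under scalar and upper unipotent matrices: the part of being a Whittaker function
with central character `ω` that makes the integrand `N̂(F)`-invariant. -/
def IsWhittaker (ψ : AddChar F Circle) (ω : Fˣ →* ℂˣ) (W : GL (Fin 2) F → ℂ) : Prop :=
  ∀ (z : Fˣ) (x : F) (g : GL (Fin 2) F),
    W (diag z z * unip x * g) = (ω z : ℂ) * (ψ x : ℂ) * W g

variable {ψ : AddChar F Circle} {ω₁ ω₂ : Fˣ →* ℂˣ} {W₁ W₂ : GL (Fin 2) F → ℂ}

theorem IsWhittaker.mul_left_invariant (h₁ : IsWhittaker ψ ω₁ W₁) (h₂ : IsWhittaker ψ ω₂ W₂)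
    (hω : ω₁ * ω₂ = 1) (d : GL (Fin 2) F) (φ : VSq F → ℂ) {n : DetPairs F} (hn : n ∈ NHat F)
    (h : DetPairs F) :
    W₁ (eps * (n * h).1.1 * d) * W₂ (n * h).1.2 *
        φ (invAct (n * h).1.1 (n * h).1.2 (basePoint F)) =
      W₁ (eps * h.1.1 * d) * W₂ h.1.2 * φ (invAct h.1.1 h.1.2 (basePoint F)) := by
  obtain ⟨z, x, hz⟩ := hn
  have hfst : (n * h).1.1 = diag z z * unip x * h.1.1 := by
    rw [Subgroup.coe_mul, Prod.fst_mul, hz]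
  have hsnd : (n * h).1.2 = diag z z * unip x * h.1.2 := by
    rw [Subgroup.coe_mul, Prod.snd_mul, hz]
  have hωz : (ω₁ z : ℂ) * ω₂ z = 1 := by
    rw [← Units.val_mul, ← MonoidHom.mul_apply, hω, MonoidHom.one_apply, Units.val_one]
  have hψx : (ψ (-x) : ℂ) * ψ x = 1 := by
    rw [← Circle.coe_mul, ← AddChar.map_add_eq_mul, neg_add_cancel, AddChar.map_zero_eq_one,
      Circle.coe_one]
  rw [hfst, hsnd, invAct_mul, invAct_basePoint, eps_mul_diag_mul_unip_mul, mul_assoc _ _ d, h₁, h₂]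
  linear_combination (W₁ (eps * h.1.1 * d) * W₂ h.1.2 * φ (invAct h.1.1 h.1.2 (basePoint F))) *
    ((ψ (-x) : ℂ) * ψ x * hωz + hψx)

theorem NHatQuot.mk_eq {n : DetPairs F} (hn : n ∈ NHat F) (h : DetPairs F) :
    NHatQuot.mk F (n * h) = NHatQuot.mk F h :=
  Quotient.sound <| QuotientGroup.rightRel_apply.mpr <| by
    simpa only [_root_.mul_inv_rev, mul_inv_cancel_left] using (NHat F).inv_mem hn

theorem NHatQuot.exists_lift {Φ : DetPairs F → ℂ} (hΦ : ∀ n ∈ NHat F, ∀ h, Φ (n * h) = Φ h) :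
    ∃ Φ' : NHatQuot F → ℂ, ∀ h, Φ' (NHatQuot.mk F h) = Φ h :=
  ⟨Quotient.lift Φ fun a b hab => by
    rw [← hΦ _ (QuotientGroup.rightRel_apply.mp hab) a, inv_mul_cancel_right], fun _ => rfl⟩

theorem NHatQuot.mk_surjective : Function.Surjective (NHatQuot.mk F) :=
  Quotient.mk_surjective

variable [TopologicalSpace F]

theorem NHatQuot.isQuotientMap_mk : Topology.IsQuotientMap (NHatQuot.mk F) :=
  isQuotientMap_quotient_mk'

theorem continuous_invAct_basePoint [IsTopologicalRing F] :
    Continuous fun h : DetPairs F => invAct h.1.1 h.1.2 (basePoint F) := by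
  have hfst : Continuous fun h : DetPairs F =>
      ((h.1.1⁻¹ : GL (Fin 2) F) : Matrix (Fin 2) (Fin 2) F) :=
    Units.continuous_val.comp (continuous_fst.comp continuous_subtype_val).inv
  have hsnd : Continuous fun h : DetPairs F => (h.1.2 : Matrix (Fin 2) (Fin 2) F) :=
    Units.continuous_val.comp (continuous_snd.comp continuous_subtype_val)
  exact continuous_pi fun i => (hfst.matrix_mul continuous_const).matrix_mul hsnd

theorem IsTestSpace.exists_continuous_lift [IsTopologicalRing F] [LocallyCompactSpace F]
    [SecondCountableTopology F] {m : Measure (VSq F)} {S : Set (VSq F → ℂ)}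
    (hS : IsTestSpace ψ m S) (hm : IsSelfDual ψ m) {f : VSq F → ℂ} (hf : f ∈ S) (g : GSp4 F)
    (hW₁ : Continuous W₁) (hW₂ : Continuous W₂) (h₁ : IsWhittaker ψ ω₁ W₁)
    (h₂ : IsWhittaker ψ ω₂ W₂) (hω : ω₁ * ω₂ = 1) :
    ∃ φ ∈ S, ∃ Φ : NHatQuot F → ℂ, Continuous Φ ∧
      (∀ h, Φ (NHatQuot.mk F h) = integrand ψ m W₁ W₂ f g h) ∧
      ∀ h, Φ (NHatQuot.mk F h) = W₁ (eps * h.1.1 * diag g.nu 1) * W₂ h.1.2 *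
        φ (invAct h.1.1 h.1.2 (basePoint F)) := by
  obtain ⟨φ, hφ, hφeq⟩ := hS.exists_integrand_eq hm hf g W₁ W₂
  obtain ⟨Φ, hΦ⟩ := NHatQuot.exists_lift
    (Φ := fun h : DetPairs F => W₁ (eps * h.1.1 * diag g.nu 1) * W₂ h.1.2 *
      φ (invAct h.1.1 h.1.2 (basePoint F)))
    fun _ hn h => h₁.mul_left_invariant h₂ hω (diag g.nu 1) φ hn h
  refine ⟨φ, hφ, Φ, NHatQuot.isQuotientMap_mk.continuous_iff.mpr ?_,
    fun h => (hΦ h).trans (hφeq h).symm, hΦ⟩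
  have hfst : Continuous fun h : DetPairs F => h.1.1 := continuous_fst.comp continuous_subtype_val
  have hsnd : Continuous fun h : DetPairs F => h.1.2 := continuous_snd.comp continuous_subtype_val
  exact (funext hΦ : Φ ∘ NHatQuot.mk F = _) ▸
    ((hW₁.comp ((continuous_const.mul hfst).mul continuous_const)).mul (hW₂.comp hsnd)).mul
      ((hS.continuous φ hφ).comp continuous_invAct_basePoint)

end Invariance

/-! ### Compact subsets of `GL₂` and of the group of pairs -/

section Compact

theorem isClosed_detPairs {F : Type*} [Field F] [TopologicalSpace F] [IsTopologicalRing F]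
    [T2Space F] : IsClosed (DetPairs F : Set (GL (Fin 2) F × GL (Fin 2) F)) := by
  have : (DetPairs F : Set (GL (Fin 2) F × GL (Fin 2) F)) =
      {h | (h.1 : Matrix (Fin 2) (Fin 2) F).det = (h.2 : Matrix (Fin 2) (Fin 2) F).det} :=
    Set.ext fun h => Units.ext_iff
  rw [this]
  exact isClosed_eq (Units.continuous_val.comp continuous_fst).matrix_det
    (Units.continuous_val.comp continuous_snd).matrix_det

open scoped Matrix.Norms.Elementwise

variable {F : Type*} [NormedField F]

/-- The invertible matrices `g` with `‖g‖ ≤ R` and `‖g⁻¹‖ ≤ R` for the maximum norm. -/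
def boundedGL (F : Type*) [NormedField F] (R : ℝ) : Set (GL (Fin 2) F) :=
  {g | ‖(g : Matrix (Fin 2) (Fin 2) F)‖ ≤ R ∧
    ‖((g⁻¹ : GL (Fin 2) F) : Matrix (Fin 2) (Fin 2) F)‖ ≤ R}

/-- The pairs in `DetPairs F` with both components in `boundedGL F R`. -/
def boundedPairs (F : Type*) [NormedField F] (R : ℝ) : Set (DetPairs F) :=
  {h | h.1.1 ∈ boundedGL F R ∧ h.1.2 ∈ boundedGL F R}

theorem boundedGL_mono {R S : ℝ} (h : R ≤ S) : boundedGL F R ⊆ boundedGL F S :=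
  fun _ hg => ⟨hg.1.trans h, hg.2.trans h⟩

theorem inv_mem_boundedGL {R : ℝ} {g : GL (Fin 2) F} (hg : g ∈ boundedGL F R) :
    g⁻¹ ∈ boundedGL F R :=
  ⟨hg.2, by rw [inv_inv]; exact hg.1⟩

theorem norm_matrix_mul_le (A B : Matrix (Fin 2) (Fin 2) F) : ‖A * B‖ ≤ 2 * (‖A‖ * ‖B‖) := by
  refine (Matrix.norm_le_iff (by positivity)).mpr fun i j => ?_
  have entry : ∀ k, ‖A i k * B k j‖ ≤ ‖A‖ * ‖B‖ := fun k => by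
    rw [norm_mul]
    exact mul_le_mul (Matrix.norm_entry_le_entrywise_sup_norm A)
      (Matrix.norm_entry_le_entrywise_sup_norm B) (norm_nonneg _) (norm_nonneg _)
  rw [Matrix.mul_apply, Fin.sum_univ_two]
  linarith [norm_add_le (A i 0 * B 0 j) (A i 1 * B 1 j), entry 0, entry 1]

theorem mul_mem_boundedGL {R S : ℝ} {g h : GL (Fin 2) F} (hg : g ∈ boundedGL F R)
    (hh : h ∈ boundedGL F S) : g * h ∈ boundedGL F (2 * (R * S)) := by
  have hR : 0 ≤ R := (norm_nonneg _).trans hg.1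
  constructor
  · refine (norm_matrix_mul_le _ _).trans ?_
    gcongr
    exacts [hg.1, hh.1]
  · rw [_root_.mul_inv_rev, mul_comm R S]
    refine (norm_matrix_mul_le _ _).trans ?_
    gcongr
    exacts [(norm_nonneg _).trans hh.1, hh.2, hg.2]

variable [ProperSpace F]

theorem isCompact_boundedGL (R : ℝ) : IsCompact (boundedGL F R) := by
  have compact : IsCompact {A : Matrix (Fin 2) (Fin 2) F | ‖A‖ ≤ R} := by
    have hball : IsCompact (Metric.closedBall (0 : Fin 2 → Fin 2 → F) R) :=
      isCompact_closedBall _ _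
    have heq : Metric.closedBall (0 : Fin 2 → Fin 2 → F) R = {A | ‖A‖ ≤ R} :=
      Set.ext fun _ => mem_closedBall_zero_iff
    rw [heq] at hball
    exact hball
  exact Units.isClosedEmbedding_embedProduct.isCompact_preimage <|
    compact.prod <| MulOpposite.opHomeomorph.symm.isCompact_preimage.mpr compact

theorem isCompact_boundedPairs (R : ℝ) : IsCompact (boundedPairs F R) :=
  isClosed_detPairs.isClosedEmbedding_subtypeVal.isCompact_preimage
    ((isCompact_boundedGL R).prod (isCompact_boundedGL R))

end Compact

/-! ### Additive characters of an ultrametric field -/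

section NonarchCharacter

/-- While it stays near `1`, squaring multiplies the distance to `1` by at least `3 / 2`. -/
theorem eq_one_of_forall_norm_pow_sub_one_lt {z : ℂ} (h : ∀ n : ℕ, ‖z ^ n - 1‖ < 1 / 2) :
    z = 1 := by
  by_contra hz
  have hpos : 0 < ‖z - 1‖ := norm_pos_iff.mpr (sub_ne_zero.mpr hz)
  have growth : ∀ k : ℕ, (3 / 2 : ℝ) ^ k * ‖z - 1‖ ≤ ‖z ^ 2 ^ k - 1‖ := by
    intro k
    induction k with
    | zero => simp
    | succ k ih =>
      have hfactor : z ^ 2 ^ (k + 1) - 1 = (z ^ 2 ^ k - 1) * (z ^ 2 ^ k + 1) := by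
        rw [pow_succ 2 k, pow_mul]
        ring
      have hplus : 3 / 2 ≤ ‖z ^ 2 ^ k + 1‖ := by
        have htwo : ‖(z ^ 2 ^ k + 1) - (z ^ 2 ^ k - 1)‖ = 2 := by
          rw [add_sub_sub_cancel, one_add_one_eq_two, Complex.norm_two]
        linarith [h (2 ^ k), norm_sub_le (z ^ 2 ^ k + 1) (z ^ 2 ^ k - 1)]
      rw [hfactor, norm_mul, pow_succ]
      nlinarith [norm_nonneg (z ^ 2 ^ k - 1)]
  obtain ⟨k, hk⟩ := pow_unbounded_of_one_lt (1 / ‖z - 1‖) (by norm_num : (1 : ℝ) < 3 / 2)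
  rw [div_lt_iff₀ hpos] at hk
  linarith [growth k, h (2 ^ k)]

theorem exists_forall_norm_lt_eq_one {G : Type*} [SeminormedAddCommGroup G] [IsUltrametricDist G]
    {ψ : AddChar G Circle} (hψ : Continuous ψ) : ∃ δ > 0, ∀ x : G, ‖x‖ < δ → ψ x = 1 := by
  have hcont : Continuous fun x => (ψ x : ℂ) := continuous_subtype_val.comp hψ
  obtain ⟨δ, hδ, hball⟩ := Metric.continuous_iff.mp hcont 0 (1 / 2) (by norm_num)
  refine ⟨δ, hδ, fun x hx => Circle.ext (eq_one_of_forall_norm_pow_sub_one_lt fun n => ?_)⟩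
  have hnx : dist (n • x) 0 < δ := by
    rw [dist_zero_right]
    exact (IsUltrametricDist.norm_nsmul_le x n).trans_lt hx
  simpa only [dist_eq_norm, AddChar.map_nsmul_eq_pow, AddChar.map_zero_eq_one, Circle.coe_one,
    Circle.coe_pow] using hball (n • x) hnx

theorem norm_le_of_forall_eq_one {F : Type*} [NormedField F] {ψ : AddChar F Circle} {b : F}
    (hb : ψ b ≠ 1) {ρ : ℝ} (hρ : 0 < ρ) {a : F} (h : ∀ x, ‖x‖ ≤ ρ → ψ (a * x) = 1) :
    ‖a‖ ≤ ‖b‖ / ρ := by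
  by_contra! hlt
  have ha : 0 < ‖a‖ := lt_of_le_of_lt (by positivity) hlt
  rw [div_lt_iff₀ hρ] at hlt
  refine hb ?_
  rw [← mul_inv_cancel_left₀ (norm_pos_iff.mp ha) b]
  refine h _ ?_
  rw [norm_mul, norm_inv, inv_mul_le_iff₀ ha]
  exact hlt.le

end NonarchCharacter

/-! ### Schwartz–Bruhat functions -/

section SchwartzBruhat

open scoped Matrix.Norms.Elementwise

theorem exists_forall_norm_lt_add_eq {X Y : Type*} [SeminormedAddCommGroup X] [Zero Y] {f : X → Y}
    (hf : IsLocallyConstant f) (hc : HasCompactSupport f) :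
    ∃ δ > 0, ∀ x u, ‖u‖ < δ → f (x + u) = f x := by
  obtain ⟨δ, hδ, hball⟩ := lebesgue_number_lemma_of_metric (s := tsupport f)
    (c := fun v : Y => f ⁻¹' {v}) hc (fun v => hf.isOpen_fiber v)
    (fun x _ => Set.mem_iUnion.mpr ⟨f x, rfl⟩)
  have near_support : ∀ x ∈ tsupport f, ∀ u, ‖u‖ < δ → f (x + u) = f x := by
    intro x hx u hu
    obtain ⟨v, hv⟩ := hball x hx
    have hxu : f (x + u) = v := hv (by rwa [mem_ball_iff_norm, add_sub_cancel_left])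
    exact hxu.trans (hv (Metric.mem_ball_self hδ)).symm
  refine ⟨δ, hδ, fun x u hu => ?_⟩
  by_cases hx : x ∈ tsupport f
  · exact near_support x hx u hu
  by_cases hxu : x + u ∈ tsupport f
  · have := near_support _ hxu (-u) (by rwa [norm_neg])
    rwa [add_neg_cancel_right, eq_comm] at this
  · rw [image_eq_zero_of_notMem_tsupport hx, image_eq_zero_of_notMem_tsupport hxu]

theorem isLocallyConstant_of_forall_norm_lt_add_eq {X Y : Type*} [SeminormedAddCommGroup X]
    {f : X → Y} {δ : ℝ} (hδ : 0 < δ) (h : ∀ x u, ‖u‖ < δ → f (x + u) = f x) :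
    IsLocallyConstant f := by
  rw [IsLocallyConstant.iff_eventually_eq]
  intro x
  filter_upwards [Metric.ball_mem_nhds x hδ] with y hy
  rw [← h x (y - x) (mem_ball_iff_norm.mp hy), add_sub_cancel]

theorem isLocallyConstant_addChar {G : Type*} [SeminormedAddCommGroup G] [IsUltrametricDist G]
    {ψ : AddChar G Circle} (hψ : Continuous ψ) : IsLocallyConstant ψ := by
  obtain ⟨η, hη, hψη⟩ := exists_forall_norm_lt_eq_one hψ
  exact isLocallyConstant_of_forall_norm_lt_add_eq hη fun x u hu => by
    rw [AddChar.map_add_eq_mul, hψη u hu, mul_one]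

variable {F : Type*}

section NormedField

variable [NormedField F]

theorem norm_entry_le (x : VSq F) (k i j : Fin 2) : ‖x k i j‖ ≤ ‖x‖ :=
  (Matrix.norm_entry_le_entrywise_sup_norm (x k)).trans (norm_le_pi_norm x k)

theorem norm_vSq_le {x : VSq F} {R : ℝ} (hR : 0 ≤ R) (h : ∀ k i j, ‖x k i j‖ ≤ R) : ‖x‖ ≤ R :=
  (pi_norm_le_iff_of_nonneg hR).mpr fun k => (Matrix.norm_le_iff hR).mpr (h k)

theorem norm_form_le (a b : Matrix (Fin 2) (Fin 2) F) : ‖form a b‖ ≤ 4 * (‖a‖ * ‖b‖) := by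
  have entry : ∀ i j k l, ‖a i j * b k l‖ ≤ ‖a‖ * ‖b‖ := fun i j k l => by
    rw [norm_mul]
    exact mul_le_mul (Matrix.norm_entry_le_entrywise_sup_norm a)
      (Matrix.norm_entry_le_entrywise_sup_norm b) (norm_nonneg _) (norm_nonneg _)
  rw [form_eq]
  linarith [norm_sub_le (a 0 0 * b 1 1 + a 1 1 * b 0 0 - a 0 1 * b 1 0) (a 1 0 * b 0 1),
    norm_sub_le (a 0 0 * b 1 1 + a 1 1 * b 0 0) (a 0 1 * b 1 0),
    norm_add_le (a 0 0 * b 1 1) (a 1 1 * b 0 0),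
    entry 0 0 1 1, entry 1 1 0 0, entry 0 1 1 0, entry 1 0 0 1]

theorem norm_sum_form_le (x y : VSq F) : ‖∑ i, form (x i) (y i)‖ ≤ 8 * (‖x‖ * ‖y‖) := by
  have summand : ∀ i, ‖form (x i) (y i)‖ ≤ 4 * (‖x‖ * ‖y‖) := fun i => by
    refine (norm_form_le _ _).trans ?_
    gcongr <;> exact norm_le_pi_norm _ i
  rw [Fin.sum_univ_two]
  linarith [norm_add_le (form (x 0) (y 0)) (form (x 1) (y 1)), summand 0, summand 1]

theorem exists_sum_form_eq (k i j : Fin 2) (t : F) :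
    ∃ u : VSq F, ‖u‖ ≤ ‖t‖ ∧ ∀ x : VSq F,
      ∑ l, form (x l) (u l) = x k i j * t ∨ ∑ l, form (x l) (u l) = x k i j * (-t) := by
  refine ⟨fun l => Matrix.of fun i' j' => if l = k ∧ i' ≠ i ∧ j' ≠ j then t else 0,
    norm_vSq_le (norm_nonneg _) fun l i' j' => ?_, fun x => ?_⟩
  · rw [Matrix.of_apply]
    split_ifs <;> simp
  · fin_cases k <;> fin_cases i <;> fin_cases j <;> simp [form_eq]

theorem fourier_eq_mul_of_forall_add_eq {ψ : AddChar F Circle} {m : Measure (VSq F)}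
    [m.IsAddHaarMeasure] {f : VSq F → ℂ} {u : VSq F} (hu : ∀ y, f (y + u) = f y) (x : VSq F) :
    fourier ψ m f x = (ψ (∑ i, form (x i) (u i)) : ℂ) * fourier ψ m f x :=
  calc fourier ψ m f x
      = ∫ y, f (y + u) * (ψ (∑ i, form (x i) ((y + u) i)) : ℂ) ∂m :=
        (integral_add_right_eq_self (μ := m)
          (fun y => f y * (ψ (∑ i, form (x i) (y i)) : ℂ)) u).symm
    _ = ∫ y, (ψ (∑ i, form (x i) (u i)) : ℂ) * (f y * (ψ (∑ i, form (x i) (y i)) : ℂ)) ∂m := by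
        refine integral_congr_ae (ae_of_all _ fun y => ?_)
        simp only [hu, Pi.add_apply, form_add_right, Finset.sum_add_distrib,
          AddChar.map_add_eq_mul, Circle.coe_mul]
        ring
    _ = (ψ (∑ i, form (x i) (u i)) : ℂ) * fourier ψ m f x := integral_const_mul _ _

variable [ProperSpace F]

theorem hasCompactSupport_of_forall_norm_le {f : VSq F → ℂ} {R : ℝ}
    (h : ∀ x, f x ≠ 0 → ‖x‖ ≤ R) : HasCompactSupport f := by
  have hball : IsCompact (Metric.closedBall (0 : Fin 2 → Fin 2 → Fin 2 → F) R) :=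
    isCompact_closedBall _ _
  have heq : Metric.closedBall (0 : Fin 2 → Fin 2 → Fin 2 → F) R = {x | ‖x‖ ≤ R} :=
    Set.ext fun _ => mem_closedBall_zero_iff
  rw [heq] at hball
  exact HasCompactSupport.intro (K := {x : VSq F | ‖x‖ ≤ R}) hball
    fun x hx => not_not.mp fun hne => hx (h x hne)

theorem IsSchwartzBruhat.hasCompactSupport_fourier {ψ : AddChar F Circle}
    {m : Measure (VSq F)} [m.IsAddHaarMeasure] {f : VSq F → ℂ} (hψ : ψ ≠ 1)
    (hf : IsSchwartzBruhat f) : HasCompactSupport (fourier ψ m f) := by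
  obtain ⟨b, hb⟩ : ∃ b, ψ b ≠ 1 := DFunLike.exists_ne hψ
  obtain ⟨δ, hδ, hfδ⟩ := exists_forall_norm_lt_add_eq hf.1 hf.2
  refine hasCompactSupport_of_forall_norm_le (R := ‖b‖ / (δ / 2)) fun x hx => ?_
  have pairing_eq_one : ∀ u : VSq F, ‖u‖ < δ → ψ (∑ l, form (x l) (u l)) = 1 := fun u hu => by
    have := fourier_eq_mul_of_forall_add_eq (ψ := ψ) (m := m) (fun y => hfδ y u hu) x
    exact Circle.ext (mul_right_cancel₀ hx (this.symm.trans (one_mul _).symm))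
  refine norm_vSq_le (by positivity) fun k i j => ?_
  refine norm_le_of_forall_eq_one hb (by positivity) fun t ht => ?_
  obtain ⟨u, hut, hux⟩ := exists_sum_form_eq k i j t
  have hu := pairing_eq_one u (by linarith)
  rcases hux x with h | h
  · rwa [h] at hu
  · rwa [h, mul_neg, AddChar.map_neg_eq_inv, inv_eq_one] at hu

end NormedField

section Ultrametric

variable [NormedField F] [IsUltrametricDist F] {ψ : AddChar F Circle} {m : Measure (VSq F)}
  {f : VSq F → ℂ}

theorem IsSchwartzBruhat.isLocallyConstant_fourier (hψ : Continuous ψ) (hf : IsSchwartzBruhat f) :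
    IsLocallyConstant (fourier ψ m f) := by
  obtain ⟨η, hη, hψη⟩ := exists_forall_norm_lt_eq_one hψ
  obtain ⟨R, hR, hfR⟩ := (IsCompact.isBounded hf.2).exists_pos_norm_le
  refine isLocallyConstant_of_forall_norm_lt_add_eq (δ := η / (8 * R)) (by positivity)
    fun x u hu => integral_congr_ae (ae_of_all _ fun y => ?_)
  dsimp only
  by_cases hy : f y = 0
  · rw [hy, zero_mul, zero_mul]
  have huy : ‖∑ i, form (u i) (y i)‖ < η := by
    refine (norm_sum_form_le u y).trans_lt ?_
    rw [lt_div_iff₀ (by positivity)] at hu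
    nlinarith [hfR y (subset_tsupport f hy), norm_nonneg u]
  simp only [Pi.add_apply, form_add_left, Finset.sum_add_distrib, AddChar.map_add_eq_mul,
    hψη _ huy, mul_one]

theorem exists_isSchwartzBruhat_ne_zero [ProperSpace F] :
    ∃ f : VSq F → ℂ, IsSchwartzBruhat f ∧ ∃ x, f x ≠ 0 := by
  classical
  let f : VSq F → ℂ := fun x => if ∀ k i j, ‖x k i j‖ ≤ 1 then 1 else 0
  have unit_ball_add : ∀ x u : VSq F, ‖u‖ < 1 → (∀ k i j, ‖x k i j‖ ≤ 1) →
      ∀ k i j, ‖(x + u) k i j‖ ≤ 1 := fun x u hu hx k i j =>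
    (IsUltrametricDist.norm_add_le_max _ _).trans
      (max_le (hx k i j) ((norm_entry_le u k i j).trans hu.le))
  refine ⟨f, ⟨?_, ?_⟩, 0, by simp [f]⟩
  · refine isLocallyConstant_of_forall_norm_lt_add_eq one_pos fun x u hu =>
      if_congr ⟨fun h => ?_, unit_ball_add x u hu⟩ rfl rfl
    have := unit_ball_add (x + u) (-u) (by rwa [norm_neg]) h
    rwa [add_neg_cancel_right] at this
  · exact hasCompactSupport_of_forall_norm_le fun x hx =>
      norm_vSq_le zero_le_one (of_not_not fun h => hx (if_neg h))

theorem isTestSpace_schwartzBruhat [ProperSpace F] (hψ : Continuous ψ) (hψ1 : ψ ≠ 1)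
    [m.IsAddHaarMeasure] : IsTestSpace ψ m {f | IsSchwartzBruhat f} where
  continuous f hf := hf.1.continuous
  integrable f hf := hf.1.continuous.integrable_of_hasCompactSupport hf.2
  exists_ne_zero := exists_isSchwartzBruhat_ne_zero
  smul c f hf := ⟨hf.1.comp (c * ·), hf.2.mul_left⟩
  comp_rightAct a f hf := ⟨hf.1.comp_continuous (continuous_rightAct _),
    hf.2.comp_homeomorph (rightActHomeomorph a)⟩
  comp_invAct h₁ h₂ f hf := ⟨hf.1.comp_continuous (continuous_invAct h₁ h₂),
    hf.2.comp_homeomorph (invActEquiv h₁ h₂).toHomeomorph⟩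
  siegel_mul b f hf := by
    have hcont : Continuous fun x : VSq F => 2⁻¹ * ∑ i, ∑ j, b i j * form (x j) (x i) := by
      have := fun i j => continuous_form_apply (F := F) j i
      fun_prop
    exact ⟨(((isLocallyConstant_addChar hψ).comp_continuous hcont).comp
      (fun z : Circle => (z : ℂ))).comp₂ hf.1 (· * ·), hf.2.mul_left⟩
  fourier f hf := ⟨hf.isLocallyConstant_fourier hψ, hf.hasCompactSupport_fourier hψ1⟩

end Ultrametric

end SchwartzBruhat

section Integrable

theorem integrable_of_support_subset_isCompact {X E : Type*} [TopologicalSpace X]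
    [MeasurableSpace X] [OpensMeasurableSpace X] [NormedAddCommGroup E]
    [SecondCountableTopologyEither X E] {μ : Measure X} {Φ : X → E} (hΦ : Continuous Φ)
    {C : Set X} (hC : IsCompact C) (hμC : μ C < ⊤) (h : Function.support Φ ⊆ C) :
    Integrable Φ μ := by
  obtain ⟨B, hB⟩ := (hC.image hΦ.norm).isBounded.exists_norm_le
  have hmeas : MeasurableSet (Function.support Φ) :=
    (isOpen_ne_fun hΦ continuous_const).measurableSet
  refine (integrableOn_iff_integrable_of_support_subset subset_rfl).mp
    (Measure.integrableOn_of_bounded (M := B) ((measure_mono h).trans_lt hμC).ne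
      hΦ.aestronglyMeasurable ?_)
  refine (ae_restrict_iff' hmeas).mpr (ae_of_all _ fun x hx => ?_)
  simpa only [norm_norm] using hB _ (Set.mem_image_of_mem _ (h hx))

end Integrable

/-! ### Whittaker functions of smooth representations -/

section Smooth

theorem isLocallyConstant_rep_apply {k G V : Type*} [CommRing k] [Group G] [TopologicalSpace G]
    [ContinuousMul G] [AddCommGroup V] [Module k V] {π : Representation k G V} {v : V}
    (hv : IsOpen {g : G | π g v = v}) : IsLocallyConstant fun g => π g v := by
  refine (IsLocallyConstant.iff_eventually_eq _).mpr fun g => ?_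
  have hg : Filter.Tendsto (fun g' => g⁻¹ * g') (𝓝 g) (𝓝 1) := by
    simpa only [inv_mul_cancel] using (continuous_const_mul g⁻¹).tendsto g
  filter_upwards [hg (hv.mem_nhds (by simp))] with g' hg'
  rw [← mul_inv_cancel_left g g', map_mul, Module.End.mul_apply]
  exact congrArg (π g) hg'

theorem exists_forall_dist_lt_mem_of_mem_nhds_one {M : Type*} [Monoid M]
    [PseudoMetricSpace M] {U : Set Mˣ} (hU : U ∈ 𝓝 1) :
    ∃ δ > 0, ∀ u : Mˣ, dist (u : M) 1 < δ → dist ((u⁻¹ : Mˣ) : M) 1 < δ → u ∈ U := by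
  rw [Units.isEmbedding_embedProduct.nhds_eq_comap, Filter.mem_comap] at hU
  obtain ⟨t, ht, htU⟩ := hU
  rw [map_one, Prod.one_eq_mk, nhds_prod_eq, Filter.mem_prod_iff] at ht
  obtain ⟨V, hV, V', hV', hVt⟩ := ht
  obtain ⟨δ, hδ, hδV⟩ := Metric.mem_nhds_iff.mp hV
  obtain ⟨δ', hδ', hδV'⟩ :=
    Metric.mem_nhds_iff.mp (MulOpposite.continuous_op.continuousAt.preimage_mem_nhds hV')
  exact ⟨min δ δ', lt_min hδ hδ', fun u hu hu' => htU <| hVt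
    ⟨hδV (hu.trans_le (min_le_left _ _)), hδV' (hu'.trans_le (min_le_right _ _))⟩⟩

section Field

variable {F : Type*} [Field F]

/-- The nilpotent matrix `g⁻¹ [0, 1; 0, 0] g`, which measures the class of `g` modulo left
multiplication by scalars and upper triangular unipotents. -/
def conjNilp (g : GL (Fin 2) F) : Matrix (Fin 2) (Fin 2) F :=
  ((g⁻¹ : GL (Fin 2) F) : Matrix (Fin 2) (Fin 2) F) * !![0, 1; 0, 0] *
    (g : Matrix (Fin 2) (Fin 2) F)

theorem conjNilp_eq (g : GL (Fin 2) F) :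
    conjNilp g = ((g : Matrix (Fin 2) (Fin 2) F).det)⁻¹ • !![g 1 0 * g 1 1, g 1 1 * g 1 1;
      -(g 1 0 * g 1 0), -(g 1 0 * g 1 1)] := by
  rw [conjNilp, Matrix.coe_units_inv, Matrix.inv_def, Ring.inverse_eq_inv', Matrix.adjugate_fin_two]
  ext i j
  fin_cases i <;> fin_cases j <;> simp [Matrix.mul_apply, Fin.sum_univ_two] <;> ring

theorem inv_unip (x : F) : (unip x)⁻¹ = unip (-x) :=
  Units.ext rfl

theorem inv_mul_unip_mul (g : GL (Fin 2) F) (x : F) :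
    ((g⁻¹ * unip x * g : GL (Fin 2) F) : Matrix (Fin 2) (Fin 2) F) = 1 + x • conjNilp g := by
  have hx : ((unip x : GL (Fin 2) F) : Matrix (Fin 2) (Fin 2) F) = 1 + x • !![0, 1; 0, 0] := by
    ext i j
    fin_cases i <;> fin_cases j <;> simp [unip]
  rw [Units.val_mul, Units.val_mul, hx, Matrix.mul_add, Matrix.add_mul, Matrix.mul_one,
    Units.inv_mul, Matrix.mul_smul, Matrix.smul_mul, conjNilp]

theorem isWhittaker_of_mem_whittakerModel {E : Type*} [AddCommGroup E] [Module ℂ E]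
    {π : Representation ℂ (GL (Fin 2) F) E} {ω : Fˣ →* ℂˣ} (hω : HasCentralChar π ω)
    {ψ : AddChar F Circle} {W : GL (Fin 2) F → ℂ} (hW : W ∈ whittakerModel π ψ) :
    IsWhittaker ψ ω W := by
  obtain ⟨l, hl, e, hWe⟩ := hW
  intro z x g
  rw [hWe, hWe, mul_assoc, map_mul, Module.End.mul_apply, hω, map_smul, map_mul,
    Module.End.mul_apply, hl, smul_eq_mul, mul_assoc]

theorem exists_diag_mul_unip_mul_eq {g : GL (Fin 2) F} (hd : g 1 1 ≠ 0) :
    ∃ z x, ((diag z z * unip x * g : GL (Fin 2) F) : Matrix (Fin 2) (Fin 2) F) =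
        !![(g : Matrix (Fin 2) (Fin 2) F).det / g 1 1 ^ 2, 0; g 1 0 / g 1 1, 1] ∧
      (((diag z z * unip x * g)⁻¹ : GL (Fin 2) F) : Matrix (Fin 2) (Fin 2) F) =
        !![conjNilp g 0 1, 0; conjNilp g 1 1, 1] := by
  have hdet : (g : Matrix (Fin 2) (Fin 2) F).det = g 0 0 * g 1 1 - g 0 1 * g 1 0 := det_fin_two _
  have hdet0 : (g : Matrix (Fin 2) (Fin 2) F).det ≠ 0 := g.det_ne_zero
  set u := diag (Units.mk0 _ hd)⁻¹ (Units.mk0 _ hd)⁻¹ * unip (-(g 0 1 / g 1 1)) * g with hu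
  have val : (u : Matrix (Fin 2) (Fin 2) F) =
      !![(g : Matrix (Fin 2) (Fin 2) F).det / g 1 1 ^ 2, 0; g 1 0 / g 1 1, 1] := by
    ext i j
    fin_cases i <;> fin_cases j <;>
      simp [hu, diag, unip, Matrix.mul_apply, Fin.sum_univ_two, hdet, hd] <;> field_simp <;> ring
  refine ⟨(Units.mk0 _ hd)⁻¹, -(g 0 1 / g 1 1), val, Units.inv_eq_of_mul_eq_one_right ?_⟩
  rw [← hu, val, conjNilp_eq]
  ext i j
  fin_cases i <;> fin_cases j <;> simp [Matrix.mul_apply, Fin.sum_univ_two] <;> field_simp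
  ring

end Field

theorem continuous_of_mem_whittakerModel {F : Type*} [Field F] [TopologicalSpace F]
    [IsTopologicalRing F] {E : Type*} [AddCommGroup E] [Module ℂ E]
    {π : Representation ℂ (GL (Fin 2) F) E} (hπ : ∀ e, IsOpen {g : GL (Fin 2) F | π g e = e})
    {ψ : AddChar F Circle} {W : GL (Fin 2) F → ℂ} (hW : W ∈ whittakerModel π ψ) :
    Continuous W := by
  obtain ⟨l, -, e, hWe⟩ := hW
  rw [funext hWe]
  exact ((isLocallyConstant_rep_apply (hπ e)).comp l).continuous

open scoped Matrix.Norms.Elementwise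

/-- If `conjNilp g` is small, then `g⁻¹ n(b) g` fixes the vector defining `W`, whence
`ψ b * W g = W g`. -/
theorem exists_forall_le_norm_conjNilp {F : Type*} [NormedField F] {E : Type*} [AddCommGroup E]
    [Module ℂ E] {π : Representation ℂ (GL (Fin 2) F) E}
    (hπ : ∀ e, IsOpen {g : GL (Fin 2) F | π g e = e}) {ψ : AddChar F Circle} (hψ : ψ ≠ 1)
    {W : GL (Fin 2) F → ℂ} (hW : W ∈ whittakerModel π ψ) :
    ∃ δ > 0, ∀ g, W g ≠ 0 → δ ≤ ‖conjNilp g‖ := by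
  obtain ⟨b, hb⟩ : ∃ b, ψ b ≠ 1 := DFunLike.exists_ne hψ
  have hb0 : b ≠ 0 := fun h => hb (by rw [h, AddChar.map_zero_eq_one])
  obtain ⟨l, hl, e, hWe⟩ := hW
  obtain ⟨δ, hδ, hfix⟩ := exists_forall_dist_lt_mem_of_mem_nhds_one
    ((hπ e).mem_nhds (by simp : (1 : GL (Fin 2) F) ∈ _))
  refine ⟨δ / ‖b‖, by positivity, fun g hg => ?_⟩
  by_contra! hsmall
  rw [lt_div_iff₀' (norm_pos_iff.mpr hb0)] at hsmall
  have fixed : π (g⁻¹ * unip b * g) e = e := by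
    refine hfix _ ?_ ?_
    · rwa [inv_mul_unip_mul, dist_eq_norm, add_sub_cancel_left, norm_smul]
    · rw [_root_.mul_inv_rev, _root_.mul_inv_rev, inv_inv, inv_unip, ← mul_assoc, inv_mul_unip_mul,
        dist_eq_norm, add_sub_cancel_left, norm_smul, norm_neg]
      exact hsmall
  have invariant : l (π (unip b * g) e) = l (π g e) := by
    have hconj : unip b * g = g * (g⁻¹ * unip b * g) := by group
    rw [hconj, map_mul, Module.End.mul_apply, fixed]
  rw [map_mul, Module.End.mul_apply, hl, ← hWe] at invariant
  refine hb (Circle.ext ?_)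
  rw [Circle.coe_one]
  exact mul_right_cancel₀ hg (invariant.trans (one_mul _).symm)

end Smooth

/-! ### Reduction modulo scalars and unipotents -/

section Reduction

open scoped Matrix.Norms.Elementwise

variable {F : Type*} [NormedField F]

theorem norm_conjNilp (g : GL (Fin 2) F) :
    ‖conjNilp g‖ = ‖(g : Matrix (Fin 2) (Fin 2) F).det‖⁻¹ * max ‖g 1 0‖ ‖g 1 1‖ ^ 2 := by
  rw [conjNilp_eq, norm_smul, norm_inv]
  congr 1
  set M := max ‖g 1 0‖ ‖g 1 1‖
  have hc : ‖g 1 0‖ ≤ M := le_max_left _ _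
  have hd : ‖g 1 1‖ ≤ M := le_max_right _ _
  refine le_antisymm ((Matrix.norm_le_iff (by positivity)).mpr fun i j => ?_) ?_
  · fin_cases i <;> fin_cases j <;> simp only [Fin.zero_eta, Fin.mk_one, Fin.isValue, of_apply,
      cons_val', cons_val_zero, cons_val_one, cons_val_fin_one, norm_neg, norm_mul, pow_two] <;>
      gcongr
  · rcases max_choice ‖g 1 0‖ ‖g 1 1‖ with h | h
    · refine le_of_eq_of_le ?_ (Matrix.norm_entry_le_entrywise_sup_norm _ (i := 1) (j := 0))
      simp [M, h, pow_two]
    · refine le_of_eq_of_le ?_ (Matrix.norm_entry_le_entrywise_sup_norm _ (i := 0) (j := 1))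
      simp [M, h, pow_two]

theorem mul_swap_mem_boundedGL {R : ℝ} {g : GL (Fin 2) F} (hg : g ∈ boundedGL F R) :
    g * GeneralLinearGroup.swap F 0 1 ∈ boundedGL F R := by
  have hR : 0 ≤ R := (norm_nonneg _).trans hg.1
  constructor <;> refine (Matrix.norm_le_iff hR).mpr fun i j => ?_
  · refine le_trans ?_ ((Matrix.norm_entry_le_entrywise_sup_norm _ (i := i)
      (j := Equiv.swap 0 1 j)).trans hg.1)
    fin_cases j
    · exact (congrArg norm (Matrix.mul_swap_apply_left 0 1 i _)).le
    · exact (congrArg norm (Matrix.mul_swap_apply_right 0 1 i _)).le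
  · refine le_trans ?_ ((Matrix.norm_entry_le_entrywise_sup_norm _ (i := Equiv.swap 0 1 i)
      (j := j)).trans hg.2)
    rw [_root_.mul_inv_rev]
    fin_cases i
    · exact (congrArg norm (Matrix.swap_mul_apply_left 0 1 j _)).le
    · exact (congrArg norm (Matrix.swap_mul_apply_right 0 1 j _)).le

theorem exists_mul_mem_boundedGL_of_norm_le {g : GL (Fin 2) F} (h : ‖g 1 0‖ ≤ ‖g 1 1‖) :
    ∃ z x, diag z z * unip x * g ∈
      boundedGL F (max 1 (max ‖conjNilp g‖ ‖conjNilp g‖⁻¹)) := by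
  have hd : g 1 1 ≠ 0 := fun h0 => by
    have hc : g 1 0 = 0 := norm_le_zero_iff.mp (by rwa [h0, norm_zero] at h)
    exact g.det_ne_zero (by rw [det_fin_two, h0, hc, mul_zero, mul_zero, sub_zero])
  set B := max 1 (max ‖conjNilp g‖ ‖conjNilp g‖⁻¹)
  have hB : 1 ≤ B := le_max_left _ _
  have hN : ‖conjNilp g‖ ≤ B := (le_max_left _ _).trans (le_max_right _ _)
  have hNinv : ‖conjNilp g‖⁻¹ ≤ B := (le_max_right _ _).trans (le_max_right _ _)
  have corner : ‖(g : Matrix (Fin 2) (Fin 2) F).det / g 1 1 ^ 2‖ = ‖conjNilp g‖⁻¹ := by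
    rw [norm_conjNilp, max_eq_right h, norm_div, norm_pow, mul_inv, inv_inv, div_eq_mul_inv]
  have entry : ∀ k l, ‖conjNilp g k l‖ ≤ B := fun k l =>
    (Matrix.norm_entry_le_entrywise_sup_norm _).trans hN
  obtain ⟨z, x, hval, hinv⟩ := exists_diag_mul_unip_mul_eq hd
  refine ⟨z, x, ?_, ?_⟩ <;> refine (Matrix.norm_le_iff (zero_le_one.trans hB)).mpr fun i j => ?_
  · rw [hval]
    fin_cases i <;> fin_cases j
    · exact corner.trans_le hNinv
    · simpa using zero_le_one.trans hB
    · simpa using (div_le_one_of_le₀ h (norm_nonneg _)).trans hB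
    · simpa using hB
  · rw [hinv]
    fin_cases i <;> fin_cases j
    · exact entry 0 1
    · simpa using zero_le_one.trans hB
    · exact entry 1 1
    · simpa using hB

theorem exists_mul_mem_boundedGL (g : GL (Fin 2) F) :
    ∃ z x, diag z z * unip x * g ∈
      boundedGL F (max 1 (max ‖conjNilp g‖ ‖conjNilp g‖⁻¹)) := by
  rcases le_total ‖g 1 0‖ ‖g 1 1‖ with h | h
  · exact exists_mul_mem_boundedGL_of_norm_le h
  let s : GL (Fin 2) F := GeneralLinearGroup.swap F 0 1
  have norm_swap : ‖conjNilp (g * s)‖ = ‖conjNilp g‖ := by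
    have hdet : ‖(Matrix.swap F (0 : Fin 2) 1).det‖ = 1 := by simp [Matrix.swap]
    simp [norm_conjNilp, s, Matrix.det_mul, hdet, max_comm]
  obtain ⟨z, x, hzx⟩ := exists_mul_mem_boundedGL_of_norm_le (g := g * s) (by simpa [s] using h)
  refine ⟨z, x, ?_⟩
  have hs : diag z z * unip x * g = diag z z * unip x * (g * s) * s := by
    have hss : s * s = 1 := Units.ext (Matrix.swap_mul_self 0 1)
    rw [mul_assoc _ (g * s), mul_assoc g, hss, mul_one]
  rw [hs, ← norm_swap]
  exact mul_swap_mem_boundedGL hzx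

end Reduction

/-! ### Convergence over non-archimedean local fields -/

section Nonarch

section Field

variable {F : Type*} [Field F]

theorem invAct_basePoint_zero (h₁ h₂ : GL (Fin 2) F) :
    invAct h₁ h₂ (basePoint F) 0 =
      -(((h₁⁻¹ * h₂ : GL (Fin 2) F) : Matrix (Fin 2) (Fin 2) F) * conjNilp h₂) := by
  have hneg : basePoint F 0 = -!![0, 1; 0, 0] := by
    ext i j
    fin_cases i <;> fin_cases j <;> simp [basePoint]
  rw [invAct, conjNilp, Units.val_mul, hneg, Matrix.mul_neg, Matrix.neg_mul, ← Matrix.mul_assoc,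
    ← Matrix.mul_assoc, Matrix.mul_assoc _ (h₂ : Matrix (Fin 2) (Fin 2) F), Units.mul_inv,
    Matrix.mul_one]

theorem invAct_basePoint_one (h₁ h₂ : GL (Fin 2) F) :
    invAct h₁ h₂ (basePoint F) 1 = ((h₁⁻¹ * h₂ : GL (Fin 2) F) : Matrix (Fin 2) (Fin 2) F) := by
  rw [invAct, Units.val_mul, show basePoint F 1 = 1 from rfl, Matrix.mul_one]

theorem det_inv_mul (h : DetPairs F) :
    ((h.1.1⁻¹ * h.1.2 : GL (Fin 2) F) : Matrix (Fin 2) (Fin 2) F).det = 1 := by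
  rw [← GeneralLinearGroup.val_det_apply, map_mul, map_inv, h.2, inv_mul_cancel, Units.val_one]

end Field

open scoped Matrix.Norms.Elementwise

variable {F : Type*} [NormedField F]

theorem norm_inv_le_of_det_eq_one {k : GL (Fin 2) F}
    (hk : (k : Matrix (Fin 2) (Fin 2) F).det = 1) :
    ‖((k⁻¹ : GL (Fin 2) F) : Matrix (Fin 2) (Fin 2) F)‖ ≤ ‖(k : Matrix (Fin 2) (Fin 2) F)‖ := by
  refine (Matrix.norm_le_iff (norm_nonneg _)).mpr fun i j => ?_
  rw [Matrix.coe_units_inv, Matrix.inv_def, hk, Ring.inverse_one, one_smul,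
    Matrix.adjugate_fin_two]
  fin_cases i <;> fin_cases j <;>
    simpa using Matrix.norm_entry_le_entrywise_sup_norm (k : Matrix (Fin 2) (Fin 2) F)

theorem inv_mul_mem_boundedGL (h : DetPairs F) :
    h.1.1⁻¹ * h.1.2 ∈ boundedGL F ‖invAct h.1.1 h.1.2 (basePoint F)‖ := by
  have hle : ‖((h.1.1⁻¹ * h.1.2 : GL (Fin 2) F) : Matrix (Fin 2) (Fin 2) F)‖ ≤
      ‖invAct h.1.1 h.1.2 (basePoint F)‖ := by
    rw [← invAct_basePoint_one]
    exact norm_le_pi_norm _ 1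
  exact ⟨hle, (norm_inv_le_of_det_eq_one (det_inv_mul h)).trans hle⟩

theorem norm_conjNilp_le (h : DetPairs F) :
    ‖conjNilp h.1.2‖ ≤ 2 * ‖invAct h.1.1 h.1.2 (basePoint F)‖ ^ 2 := by
  have hconj : conjNilp h.1.2 =
      -((((h.1.1⁻¹ * h.1.2)⁻¹ : GL (Fin 2) F) : Matrix (Fin 2) (Fin 2) F) *
        invAct h.1.1 h.1.2 (basePoint F) 0) := by
    rw [invAct_basePoint_zero, Matrix.mul_neg, neg_neg, ← Matrix.mul_assoc, Units.inv_mul,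
      Matrix.one_mul]
  rw [hconj, norm_neg, pow_two]
  refine (norm_matrix_mul_le _ _).trans ?_
  gcongr
  exacts [(inv_mul_mem_boundedGL h).2, norm_le_pi_norm _ 0]

theorem mem_boundedPairs_of_snd_mem {h : DetPairs F} {R ρ : ℝ} (hR : h.1.2 ∈ boundedGL F R)
    (hρ : 1 ≤ ρ) (hx : ‖invAct h.1.1 h.1.2 (basePoint F)‖ ≤ ρ) :
    h ∈ boundedPairs F (2 * (R * ρ)) := by
  have hR0 : 0 ≤ R := (norm_nonneg _).trans hR.1
  have hfst : h.1.1 = h.1.2 * (h.1.1⁻¹ * h.1.2)⁻¹ := by group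
  refine ⟨?_, boundedGL_mono (by nlinarith) hR⟩
  rw [hfst]
  exact mul_mem_boundedGL hR (inv_mem_boundedGL (boundedGL_mono hx (inv_mul_mem_boundedGL h)))

/-- On the support of the integrand both `h₁⁻¹h₂` and the class of `h₂` modulo scalars and
unipotents are bounded. -/
theorem exists_mul_mem_boundedPairs {δ : ℝ} (hδ : 0 < δ) (R : ℝ) :
    ∃ B, ∀ h : DetPairs F, δ ≤ ‖conjNilp h.1.2‖ → ‖invAct h.1.1 h.1.2 (basePoint F)‖ ≤ R →
      ∃ n ∈ NHat F, n * h ∈ boundedPairs F B := by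
  refine ⟨2 * (max 1 (max (2 * R ^ 2) δ⁻¹) * max 1 R), fun h hlow hR => ?_⟩
  obtain ⟨z, x, hzx⟩ := exists_mul_mem_boundedGL h.1.2
  let n : DetPairs F := ⟨(diag z z * unip x, diag z z * unip x), rfl⟩
  refine ⟨n, ⟨z, x, rfl⟩, mem_boundedPairs_of_snd_mem (boundedGL_mono
    (max_le_max le_rfl (max_le_max ?_ (inv_anti₀ hδ hlow))) hzx) (le_max_left _ _) ?_⟩
  · exact (norm_conjNilp_le h).trans (by gcongr)
  · change ‖invAct (diag z z * unip x * h.1.1) (diag z z * unip x * h.1.2) (basePoint F)‖ ≤ _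
    rw [invAct_mul, invAct_basePoint]
    exact hR.trans (le_max_right _ _)

theorem convergesAbsolutely_integrand_of_isUltrametricDist [IsUltrametricDist F] [ProperSpace F]
    {ψ : AddChar F Circle} (hψ : Continuous ψ) (hψ1 : ψ ≠ 1)
    {E₁ E₂ : Type*} [AddCommGroup E₁] [Module ℂ E₁] [AddCommGroup E₂] [Module ℂ E₂]
    {π₁ : Representation ℂ (GL (Fin 2) F) E₁} {π₂ : Representation ℂ (GL (Fin 2) F) E₂}
    (hπ₁ : ∀ e, IsOpen {g : GL (Fin 2) F | π₁ g e = e})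
    (hπ₂ : ∀ e, IsOpen {g : GL (Fin 2) F | π₂ g e = e})
    {ω₁ ω₂ : Fˣ →* ℂˣ} (hω₁ : HasCentralChar π₁ ω₁) (hω₂ : HasCentralChar π₂ ω₂)
    (hω : ω₁ * ω₂ = 1) {W₁ W₂ : GL (Fin 2) F → ℂ} (hW₁ : W₁ ∈ whittakerModel π₁ ψ)
    (hW₂ : W₂ ∈ whittakerModel π₂ ψ) {f : VSq F → ℂ} (hf : IsSchwartzBruhat f) (g : GSp4 F)
    {m : Measure (VSq F)} (hm : IsSelfDual ψ m) {μ : Measure (NHatQuot F)}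
    (hμ : IsInvariantMeasure μ) : ConvergesAbsolutely μ (integrand ψ m W₁ W₂ f g) := by
  have := hm.haar
  obtain ⟨φ, hφ, Φ, hΦcont, hΦint, hΦ⟩ := (isTestSpace_schwartzBruhat hψ hψ1).exists_continuous_lift
    hm hf g (continuous_of_mem_whittakerModel hπ₁ hW₁) (continuous_of_mem_whittakerModel hπ₂ hW₂)
    (isWhittaker_of_mem_whittakerModel hω₁ hW₁) (isWhittaker_of_mem_whittakerModel hω₂ hW₂) hω
  obtain ⟨R, hR⟩ := (IsCompact.isBounded hφ.2).exists_norm_le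
  obtain ⟨δ, hδ, hδW⟩ := exists_forall_le_norm_conjNilp hπ₂ hψ1 hW₂
  obtain ⟨B, hB⟩ := exists_mul_mem_boundedPairs (F := F) hδ R
  have hC : IsCompact (NHatQuot.mk F '' boundedPairs F B) :=
    (isCompact_boundedPairs B).image NHatQuot.isQuotientMap_mk.continuous
  refine ⟨Φ, hΦint, integrable_of_support_subset_isCompact hΦcont hC
    (hμ.finite_on_compacts _ hC) fun q hq => ?_⟩
  obtain ⟨h, rfl⟩ := NHatQuot.mk_surjective q
  rw [Function.mem_support, hΦ] at hq
  obtain ⟨n, hn, hnh⟩ := hB h (hδW _ (right_ne_zero_of_mul (left_ne_zero_of_mul hq)))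
    (hR _ (subset_tsupport φ (right_ne_zero_of_mul hq)))
  exact ⟨n * h, hnh, NHatQuot.mk_eq hn h⟩

theorem exists_normedField (F : Type*) [i : Field F] [ValuativeRel F] [t : TopologicalSpace F]
    [IsNonarchimedeanLocalField F] :
    ∃ n : NormedField F, n.toField = i ∧
      n.toMetricSpace.toPseudoMetricSpace.toUniformSpace.toTopologicalSpace = t ∧
      IsUltrametricDist F ∧ ProperSpace F := by
  let := IsTopologicalAddGroup.rightUniformSpace F
  have := isUniformAddGroup_of_addCommGroup (G := F)
  let : (Valued.v (R := F)).RankOne :=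
    { hom' := ValuativeRel.IsRankLeOne.nonempty.some.emb (R := F).comp
        MonoidWithZeroHom.ValueGroup₀.embedding
      strictMono' := ValuativeRel.IsRankLeOne.nonempty.some.strictMono.comp
        MonoidWithZeroHom.ValueGroup₀.embedding_strictMono }
  let := Valued.toNontriviallyNormedField F (ValuativeRel.ValueGroupWithZero F)
  exact ⟨inferInstance, rfl, rfl,
    inferInstanceAs (@IsUltrametricDist F
      (Valued.toNormedField F (ValuativeRel.ValueGroupWithZero F)).toMetricSpace.toDist),
    .of_nontriviallyNormedField_of_weaklyLocallyCompactSpace F⟩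

theorem convergesAbsolutely_integrand_nonarch {F : Type*} [Field F] [ValuativeRel F]
    [TopologicalSpace F] [IsNonarchimedeanLocalField F]
    {ψ : AddChar F Circle} (hψ : Continuous ψ) (hψ1 : ψ ≠ 1)
    {E₁ E₂ : Type*} [AddCommGroup E₁] [Module ℂ E₁] [AddCommGroup E₂] [Module ℂ E₂]
    {π₁ : Representation ℂ (GL (Fin 2) F) E₁} {π₂ : Representation ℂ (GL (Fin 2) F) E₂}
    (hπ₁ : ∀ e, IsOpen {g : GL (Fin 2) F | π₁ g e = e})
    (hπ₂ : ∀ e, IsOpen {g : GL (Fin 2) F | π₂ g e = e})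
    {ω₁ ω₂ : Fˣ →* ℂˣ} (hω₁ : HasCentralChar π₁ ω₁) (hω₂ : HasCentralChar π₂ ω₂)
    (hω : ω₁ * ω₂ = 1) {W₁ W₂ : GL (Fin 2) F → ℂ} (hW₁ : W₁ ∈ whittakerModel π₁ ψ)
    (hW₂ : W₂ ∈ whittakerModel π₂ ψ) {f : VSq F → ℂ} (hf : IsSchwartzBruhat f) (g : GSp4 F)
    {m : Measure (VSq F)} (hm : IsSelfDual ψ m) {μ : Measure (NHatQuot F)}
    (hμ : IsInvariantMeasure μ) : ConvergesAbsolutely μ (integrand ψ m W₁ W₂ f g) := by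
  obtain ⟨_, rfl, rfl, _, _⟩ := exists_normedField F
  exact convergesAbsolutely_integrand_of_isUltrametricDist hψ hψ1 hπ₁ hπ₂ hω₁ hω₂ hω hW₁ hW₂ hf g
    hm hμ

end Nonarch

/-! ### Characters of the real line -/

section RealCharacter

open scoped FourierTransform

theorem eq_cexp_mul_of_hasDerivAt {f : ℝ → ℂ} {a : ℂ} (hf : ∀ t, HasDerivAt f (a * f t) t)
    (t : ℝ) : f t = Complex.exp (a * t) * f 0 := by
  have hexp (t : ℝ) : HasDerivAt (fun t : ℝ => Complex.exp (-(a * t)))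
      (Complex.exp (-(a * t)) * -(a * 1)) t :=
    (Complex.ofRealCLM.hasDerivAt.const_mul a).neg.cexp
  have hconst (t : ℝ) : HasDerivAt (fun t : ℝ => Complex.exp (-(a * t)) * f t) 0 t :=
    ((hexp t).mul (hf t)).congr_deriv (by ring)
  have heq : Complex.exp (-(a * t)) * f t = f 0 := by
    simpa using is_const_of_deriv_eq_zero (fun x => (hconst x).differentiableAt)
      (fun x => (hconst x).deriv) t 0
  rw [← heq, ← mul_assoc, ← Complex.exp_add, add_neg_cancel, Complex.exp_zero, one_mul]

-- If `G` is a primitive of `c` with `G δ ≠ 0`, then `G (x + δ) - G x = c x * G δ` exhibits `c` as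
-- a differentiable function.
theorem exists_hasDerivAt_of_map_add_eq_mul {c : ℝ → ℂ} (hc : Continuous c) (h0 : c 0 = 1)
    (hadd : ∀ x y, c (x + y) = c x * c y) : ∃ a, ∀ x, HasDerivAt c (a * c x) x := by
  set G : ℝ → ℂ := fun x => ∫ t in (0 : ℝ)..x, c t with hG
  have hderiv (x : ℝ) : HasDerivAt G (c x) x := (hc.integral_hasStrictDerivAt 0 x).hasDerivAt
  obtain ⟨δ, hδ⟩ : ∃ δ, G δ ≠ 0 := by
    by_contra! hzero
    have h := hderiv 0
    rw [funext hzero, h0] at h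
    exact one_ne_zero (h.unique (hasDerivAt_const 0 (0 : ℂ)))
  have hshift (x : ℝ) : (G (x + δ) - G x) / G δ = c x := by
    rw [div_eq_iff hδ, hG, intervalIntegral.integral_interval_sub_left
      (hc.intervalIntegrable _ _) (hc.intervalIntegrable _ _),
      ← intervalIntegral.integral_const_mul]
    simp only [← hadd, intervalIntegral.integral_comp_add_left, add_zero]
  refine ⟨(c δ - 1) / G δ, fun x => ?_⟩
  have h := (((hderiv (x + δ)).comp_add_const x δ).sub (hderiv x)).div_const (G δ)
  rw [hadd] at h
  exact (h.congr_of_eventuallyEq (.of_forall fun y => (hshift y).symm)).congr_deriv (by ring)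

theorem exists_eq_fourierChar {ψ : AddChar ℝ Circle} (hψ : Continuous ψ) (hψ1 : ψ ≠ 1) :
    ∃ α : ℝ, α ≠ 0 ∧ ∀ x, ψ x = 𝐞 (α * x) := by
  have h0 : (ψ 0 : ℂ) = 1 := by simp
  obtain ⟨a, ha⟩ := exists_hasDerivAt_of_map_add_eq_mul (c := fun x => (ψ x : ℂ))
    (continuous_subtype_val.comp hψ) h0
    fun x y => by rw [AddChar.map_add_eq_mul, Circle.coe_mul]
  have hexp (x : ℝ) : (ψ x : ℂ) = Complex.exp (a * x) := by
    simpa [h0] using eq_cexp_mul_of_hasDerivAt ha x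
  have hre : a.re = 0 := by
    have h := Circle.norm_coe (ψ 1)
    rw [hexp, Complex.norm_exp] at h
    simpa using h
  have hψ_eq (x : ℝ) : ψ x = 𝐞 (a.im / (2 * Real.pi) * x) := by
    refine Circle.ext ?_
    rw [hexp, Real.fourierChar_apply]
    congr 1
    rw [← mul_assoc, mul_div_cancel₀ _ Real.two_pi_pos.ne']
    apply Complex.ext <;> simp [hre]
  refine ⟨_, fun h => hψ1 (DFunLike.ext _ _ fun x => ?_), hψ_eq⟩
  rw [hψ_eq, h, zero_mul, AddChar.map_zero_eq_one, AddChar.one_apply]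

theorem iteratedDeriv_fourierChar (n : ℕ) :
    iteratedDeriv n (fun t : ℝ => (𝐞 t : ℂ)) =
      fun t => (2 * Real.pi * Complex.I) ^ n * (𝐞 t : ℂ) := by
  induction n with
  | zero => simp
  | succ n ih =>
    rw [iteratedDeriv_succ, ih]
    funext t
    rw [((Real.hasDerivAt_fourierChar t).const_mul _).deriv, pow_succ]
    ring

theorem hasTemperateGrowth_fourierChar :
    Function.HasTemperateGrowth fun t : ℝ => (𝐞 t : ℂ) := by
  refine ⟨?_, fun n => ⟨0, (2 * Real.pi) ^ n, fun t => ?_⟩⟩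
  · simp only [Real.fourierChar_apply]
    exact Complex.contDiff_exp.comp ((Complex.ofRealCLM.contDiff.comp
      (contDiff_const.mul contDiff_id)).mul contDiff_const)
  · rw [norm_iteratedFDeriv_eq_norm_iteratedDeriv, iteratedDeriv_fourierChar, norm_mul,
      Circle.norm_coe]
    simp [abs_of_pos Real.pi_pos]

end RealCharacter

/-! ### Real Schwartz functions -/

section RealSchwartz

open scoped FourierTransform

/-- The space `V²` over the reals with the Euclidean inner product of the matrix entries, on which
Mathlib's Fourier transform is defined. -/
abbrev EuclideanVSq : Type := EuclideanSpace ℝ (Fin 2 × Fin 2 × Fin 2)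

/-- The identification of `V²` with Euclidean space by the matrix entries. -/
noncomputable def vsqEquiv : VSq ℝ ≃L[ℝ] EuclideanVSq :=
  LinearEquiv.toContinuousLinearEquiv
    { toFun x := WithLp.toLp 2 fun p => x p.1 p.2.1 p.2.2
      invFun v := fun k => Matrix.of fun i j => v (k, i, j)
      map_add' _ _ := rfl
      map_smul' _ _ := rfl
      left_inv _ := rfl
      right_inv _ := rfl }

theorem vsqEquiv_symm_apply (v : EuclideanVSq) (k i j : Fin 2) :
    vsqEquiv.symm v k i j = v (k, i, j) :=
  rfl

theorem isRealSchwartz_iff {f : VSq ℝ → ℂ} :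
    IsRealSchwartz f ↔ ∃ φ : 𝓢(EuclideanVSq, ℂ), ∀ x, f x = φ (vsqEquiv x) := by
  let e : (Fin 2 → Fin 2 → Fin 2 → ℝ) ≃L[ℝ] EuclideanVSq := vsqEquiv
  constructor
  · rintro ⟨φ, hφ⟩
    exact ⟨SchwartzMap.compCLMOfContinuousLinearEquiv ℂ e.symm φ, hφ⟩
  · rintro ⟨φ, hφ⟩
    exact ⟨SchwartzMap.compCLMOfContinuousLinearEquiv ℂ e φ, hφ⟩

theorem IsRealSchwartz.comp {f : VSq ℝ → ℂ} (hf : IsRealSchwartz f) (A : VSq ℝ ≃ₗ[ℝ] VSq ℝ) :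
    IsRealSchwartz fun x => f (A x) := by
  rw [isRealSchwartz_iff] at *
  obtain ⟨φ, hφ⟩ := hf
  exact ⟨SchwartzMap.compCLMOfContinuousLinearEquiv ℂ
    (vsqEquiv.symm.trans (A.toContinuousLinearEquiv.trans vsqEquiv)) φ, fun x => by simp [hφ]⟩

theorem IsRealSchwartz.const_mul {f : VSq ℝ → ℂ} (hf : IsRealSchwartz f) (c : ℂ) :
    IsRealSchwartz fun x => c * f x := by
  obtain ⟨φ, hφ⟩ := hf
  exact ⟨c • φ, fun x => by simp [hφ]⟩

theorem IsRealSchwartz.comp_rightAct {f : VSq ℝ → ℂ} (hf : IsRealSchwartz f)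
    (a : GL (Fin 2) ℝ) :
    IsRealSchwartz fun x => f (rightAct x (a : Matrix (Fin 2) (Fin 2) ℝ)) :=
  hf.comp
    { rightActHomeomorph a with
      map_add' x y := by
        change rightAct (x + y) _ = rightAct x _ + rightAct y _
        funext i
        simp only [rightAct, Pi.add_apply, smul_add, Finset.sum_add_distrib]
      map_smul' c x := by funext i; simp [rightActHomeomorph, rightAct, smul_comm c] }

theorem IsRealSchwartz.comp_invAct {f : VSq ℝ → ℂ} (hf : IsRealSchwartz f)
    (h₁ h₂ : GL (Fin 2) ℝ) : IsRealSchwartz fun x => f (invAct h₁ h₂ x) :=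
  hf.comp
    { invActEquiv h₁ h₂ with
      map_smul' c x := by
        change invAct h₁ h₂ (c • x) = c • invAct h₁ h₂ x
        funext i
        simp [invAct] }

theorem hasTemperateGrowth_form (b : Matrix (Fin 2) (Fin 2) ℝ) :
    Function.HasTemperateGrowth fun v : EuclideanVSq => 2⁻¹ * ∑ i, ∑ j, b i j *
      form (vsqEquiv.symm v j) (vsqEquiv.symm v i) := by
  have hentry (k i j : Fin 2) :
      Function.HasTemperateGrowth fun v : EuclideanVSq => vsqEquiv.symm v k i j :=
    (EuclideanSpace.proj (𝕜 := ℝ) ((k, i, j) : Fin 2 × Fin 2 × Fin 2)).hasTemperateGrowth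
  simp only [form_eq]
  fun_prop

theorem IsRealSchwartz.siegel_mul {ψ : AddChar ℝ Circle} (hψ : Continuous ψ) (hψ1 : ψ ≠ 1)
    {f : VSq ℝ → ℂ} (hf : IsRealSchwartz f) (b : Matrix (Fin 2) (Fin 2) ℝ) :
    IsRealSchwartz fun x =>
      (ψ (2⁻¹ * ∑ i, ∑ j, b i j * form (x j) (x i)) : ℂ) * f x := by
  obtain ⟨φ, hφ⟩ := isRealSchwartz_iff.mp hf
  obtain ⟨α, -, hα⟩ := exists_eq_fourierChar hψ hψ1
  have hgrowth : Function.HasTemperateGrowth fun v : EuclideanVSq =>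
      (𝐞 (α * (2⁻¹ * ∑ i, ∑ j, b i j * form (vsqEquiv.symm v j) (vsqEquiv.symm v i))) : ℂ) :=
    hasTemperateGrowth_fourierChar.comp
      ((Function.HasTemperateGrowth.const α).mul (hasTemperateGrowth_form b))
  exact isRealSchwartz_iff.mpr ⟨SchwartzMap.smulLeftCLM ℂ _ φ, fun x =>
    .trans (by simp [hφ, hα]) (SchwartzMap.smulLeftCLM_apply_apply hgrowth φ _).symm⟩

theorem exists_isRealSchwartz_ne_zero : ∃ f : VSq ℝ → ℂ, IsRealSchwartz f ∧ ∃ x, f x ≠ 0 := by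
  let b : ContDiffBump (0 : EuclideanVSq) := ⟨1, 2, one_pos, one_lt_two⟩
  have hb : b 0 = 1 := b.one_of_mem_closedBall (Metric.mem_closedBall_self zero_le_one)
  have hcompact : HasCompactSupport fun v => ((b v : ℝ) : ℂ) :=
    b.hasCompactSupport.comp_left Complex.ofReal_zero
  refine ⟨fun x => hcompact.toSchwartzMap
    (Complex.ofRealCLM.contDiff.comp b.contDiff) (vsqEquiv x),
    isRealSchwartz_iff.mpr ⟨_, fun x => rfl⟩, 0, ?_⟩
  change ((b (vsqEquiv 0) : ℝ) : ℂ) ≠ 0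
  simp [hb]

theorem exists_map_vsqEquiv_eq_smul (m : Measure (VSq ℝ)) [m.IsAddHaarMeasure] :
    ∃ c : NNReal, m.map vsqEquiv = c • (volume : Measure EuclideanVSq) := by
  have : (m.map vsqEquiv).IsAddHaarMeasure :=
    vsqEquiv.toContinuousAddEquiv.isAddHaarMeasure_map m
  exact ⟨_, Measure.isAddLeftInvariant_eq_smul _ _⟩

theorem IsRealSchwartz.continuous {f : VSq ℝ → ℂ} (hf : IsRealSchwartz f) : Continuous f := by
  obtain ⟨φ, hφ⟩ := isRealSchwartz_iff.mp hf
  rw [funext hφ]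
  exact φ.continuous.comp vsqEquiv.continuous

theorem IsRealSchwartz.integrable {f : VSq ℝ → ℂ} (hf : IsRealSchwartz f)
    (m : Measure (VSq ℝ)) [m.IsAddHaarMeasure] : Integrable f m := by
  obtain ⟨φ, hφ⟩ := isRealSchwartz_iff.mp hf
  obtain ⟨c, hc⟩ := exists_map_vsqEquiv_eq_smul m
  have hint : Integrable φ (m.map vsqEquiv) := hc ▸ φ.integrable.smul_measure_nnreal
  rw [funext hφ]
  exact vsqEquiv.toHomeomorph.measurableEmbedding.integrable_map_iff.mp hint

open scoped Matrix.Norms.Elementwise in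
theorem IsRealSchwartz.exists_decay {f : VSq ℝ → ℂ} (hf : IsRealSchwartz f) (N : ℕ) :
    ∃ C, ∀ x, (1 + ‖x‖) ^ N * ‖f x‖ ≤ C := by
  obtain ⟨φ, hφ⟩ := hf
  have hdecay := SchwartzMap.one_add_le_sup_seminorm_apply (𝕜 := ℝ) (m := (N, 0)) (k := N) (n := 0)
    le_rfl le_rfl φ
  simp only [norm_iteratedFDeriv_zero] at hdecay
  exact ⟨_, fun x => (hφ x).symm ▸ hdecay x⟩

/-- The endomorphism of `V²` whose Euclidean inner product with `v` is `κ ∑ (xᵢ, vᵢ)`. It transports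
the Fourier transform for the quadratic space `V²` to the one for the Euclidean inner product. -/
def pairingMap (κ : ℝ) : EuclideanVSq →ₗ[ℝ] EuclideanVSq where
  toFun w := WithLp.toLp 2 fun p =>
    κ * ((if p.2.1 = p.2.2 then 1 else -1) * w (p.1, p.2.1 + 1, p.2.2 + 1))
  map_add' x y := by ext p; simp only [PiLp.add_apply]; ring
  map_smul' c x := by ext p; simp only [PiLp.smul_apply, smul_eq_mul, RingHom.id_apply]; ring

theorem inner_pairingMap (κ : ℝ) (v w : EuclideanVSq) :
    inner ℝ v (pairingMap κ w) = κ * ∑ i, form (vsqEquiv.symm w i) (vsqEquiv.symm v i) := by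
  simp only [PiLp.inner_apply, pairingMap, Fintype.sum_prod_type, Fin.sum_univ_two, form_eq,
    vsqEquiv_symm_apply, LinearMap.coe_mk, AddHom.coe_mk, RCLike.inner_apply, Real.ringHom_apply,
    Fin.isValue, Fin.reduceAdd, zero_add, zero_ne_one, one_ne_zero, ↓reduceIte]
  ring

theorem pairingMap_injective {κ : ℝ} (hκ : κ ≠ 0) : Function.Injective (pairingMap κ) := by
  rw [injective_iff_map_eq_zero]
  intro w hw
  ext ⟨k, i, j⟩
  have := congrArg (fun v : EuclideanVSq => v (k, i + 1, j + 1)) hw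
  fin_cases i <;> fin_cases j <;> simpa [pairingMap, hκ] using this

theorem IsRealSchwartz.fourier {ψ : AddChar ℝ Circle} (hψ : Continuous ψ) (hψ1 : ψ ≠ 1)
    {f : VSq ℝ → ℂ} (hf : IsRealSchwartz f) (m : Measure (VSq ℝ)) [m.IsAddHaarMeasure] :
    IsRealSchwartz (fourier ψ m f) := by
  obtain ⟨α, hα, hψα⟩ := exists_eq_fourierChar hψ hψ1
  obtain ⟨φ, hφ⟩ := isRealSchwartz_iff.mp hf
  obtain ⟨c, hc⟩ := exists_map_vsqEquiv_eq_smul m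
  let A : EuclideanVSq ≃L[ℝ] EuclideanVSq := (LinearEquiv.ofInjectiveEndo (pairingMap (-α))
    (pairingMap_injective (neg_ne_zero.mpr hα))).toContinuousLinearEquiv
  have hA (v : EuclideanVSq) (x : VSq ℝ) :
      -inner ℝ v (A (vsqEquiv x)) = α * ∑ i, form (x i) (vsqEquiv.symm v i) := by
    change -inner ℝ v (pairingMap (-α) (vsqEquiv x)) = _
    rw [inner_pairingMap, ContinuousLinearEquiv.symm_apply_apply, neg_mul, neg_neg]
  have htransport (x : VSq ℝ) : ThetaWhittaker.fourier ψ m f x =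
      ∫ v, φ v * (𝐞 (α * ∑ i, form (x i) (vsqEquiv.symm v i)) : ℂ) ∂(m.map vsqEquiv) := by
    refine .trans ?_ (vsqEquiv.toHomeomorph.measurableEmbedding.integral_map _).symm
    simp [ThetaWhittaker.fourier, hφ, hψα]
  refine isRealSchwartz_iff.mpr ⟨((c : ℝ) : ℂ) •
    SchwartzMap.compCLMOfContinuousLinearEquiv ℂ A (FourierTransform.fourier φ), fun x => ?_⟩
  rw [htransport, hc, integral_smul_nnreal_measure, _root_.smul_apply,
    SchwartzMap.compCLMOfContinuousLinearEquiv_apply, Function.comp_apply,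
    SchwartzMap.fourier_coe, Real.fourier_eq, NNReal.smul_def, Complex.real_smul, smul_eq_mul]
  simp only [hA, Circle.smul_def, smul_eq_mul, mul_comm]

theorem isTestSpace_realSchwartz {ψ : AddChar ℝ Circle} (hψ : Continuous ψ) (hψ1 : ψ ≠ 1)
    (m : Measure (VSq ℝ)) [m.IsAddHaarMeasure] : IsTestSpace ψ m {f | IsRealSchwartz f} where
  continuous _ hf := hf.continuous
  integrable _ hf := hf.integrable m
  exists_ne_zero := exists_isRealSchwartz_ne_zero
  smul c _ hf := hf.const_mul c
  comp_rightAct a _ hf := hf.comp_rightAct a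
  comp_invAct h₁ h₂ _ hf := hf.comp_invAct h₁ h₂
  siegel_mul b _ hf := hf.siegel_mul hψ hψ1 b
  fourier _ hf := hf.fourier hψ hψ1 m

end RealSchwartz

/-! ### The Casimir operator and Schur's lemma -/

theorem exists_injective_intertwiningMap_fin {k G V : Type*} [Field k] [Monoid G]
    [AddCommGroup V] [Module k V] {ρ : Representation k G V} (S : Subrepresentation ρ)
    [FiniteDimensional k S.toSubmodule] :
    ∃ (τ : Representation k G (Fin (Module.finrank k S.toSubmodule) → k))
      (T : τ.IntertwiningMap ρ), Function.Injective T := by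
  let e := (Module.finBasis k S.toSubmodule).equivFun
  refine ⟨(e.conjRingEquiv : _ →* _).comp S.toRepresentation,
    (S.toSubmodule.subtype ∘ₗ e.symm.toLinearMap).intertwiningMap_of_isIntertwiningMap _ _
      fun g v => ?_, Subtype.val_injective.comp e.symm.injective⟩
  simp [LinearEquiv.conjRingEquiv, Subrepresentation.toRepresentation]

-- A representation of least positive dimension which embeds is irreducible.
theorem exists_isIrreducible_intertwiningMap_ne_zero {k G V : Type*} [Field k] [Monoid G]
    [AddCommGroup V] [Module k V] {ρ : Representation k G V} (N : Subrepresentation ρ)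
    [FiniteDimensional k N.toSubmodule] [Nontrivial N.toSubmodule] :
    ∃ (n : ℕ) (τ : Representation k G (Fin n → k)), τ.IsIrreducible ∧
      ∃ T : τ.IntertwiningMap ρ, T ≠ 0 := by
  classical
  have hex : ∃ n, 0 < n ∧ ∃ (τ : Representation k G (Fin n → k)) (T : τ.IntertwiningMap ρ),
      Function.Injective T :=
    ⟨_, Module.finrank_pos, exists_injective_intertwiningMap_fin N⟩
  obtain ⟨hpos, τ, T, hT⟩ := Nat.find_spec hex
  have : NeZero (Nat.find hex) := ⟨hpos.ne'⟩
  refine ⟨_, τ, ?_, T, fun h => one_ne_zero (α := Fin (Nat.find hex) → k) (hT (by simp [h]))⟩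
  have : Nontrivial (Subrepresentation τ) :=
    ⟨⊥, ⊤, fun h => bot_ne_top (congrArg Subrepresentation.toSubmodule h)⟩
  refine { eq_bot_or_eq_top := fun S => or_iff_not_imp_left.mpr fun hS => ?_ }
  have hrank : 0 < Module.finrank k S.toSubmodule :=
    Submodule.one_le_finrank_iff.mpr fun h => hS (Subrepresentation.toSubmodule_injective h)
  obtain ⟨τ', T', hT'⟩ := exists_injective_intertwiningMap_fin S
  have hmin : Nat.find hex ≤ Module.finrank k S.toSubmodule :=
    Nat.find_min' hex ⟨hrank, τ', T.comp T', hT.comp hT'⟩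
  refine Subrepresentation.toSubmodule_injective
    (Submodule.eq_top_of_finrank_eq (le_antisymm (Submodule.finrank_le _) ?_))
  rwa [Module.finrank_fin_fun]

namespace GKModule

variable {E : Type*} [AddCommGroup E] [Module ℂ E] (π : GKModule E)

/-- The operator by which the elementary matrix with entry `1` in position `(i, j)` acts. -/
def elem (i j : Fin 2) : Module.End ℂ E := π.lie (Matrix.single i j 1)

/-- The Casimir operator `∑ Eᵢⱼ Eⱼᵢ` of `𝔤𝔩₂`. -/
def casimir : Module.End ℂ E := ∑ i, ∑ j, π.elem i j * π.elem j i

theorem lie_eq_sum (X : gl2) : π.lie X = ∑ i, ∑ j, (X i j : ℂ) • π.elem i j := by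
  have hX : X = X 0 0 • Matrix.single 0 0 1 + X 0 1 • Matrix.single 0 1 1 +
      (X 1 0 • Matrix.single 1 0 1 + X 1 1 • Matrix.single 1 1 1) := by
    ext i j; fin_cases i <;> fin_cases j <;> simp
  conv_lhs => rw [hX]
  simp only [lie_add, lie_smul, Fin.sum_univ_two, elem]

theorem lie_zero : π.lie 0 = 0 := by
  simpa using π.lie_smul 0 0

theorem lie_sub (X Y : gl2) : π.lie (X - Y) = π.lie X - π.lie Y := by
  rw [eq_sub_iff_add_eq, ← lie_add, sub_add_cancel]

theorem lie_single_mul_single (i j k l : Fin 2) :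
    π.lie (Matrix.single i j 1 * Matrix.single k l 1) = if j = k then π.elem i l else 0 := by
  split_ifs with h
  · rw [h, Matrix.single_mul_single_same, one_mul, elem]
  · rw [Matrix.single_mul_single_of_ne _ _ _ _ h, lie_zero]

theorem elem_bracket (i j k l : Fin 2) : π.elem i j * π.elem k l - π.elem k l * π.elem i j =
    (if j = k then π.elem i l else 0) - (if l = i then π.elem k j else 0) := by
  rw [elem, elem, ← lie_bracket, lie_sub, lie_single_mul_single, lie_single_mul_single]

theorem casimir_commute_elem (k l : Fin 2) : Commute π.casimir (π.elem k l) := by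
  have leibniz (a b x : Module.End ℂ E) :
      a * b * x - x * (a * b) = a * (b * x - x * b) + (a * x - x * a) * b := by noncomm_ring
  rw [commute_iff_eq, ← sub_eq_zero]
  simp only [casimir, Finset.sum_mul, Finset.mul_sum, ← Finset.sum_sub_distrib, leibniz,
    elem_bracket, mul_sub, sub_mul, mul_ite, ite_mul, mul_zero, zero_mul, Finset.sum_add_distrib]
  simp only [Finset.sum_sub_distrib, Finset.sum_ite_eq, Finset.sum_ite_eq',
    Finset.sum_ite_irrel, Finset.sum_const_zero, Finset.mem_univ, if_true]
  abel

theorem casimir_commute_lie (X : gl2) : Commute π.casimir (π.lie X) := by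
  rw [lie_eq_sum]
  exact Commute.sum_right _ _ _ fun i _ => Commute.sum_right _ _ _ fun j _ =>
    (π.casimir_commute_elem i j).smul_right _

theorem rep_mul_lie (k : O2) (X : gl2) :
    π.rep k * π.lie X = π.lie ((k : gl2) * X * (k : gl2)ᵀ) * π.rep k :=
  LinearMap.ext fun e => π.adjoint k X e

theorem lie_mul_single_mul (A B : gl2) (i j : Fin 2) :
    π.lie (A * Matrix.single i j 1 * B) = ∑ p, ∑ q, ((A p i * B j q : ℝ) : ℂ) • π.elem p q := by
  rw [lie_eq_sum]
  refine Finset.sum_congr rfl fun p _ => Finset.sum_congr rfl fun q _ => ?_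
  simp [Matrix.mul_apply, Matrix.single_apply, Finset.sum_ite_eq, ite_and]

theorem sum_lie_conj_mul_lie_conj {A B : gl2} (hAB : A * B = 1) :
    ∑ i, ∑ j, π.lie (A * Matrix.single i j 1 * B) * π.lie (A * Matrix.single j i 1 * B) =
      π.casimir := by
  have hexpand : ∑ i, ∑ j, π.lie (A * Matrix.single i j 1 * B) *
      π.lie (A * Matrix.single j i 1 * B) = ∑ p, ∑ q, ∑ r, ∑ s,
        (((A * B) p s * (A * B) r q : ℝ) : ℂ) • (π.elem p q * π.elem r s) := by
    simp only [lie_mul_single_mul, Matrix.mul_apply, Fin.sum_univ_two, add_mul, mul_add,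
      smul_mul_assoc, mul_smul_comm]
    match_scalars <;> ring
  rw [hexpand, hAB, casimir]
  simp [Matrix.one_apply]

theorem casimir_commute_rep (k : O2) : Commute π.casimir (π.rep k) := by
  have hk : (k : gl2) * (k : gl2)ᵀ = 1 := (Matrix.mem_orthogonalGroup_iff (Fin 2) ℝ).mp k.2
  have hconj (i j : Fin 2) : π.rep k * (π.elem i j * π.elem j i) =
      π.lie ((k : gl2) * Matrix.single i j 1 * (k : gl2)ᵀ) *
        π.lie ((k : gl2) * Matrix.single j i 1 * (k : gl2)ᵀ) * π.rep k := by
    rw [elem, elem, ← mul_assoc, rep_mul_lie, mul_assoc _ (π.rep k), rep_mul_lie, ← mul_assoc]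
  calc π.casimir * π.rep k
      = ∑ i, ∑ j, π.rep k * (π.elem i j * π.elem j i) := by
        simp only [hconj, ← Finset.sum_mul, π.sum_lie_conj_mul_lie_conj hk]
    _ = π.rep k * π.casimir := by simp only [← Finset.mul_sum, casimir]

/-- The span of the `K`-orbit of a vector. -/
def orbitSpan (e : E) : Subrepresentation π.rep where
  toSubmodule := Submodule.span ℂ (Set.range fun k => π.rep k e)
  apply_mem_toSubmodule k := by
    change Submodule.span ℂ _ ≤ (Submodule.span ℂ _).comap (π.rep k)
    refine Submodule.span_le.mpr ?_
    rintro _ ⟨k', rfl⟩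
    exact Submodule.subset_span ⟨k * k', by simp only [map_mul, Module.End.mul_apply]⟩

theorem mem_orbitSpan (e : E) : e ∈ (π.orbitSpan e).toSubmodule :=
  Submodule.subset_span ⟨1, by simp⟩

instance (e : E) : FiniteDimensional ℂ (π.orbitSpan e).toSubmodule :=
  π.locally_finite e

variable {π}

theorem IsIrredAdmissible.exists_eigenvector (hπ : π.IsIrredAdmissible) {T : Module.End ℂ E}
    (hT : ∀ k, Commute T (π.rep k)) : ∃ (c : ℂ) (v : E), v ≠ 0 ∧ T v = c • v := by
  have := hπ.nontrivial
  obtain ⟨e, he⟩ := exists_ne (0 : E)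
  have : Nontrivial (π.orbitSpan e).toSubmodule :=
    ⟨⟨e, π.mem_orbitSpan e⟩, 0, fun h => he (congrArg Subtype.val h)⟩
  obtain ⟨n, τ, hτ, S₀, hS₀⟩ :=
    exists_isIrreducible_intertwiningMap_ne_zero (π.orbitSpan e)
  have := hπ.admissible n τ hτ
  let T' : π.rep.IntertwiningMap π.rep :=
    T.intertwiningMap_of_isIntertwiningMap _ _ fun k v => LinearMap.congr_fun (hT k).eq v
  let Ω : Module.End ℂ (τ.IntertwiningMap π.rep) :=
    { toFun := T'.comp
      map_add' := fun S₁ S₂ => by ext v; simp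
      map_smul' := fun c S => by ext v; simp }
  have : Nontrivial (τ.IntertwiningMap π.rep) := ⟨S₀, 0, hS₀⟩
  obtain ⟨c, hc⟩ := Module.End.exists_eigenvalue Ω
  obtain ⟨S, hS⟩ := hc.exists_hasEigenvector
  obtain ⟨v, hv⟩ : ∃ v, S v ≠ 0 := by
    by_contra! hzero
    exact hS.2 (DFunLike.ext _ _ hzero)
  exact ⟨c, S v, hv, DFunLike.congr_fun hS.apply_eq_smul v⟩

theorem IsIrredAdmissible.exists_eq_smul (hπ : π.IsIrredAdmissible) {T : Module.End ℂ E}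
    (hlie : ∀ X, Commute T (π.lie X)) (hrep : ∀ k, Commute T (π.rep k)) :
    ∃ c : ℂ, ∀ e, T e = c • e := by
  obtain ⟨c, v, hv, hTv⟩ := hπ.exists_eigenvector hrep
  have hcomm (U : Module.End ℂ E) (hU : Commute T U) (e : E) (he : e ∈ T.eigenspace c) :
      U e ∈ T.eigenspace c := by
    rw [Module.End.mem_eigenspace_iff] at he ⊢
    rw [← Module.End.mul_apply, hU.eq, Module.End.mul_apply, he, map_smul]
  refine ⟨c, fun e => Module.End.mem_eigenspace_iff.mp ?_⟩
  rcases hπ.irreducible (T.eigenspace c) (fun X => hcomm _ (hlie X)) (fun k => hcomm _ (hrep k))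
    with hbot | htop
  · exact absurd ((Submodule.eq_bot_iff _).mp hbot v (Module.End.mem_eigenspace_iff.mpr hTv)) hv
  · exact htop ▸ Submodule.mem_top

theorem IsIrredAdmissible.exists_casimir_eq (hπ : π.IsIrredAdmissible) :
    ∃ c : ℂ, ∀ e, π.casimir e = c • e :=
  hπ.exists_eq_smul π.casimir_commute_lie π.casimir_commute_rep

end GKModule

/-- The generator of the rotations in `𝔤`. -/
def rotGen : gl2 := Matrix.single 0 1 1 - Matrix.single 1 0 1

theorem rotGen_transpose : rotGenᵀ = -rotGen := by
  simp [rotGen]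

theorem exp_mem_orthogonalGroup {n : Type*} [Fintype n] [DecidableEq n] {X : Matrix n n ℝ}
    (hX : Xᵀ = -X) : NormedSpace.exp X ∈ Matrix.orthogonalGroup n ℝ := by
  rw [Matrix.mem_orthogonalGroup_iff]
  change NormedSpace.exp X * (NormedSpace.exp X)ᵀ = 1
  rw [← Matrix.exp_transpose, hX, Matrix.exp_neg]
  exact Matrix.mul_nonsing_inv _ ((Matrix.isUnit_iff_isUnit_det _).mp (Matrix.isUnit_exp _))

theorem GKModule.lie_mem_of_transpose_eq_neg {E : Type*} [AddCommGroup E] [Module ℂ E]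
    {π : GKModule E} (S : Subrepresentation π.rep) {X : gl2} (hX : Xᵀ = -X) {v : E}
    (hv : v ∈ S.toSubmodule) : π.lie X v ∈ S.toSubmodule := by
  have hmem (t : ℝ) : NormedSpace.exp (t • X) ∈ Matrix.orthogonalGroup (Fin 2) ℝ :=
    exp_mem_orthogonalGroup (by rw [Matrix.transpose_smul, hX, smul_neg])
  by_contra hcon
  obtain ⟨l, hl, hlS⟩ := Submodule.exists_le_ker_of_notMem hcon
  have hderiv := π.differential X hX (fun t => ⟨_, hmem t⟩) (fun t => rfl) v l
  have hzero : (fun t : ℝ => l (π.rep ⟨_, hmem t⟩ v)) = fun _ => 0 :=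
    funext fun t => hlS (S.apply_mem_toSubmodule _ hv)
  rw [hzero] at hderiv
  exact hl (hderiv.unique (hasDerivAt_const 0 (0 : ℂ)))

/-! ### Rapid decay for second order differential systems -/

theorem nonpos_of_pos_imp_second_deriv_pos {f f' f'' : ℝ → ℝ} {a b : ℝ}
    (hf : ∀ x, HasDerivAt f (f' x) x) (hf' : ∀ x, HasDerivAt f' (f'' x) x) (ha : f a ≤ 0)
    (hb : f b ≤ 0) (hpos : ∀ x ∈ Set.Ioo a b, 0 < f x → 0 < f'' x) :
    ∀ x ∈ Set.Icc a b, f x ≤ 0 := by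
  intro x hx
  obtain ⟨p, hp, hmax⟩ := isCompact_Icc.exists_isMaxOn ⟨x, hx⟩
    fun y _ => (hf y).continuousAt.continuousWithinAt
  by_contra! hfx
  have hfp : 0 < f p := hfx.trans_le (hmax hx)
  have hp' : p ∈ Set.Ioo a b :=
    ⟨hp.1.lt_of_ne fun h => absurd (h ▸ ha) hfp.not_ge,
      hp.2.lt_of_ne fun h => absurd (h ▸ hb) hfp.not_ge⟩
  have hlocmax : IsLocalMax f p := hmax.isLocalMax (Icc_mem_nhds hp'.1 hp'.2)
  have hderiv : deriv f = f' := funext fun y => (hf y).deriv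
  have hderiv₂ : deriv (deriv f) p = f'' p := by rw [hderiv, (hf' p).deriv]
  have hlocmin : IsLocalMin f p := isLocalMin_of_deriv_deriv_pos
    (hderiv₂ ▸ hpos p hp' hfp) hlocmax.deriv_eq_zero (hf p).continuousAt
  have hconst : f =ᶠ[𝓝 p] fun _ => f p := by
    filter_upwards [hlocmax, hlocmin] with y h₁ h₂ using le_antisymm h₁ h₂
  have hzero : f'' p = 0 := by
    rw [← hderiv₂, hconst.deriv.deriv_eq, deriv_const', deriv_const']
  exact (hpos p hp' hfp).ne' hzero

theorem le_mul_exp_neg_of_mul_le_second_deriv {w w' w'' : ℝ → ℝ} {M u₀ : ℝ} (hM : 0 < M)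
    (hw : ∀ u, HasDerivAt w (w' u) u) (hw' : ∀ u, HasDerivAt w' (w'' u) u)
    (hconv : ∀ u, u₀ ≤ u → M ^ 2 * w u ≤ w'' u)
    (hgrow : w =o[Filter.atTop] fun u => Real.exp (M * u)) {u : ℝ} (hu : u₀ ≤ u) :
    w u ≤ |w u₀| * Real.exp (-M * (u - u₀)) := by
  have hexp (a u : ℝ) :
      HasDerivAt (fun u => Real.exp (a * (u - u₀))) (Real.exp (a * (u - u₀)) * a) u := by
    simpa only [mul_one, id] using (((hasDerivAt_id u).sub_const u₀).const_mul a).exp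
  -- Compare `w` with the solutions `|w u₀| exp (-M (u - u₀)) + δ exp (M (u - u₀))` of `v'' = M² v`.
  have hbarrier (δ : ℝ) (hδ : 0 < δ) :
      w u ≤ |w u₀| * Real.exp (-M * (u - u₀)) + δ * Real.exp (M * (u - u₀)) := by
    obtain ⟨b, hb, hub⟩ := ((hgrow.bound (mul_pos hδ (Real.exp_pos (-M * u₀)))).and
      (Filter.eventually_ge_atTop u)).exists
    have hwb : w b ≤ δ * Real.exp (M * (b - u₀)) := by
      refine (le_abs_self _).trans (hb.trans_eq ?_)
      rw [Real.norm_of_nonneg (Real.exp_pos _).le, mul_assoc, ← Real.exp_add]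
      ring_nf
    refine sub_nonpos.mp (nonpos_of_pos_imp_second_deriv_pos (a := u₀) (b := b)
      (f := fun u => w u -
        (|w u₀| * Real.exp (-M * (u - u₀)) + δ * Real.exp (M * (u - u₀))))
      (fun x => (hw x).sub (((hexp (-M) x).const_mul _).add ((hexp M x).const_mul _)))
      (fun x => (hw' x).sub ((((hexp (-M) x).mul_const _).const_mul _).add
        (((hexp M x).mul_const _).const_mul _))) ?_ ?_ (fun x hx hpos => ?_) u ⟨hu, hub⟩)
    · simp only [sub_self, mul_zero, Real.exp_zero, mul_one]
      linarith [le_abs_self (w u₀)]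
    · have := mul_nonneg (abs_nonneg (w u₀)) (Real.exp_pos (-M * (b - u₀))).le
      linarith
    · have := hconv x hx.1.le
      nlinarith [mul_pos (pow_pos hM 2) hpos]
  refine le_of_forall_pos_le_add fun η hη => ?_
  have hδ := hbarrier (η * Real.exp (-(M * (u - u₀)))) (by positivity)
  rwa [mul_assoc, ← Real.exp_add, neg_add_cancel, Real.exp_zero, mul_one] at hδ

theorem exists_forall_ge_le_sq_sub {β : ℝ} (hβ : β ≠ 0) (L K : ℝ) :
    ∃ t₀ : ℝ, ∀ t, t₀ ≤ t → K ≤ (β * t) ^ 2 - L * t := by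
  have hlim : Filter.Tendsto (fun t : ℝ => t * (β ^ 2 * t - L)) Filter.atTop Filter.atTop :=
    Filter.tendsto_id.atTop_mul_atTop₀ (Filter.tendsto_atTop_add_const_right _ (-L)
      (Filter.tendsto_id.const_mul_atTop (by positivity)))
  obtain ⟨t₀, ht₀⟩ := Filter.eventually_atTop.mp (hlim.eventually_ge_atTop K)
  exact ⟨t₀, fun t ht => (ht₀ t ht).trans_eq (by ring)⟩

section System

variable {V : Type*} [NormedAddCommGroup V] [InnerProductSpace ℝ V]

theorem two_mul_sq_norm_le_of_norm_sub_smul_le {x x' x'' : V} {k L t : ℝ}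
    (h : ‖x'' - k • x‖ ≤ L * (‖x'‖ + t * ‖x‖)) :
    2 * (k - L * t - L ^ 2 / 4) * ‖x‖ ^ 2 ≤ 2 * (inner ℝ x x'' + inner ℝ x' x') := by
  have hinner : inner ℝ x x'' = k * ‖x‖ ^ 2 + inner ℝ x (x'' - k • x) := by
    rw [inner_sub_right, real_inner_smul_right, real_inner_self_eq_norm_sq]
    ring
  have hcross : -(‖x‖ * (L * (‖x'‖ + t * ‖x‖))) ≤ inner ℝ x (x'' - k • x) :=
    (neg_le_neg (mul_le_mul_of_nonneg_left h (norm_nonneg x))).trans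
      (abs_le.mp (abs_real_inner_le_norm _ _)).1
  rw [hinner, real_inner_self_eq_norm_sq]
  nlinarith [sq_nonneg (‖x'‖ - L / 2 * ‖x‖)]

theorem isBigO_exp_neg_of_norm_second_deriv_sub_le {y y' y'' : ℝ → V}
    (hy : ∀ u, HasDerivAt y (y' u) u) (hy' : ∀ u, HasDerivAt y' (y'' u) u) {β L N : ℝ}
    (hβ : β ≠ 0)
    (hode : ∀ u, 0 ≤ u →
      ‖y'' u - (β * Real.exp u) ^ 2 • y u‖ ≤ L * (‖y' u‖ + Real.exp u * ‖y u‖))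
    (hgrow : y =O[Filter.atTop] fun u => Real.exp (N * u)) (M : ℝ) :
    y =O[Filter.atTop] fun u => Real.exp (-(M * u)) := by
  set m : ℝ := max 1 (max (2 * M) (2 * N + 1))
  have hm₁ : 1 ≤ m := le_max_left _ _
  have hmM : 2 * M ≤ m := (le_max_left _ _).trans (le_max_right _ _)
  have hmN : 2 * N + 1 ≤ m := (le_max_right _ _).trans (le_max_right _ _)
  obtain ⟨t₀, ht₀⟩ := exists_forall_ge_le_sq_sub hβ L (m ^ 2 / 2 + L ^ 2 / 4)
  obtain ⟨u₀, hu₀⟩ := Filter.eventually_atTop.mp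
    ((Real.tendsto_exp_atTop.eventually_ge_atTop t₀).and (Filter.eventually_ge_atTop 0))
  have hconv : ∀ u, u₀ ≤ u →
      m ^ 2 * ‖y u‖ ^ 2 ≤ 2 * (inner ℝ (y u) (y'' u) + inner ℝ (y' u) (y' u)) := fun u hu =>
    (mul_le_mul_of_nonneg_right (by linarith [ht₀ _ (hu₀ u hu).1]) (sq_nonneg _)).trans
      (two_mul_sq_norm_le_of_norm_sub_smul_le (hode u (hu₀ u hu).2))
  have hsq : (fun u => ‖y u‖ ^ 2) =o[Filter.atTop] fun u => Real.exp (m * u) := by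
    refine (hgrow.norm_left.pow 2).trans_isLittleO ?_
    simp only [← Real.exp_nat_mul]
    refine Real.isLittleO_exp_comp_exp_comp.mpr ?_
    refine Filter.tendsto_atTop_mono' _ ?_ Filter.tendsto_id
    filter_upwards [Filter.eventually_ge_atTop 0] with u hu
    simp only [id, Nat.cast_ofNat]
    nlinarith
  refine Asymptotics.IsBigO.of_norm_left (Asymptotics.IsBigO.of_pow two_ne_zero ?_)
  refine Asymptotics.IsBigO.of_bound (‖y u₀‖ ^ 2 * Real.exp (m * u₀)) ?_
  filter_upwards [Filter.eventually_ge_atTop (max u₀ 0)] with u hu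
  have hdecay := le_mul_exp_neg_of_mul_le_second_deriv (one_pos.trans_le hm₁)
    (fun u => (hy u).norm_sq) (fun u => ((hy u).inner ℝ (hy' u)).const_mul 2) hconv hsq
    ((le_max_left _ _).trans hu)
  have hu' : 0 ≤ u := (le_max_right _ _).trans hu
  rw [abs_sq] at hdecay
  rw [Pi.pow_apply, Pi.pow_apply, norm_pow, norm_pow, norm_norm,
    Real.norm_of_nonneg (Real.exp_pos _).le, ← Real.exp_nat_mul, mul_assoc, ← Real.exp_add]
  refine hdecay.trans (mul_le_mul_of_nonneg_left (Real.exp_le_exp.mpr ?_) (sq_nonneg _))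
  push_cast
  nlinarith

end System

/-! ### One-parameter subgroups of `GL₂(ℝ)` and moderate growth -/

theorem expGL_add (X : gl2) (s t : ℝ) : expGL X (s + t) = expGL X s * expGL X t := by
  refine Units.ext ?_
  change NormedSpace.exp ((s + t) • X) = NormedSpace.exp (s • X) * NormedSpace.exp (t • X)
  rw [add_smul, Matrix.exp_add_of_commute _ _ (((Commute.refl X).smul_left s).smul_right t)]

theorem expGL_zero (X : gl2) : expGL X 0 = 1 := by
  refine Units.ext ?_
  change NormedSpace.exp ((0 : ℝ) • X) = 1
  rw [zero_smul, NormedSpace.exp_zero]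

theorem expGL_diagonal (v : Fin 2 → ℝ) (t : ℝ) :
    expGL (diagonal v) t = diag (Units.mk0 (Real.exp (t * v 0)) (Real.exp_ne_zero _))
      (Units.mk0 (Real.exp (t * v 1)) (Real.exp_ne_zero _)) := by
  refine Units.ext ?_
  change NormedSpace.exp (t • diagonal v) = _
  rw [← diagonal_smul, Matrix.exp_diagonal]
  ext i j
  fin_cases i <;> fin_cases j <;> simp [diag, Real.exp_eq_exp_ℝ, Pi.coe_exp]

theorem expGL_single_zero_one (t : ℝ) : expGL (single 0 1 1) t = unip t := by
  refine Units.ext ?_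
  change NormedSpace.exp (t • (single 0 1 1 : gl2)) = !![1, t; 0, 1]
  have hsq : (t • (single 0 1 1 : gl2)) ^ 2 = 0 := by
    rw [sq, smul_mul_smul_comm, single_mul_single_of_ne _ _ _ _ (by decide), smul_zero]
  rw [NormedSpace.exp_eq_tsum ℝ]
  change ∑' n : ℕ, ((n.factorial : ℝ)⁻¹ • (t • (single 0 1 1 : gl2)) ^ n) = _
  rw [tsum_eq_sum (s := Finset.range 2) fun n hn => by
    rw [pow_eq_zero_of_le (by simpa [Nat.succ_le_iff] using hn) hsq, smul_zero]]
  ext i j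
  fin_cases i <;> fin_cases j <;> simp [Finset.sum_range_succ]

/-- The one-parameter group of the matrices `[eᵘ, 0; 0, 1]`, which with the centre and `K` exhausts
`GL₂(ℝ)` modulo the unipotent matrices on the left. -/
noncomputable def torus (u : ℝ) : GL (Fin 2) ℝ :=
  diag (Units.mk0 (Real.exp u) (Real.exp_ne_zero u)) 1

theorem expGL_single_zero_zero (t : ℝ) : expGL (single 0 0 1) t = torus t := by
  have hdiag : (single 0 0 1 : gl2) = diagonal ![1, 0] := by
    ext i j; fin_cases i <;> fin_cases j <;> simp
  rw [hdiag, expGL_diagonal]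
  ext i j
  fin_cases i <;> fin_cases j <;> simp [torus, diag]

theorem torus_mul_unip (u t : ℝ) : torus u * unip t = unip (Real.exp u * t) * torus u := by
  ext i j
  fin_cases i <;> fin_cases j <;>
    simp [torus, diag, unip, Matrix.mul_apply, Fin.sum_univ_two]

section Norm

open scoped Matrix.Norms.Elementwise

theorem torus_mem_boundedGL (u : ℝ) : torus u ∈ boundedGL ℝ (Real.exp |u|) := by
  have hone : (1 : ℝ) ≤ Real.exp |u| := Real.one_le_exp (abs_nonneg u)
  refine ⟨(norm_le_iff (Real.exp_pos _).le).mpr fun i j => ?_,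
    (norm_le_iff (Real.exp_pos _).le).mpr fun i j => ?_⟩
  · fin_cases i <;> fin_cases j <;> simp [torus, diag, (Real.exp_pos _).le, le_abs_self, hone]
  · change ‖(!![_, _; _, _] : gl2) i j‖ ≤ _
    fin_cases i <;> fin_cases j <;>
      simp [(Real.exp_pos _).le, neg_le_abs, hone, ← Real.exp_neg]

theorem orthogonal_mem_boundedGL (k : O2) :
    (Unitary.toUnits k : GL (Fin 2) ℝ) ∈ boundedGL ℝ 1 :=
  ⟨entrywise_sup_norm_bound_of_unitary k.2,
    entrywise_sup_norm_bound_of_unitary (Unitary.star_mem k.2)⟩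

instance : CompactSpace O2 := by
  refine isCompact_iff_compactSpace.mp ((isCompact_closedBall (0 : gl2) 1).of_isClosed_subset
    ?_ fun k hk => mem_closedBall_zero_iff.mpr (entrywise_sup_norm_bound_of_unitary hk))
  have hset : ((Matrix.orthogonalGroup (Fin 2) ℝ : Submonoid gl2) : Set gl2) =
      {k | k * kᵀ = 1} :=
    Set.ext fun k => Matrix.mem_orthogonalGroup_iff (Fin 2) ℝ
  change IsClosed ((Matrix.orthogonalGroup (Fin 2) ℝ : Submonoid gl2) : Set gl2)
  rw [hset]
  exact isClosed_eq (by fun_prop) continuous_const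

theorem GKModule.ModerateGrowth.exists_norm_le {W : GL (Fin 2) ℝ → ℂ}
    (hW : GKModule.ModerateGrowth W) :
    ∃ C : ℝ, 0 ≤ C ∧ ∃ N : ℕ, ∀ R, ∀ g ∈ boundedGL ℝ R, ‖W g‖ ≤ C * R ^ N := by
  obtain ⟨C, N, hC⟩ := hW
  refine ⟨|C| * 8 ^ N, by positivity, N, fun R g hg => (hC g).trans ?_⟩
  have hsum : ∑ i, ∑ j, (|(g : gl2) i j| + |((g⁻¹ : GL (Fin 2) ℝ) : gl2) i j|) ≤ 8 * R := by
    refine (Finset.sum_le_sum fun i _ => Finset.sum_le_sum fun j _ => add_le_add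
      ((norm_entry_le_entrywise_sup_norm _).trans hg.1)
      ((norm_entry_le_entrywise_sup_norm _).trans hg.2)).trans_eq ?_
    simp only [Finset.sum_const, Finset.card_univ, Fintype.card_fin, nsmul_eq_mul]
    push_cast
    ring
  rw [mul_assoc, ← mul_pow]
  gcongr
  exact le_abs_self C

end Norm

/-! ### Rapid decay of Whittaker functions -/

theorem mul_self_eq_of_casimir {A : Type*} [Ring A] [Algebra ℂ A] {a b c d : A} {s t : ℂ}
    (htrace : a + d = s • 1) (hbracket : b * c - c * b = a - d)
    (hcasimir : a * a + b * c + (c * b + d * d) = t • 1) :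
    a * a = (s + 1) • a - b * b + b * (b - c) + ((t - s ^ 2 - s) / 2) • (1 : A) := by
  have hd : d = s • 1 - a := eq_sub_of_add_eq' htrace
  have hcb : c * b = b * c - (a - d) := by rw [← hbracket, sub_sub_cancel]
  rw [hcb, hd] at hcasimir
  simp only [sub_mul, mul_sub, smul_mul_assoc, mul_smul_comm, one_mul, mul_one] at hcasimir
  have hone : ((t - s ^ 2 - s) / 2) • (1 : A) =
      (2⁻¹ : ℂ) • (t • (1 : A)) - ((s ^ 2 + s) / 2) • (1 : A) := by module
  rw [hone, ← hcasimir, mul_sub]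
  module

namespace GKModule

variable {E : Type*} [AddCommGroup E] [Module ℂ E] {π : GKModule E}

theorem elem_zero_zero_elem_zero_zero {s c : ℂ} (hs : ∀ e, π.lie 1 e = s • e)
    (hc : ∀ e, π.casimir e = c • e) (e : E) :
    π.elem 0 0 (π.elem 0 0 e) = (s + 1) • π.elem 0 0 e - π.elem 0 1 (π.elem 0 1 e) +
      π.elem 0 1 (π.lie rotGen e) + ((c - s ^ 2 - s) / 2) • e := by
  have htrace : π.elem 0 0 + π.elem 1 1 = s • (1 : Module.End ℂ E) := by
    ext e
    simpa [lie_eq_sum, Fin.sum_univ_two] using hs e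
  have hbracket : π.elem 0 1 * π.elem 1 0 - π.elem 1 0 * π.elem 0 1 =
      π.elem 0 0 - π.elem 1 1 := by
    simpa only [if_true] using π.elem_bracket 0 1 1 0
  have hcasimir : π.elem 0 0 * π.elem 0 0 + π.elem 0 1 * π.elem 1 0 +
      (π.elem 1 0 * π.elem 0 1 + π.elem 1 1 * π.elem 1 1) = c • (1 : Module.End ℂ E) := by
    ext e
    simpa only [casimir, Fin.sum_univ_two, LinearMap.smul_apply, Module.End.one_apply] using hc e
  rw [rotGen, lie_sub]
  exact LinearMap.congr_fun (mul_self_eq_of_casimir htrace hbracket hcasimir) e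

end GKModule

theorem isBigO_exp_neg_of_second_deriv_eq {V : Type*} [NormedAddCommGroup V]
    [InnerProductSpace ℂ V] {y y' y'' : ℝ → V} (hy : ∀ u, HasDerivAt y (y' u) u)
    (hy' : ∀ u, HasDerivAt y' (y'' u) u) {β N : ℝ} {a b c : ℂ} (T : V →L[ℂ] V) (hβ : β ≠ 0)
    (hode : ∀ u, y'' u = a • y' u + (β * Real.exp u) ^ 2 • y u + c • y u +
      Real.exp u • b • T (y u))
    (hgrow : y =O[Filter.atTop] fun u => Real.exp (N * u)) (M : ℝ) :
    y =O[Filter.atTop] fun u => Real.exp (-(M * u)) := by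
  let _ : InnerProductSpace ℝ V := InnerProductSpace.complexToReal
  refine isBigO_exp_neg_of_norm_second_deriv_sub_le (L := ‖a‖ + ‖c‖ + ‖b‖ * ‖T‖) hy hy' hβ
    (fun u hu => ?_) hgrow M
  have hsub : y'' u - (β * Real.exp u) ^ 2 • y u =
      a • y' u + c • y u + Real.exp u • b • T (y u) := by
    rw [hode]
    abel
  have hexp : 1 ≤ Real.exp u := Real.one_le_exp hu
  have hT : ‖Real.exp u • b • T (y u)‖ ≤ Real.exp u * (‖b‖ * (‖T‖ * ‖y u‖)) := by
    rw [norm_smul, norm_smul, Real.norm_of_nonneg (Real.exp_pos u).le]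
    gcongr
    exact T.le_opNorm _
  calc ‖y'' u - (β * Real.exp u) ^ 2 • y u‖
      ≤ ‖a‖ * ‖y' u‖ + ‖c‖ * ‖y u‖ + Real.exp u * (‖b‖ * (‖T‖ * ‖y u‖)) := by
        rw [hsub]
        exact (norm_add₃_le).trans
          (add_le_add (add_le_add (norm_smul _ _).le (norm_smul _ _).le) hT)
    _ ≤ (‖a‖ + ‖c‖ + ‖b‖ * ‖T‖) * (‖y' u‖ + Real.exp u * ‖y u‖) := by
        nlinarith [mul_le_mul_of_nonneg_left hexp (norm_nonneg (y u)), norm_nonneg a,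
          mul_nonneg (norm_nonneg c) (norm_nonneg (y' u)), norm_nonneg c,
          mul_nonneg (mul_nonneg (norm_nonneg b) (norm_nonneg T)) (norm_nonneg (y' u)),
          mul_nonneg (norm_nonneg a) (mul_nonneg (Real.exp_pos u).le (norm_nonneg (y u))),
          mul_le_mul_of_nonneg_left (mul_le_mul_of_nonneg_left hexp (norm_nonneg (y u)))
            (norm_nonneg c)]

theorem exists_forall_ge_norm_le_of_isBigO {V : Type*} [SeminormedAddCommGroup V] {y : ℝ → V}
    {g : ℝ → ℝ} (hy : Continuous y) (hg : Continuous g) (hpos : ∀ u, 0 < g u)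
    (h : y =O[Filter.atTop] g) (a : ℝ) : ∃ C : ℝ, ∀ u, a ≤ u → ‖y u‖ ≤ C * g u := by
  obtain ⟨C, hC⟩ := h.bound
  obtain ⟨b, hb⟩ := Filter.eventually_atTop.mp hC
  obtain ⟨B, hB⟩ := (isCompact_Icc (a := a) (b := b)).exists_bound_of_continuousOn
    (hy.norm.div hg fun u => (hpos u).ne').continuousOn
  refine ⟨max B C, fun u hu => ?_⟩
  rcases le_total u b with hub | hub
  · refine ((div_le_iff₀ (hpos u)).mp ((le_abs_self _).trans (hB u ⟨hu, hub⟩))).trans ?_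
    exact mul_le_mul_of_nonneg_right (le_max_left _ _) (hpos u).le
  · refine (hb u hub).trans ?_
    rw [Real.norm_of_nonneg (hpos u).le]
    exact mul_le_mul_of_nonneg_right (le_max_right _ _) (hpos u).le

namespace GKModule

variable {E : Type*} [AddCommGroup E] [Module ℂ E] {π : GKModule E} {ψ : AddChar ℝ Circle}

/-- `ℓ` is a `(𝔤, K)`-map from `π` into the space of Whittaker functions of moderate growth. The
image of such a map is contained in the Whittaker model of `π`. -/
structure IsWhittakerMap (π : GKModule E) (ψ : AddChar ℝ Circle)
    (ℓ : E →ₗ[ℂ] (GL (Fin 2) ℝ → ℂ)) : Prop where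
  continuous : ∀ e, Continuous (ℓ e)
  growth : ∀ e, ModerateGrowth (ℓ e)
  unip_mul : ∀ e (x : ℝ) g, ℓ e (unip x * g) = (ψ x : ℂ) * ℓ e g
  rep : ∀ e (k : O2) g, ℓ (π.rep k e) g = ℓ e (g * Unitary.toUnits k)
  hasDerivAt_zero : ∀ e (X : gl2) g,
    HasDerivAt (fun t : ℝ => ℓ e (g * expGL X t)) (ℓ (π.lie X e) g) 0

theorem exists_isWhittakerMap {W : GL (Fin 2) ℝ → ℂ} (hW : W ∈ π.whittakerModel ψ) :
    ∃ ℓ, IsWhittakerMap π ψ ℓ ∧ ∃ e, W = ℓ e := by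
  obtain ⟨ℓ, hcont, hgrowth, hunip, hrep, hderiv, he⟩ := hW
  exact ⟨ℓ, ⟨hcont, hgrowth, hunip, hrep, hderiv⟩, he⟩

namespace IsWhittakerMap

variable {ℓ : E →ₗ[ℂ] (GL (Fin 2) ℝ → ℂ)}

theorem hasDerivAt_mul_expGL (h : IsWhittakerMap π ψ ℓ) (e : E) (X : gl2) (g : GL (Fin 2) ℝ)
    (t : ℝ) :
    HasDerivAt (fun t => ℓ e (g * expGL X t)) (ℓ (π.lie X e) (g * expGL X t)) t := by
  have hzero := h.hasDerivAt_zero e X (g * expGL X t)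
  rw [← sub_self t] at hzero
  refine (hzero.comp_sub_const t t).congr_of_eventuallyEq (Filter.Eventually.of_forall fun r => ?_)
  simp only [mul_assoc, ← expGL_add, add_sub_cancel]

theorem hasDerivAt_torus (h : IsWhittakerMap π ψ ℓ) (e : E) (u : ℝ) :
    HasDerivAt (fun u => ℓ e (torus u)) (ℓ (π.elem 0 0 e) (torus u)) u := by
  simpa only [one_mul, expGL_single_zero_zero, elem] using
    h.hasDerivAt_mul_expGL e (single 0 0 1) 1 u

theorem mul_expGL_one (h : IsWhittakerMap π ψ ℓ) {s : ℂ} (hs : ∀ e, π.lie 1 e = s • e) (e : E)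
    (g : GL (Fin 2) ℝ) (t : ℝ) : ℓ e (g * expGL 1 t) = Complex.exp (s * t) * ℓ e g := by
  have hderiv (t : ℝ) :
      HasDerivAt (fun t => ℓ e (g * expGL 1 t)) (s * ℓ e (g * expGL 1 t)) t := by
    simpa only [hs, map_smul, Pi.smul_apply, smul_eq_mul] using h.hasDerivAt_mul_expGL e 1 g t
  simpa only [expGL_zero, mul_one] using eq_cexp_mul_of_hasDerivAt hderiv t

theorem neg_mul_left (h : IsWhittakerMap π ψ ℓ) {c : ℂ} (hc : ∀ e, π.rep (-1) e = c • e) (e : E)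
    (g : GL (Fin 2) ℝ) : ℓ e (-g) = c * ℓ e g := by
  have hneg : (Unitary.toUnits (-1 : O2) : GL (Fin 2) ℝ) = -1 := Units.ext rfl
  have hrep := h.rep e (-1) g
  rwa [hneg, hc, map_smul, Pi.smul_apply, smul_eq_mul, mul_neg, mul_one, eq_comm] at hrep

end IsWhittakerMap

end GKModule

theorem diag_self_mul_comm {F : Type*} [Field F] (z : Fˣ) (g : GL (Fin 2) F) :
    diag z z * g = g * diag z z := by
  ext i j
  fin_cases i <;> fin_cases j <;> simp [diag, Matrix.mul_apply, Fin.sum_univ_two, mul_comm]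

theorem diag_self_neg {F : Type*} [Field F] (z : Fˣ) : diag (-z) (-z) = -diag z z := by
  ext i j
  fin_cases i <;> fin_cases j <;> simp [diag]

theorem expGL_one_log {z : ℝˣ} (hz : 0 < (z : ℝ)) : expGL 1 (Real.log z) = diag z z := by
  have hexp : Units.mk0 (Real.exp (Real.log z * 1)) (Real.exp_ne_zero _) = z :=
    Units.ext (by rw [Units.val_mk0, mul_one, Real.exp_log hz])
  rw [← diagonal_one, expGL_diagonal, hexp]

namespace GKModule.IsWhittakerMap

variable {E : Type*} [AddCommGroup E] [Module ℂ E] {π : GKModule E} {ψ : AddChar ℝ Circle}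
  {ℓ : E →ₗ[ℂ] (GL (Fin 2) ℝ → ℂ)}

theorem diag_self_mul (h : IsWhittakerMap π ψ ℓ) {ω : ℝˣ →* ℂˣ} (hω : π.HasCentralChar ω) (e : E)
    (z : ℝˣ) (g : GL (Fin 2) ℝ) : ℓ e (diag z z * g) = (ω z : ℂ) * ℓ e g := by
  obtain ⟨hneg, s, hs, hpos⟩ := hω
  have hpos' (z : ℝˣ) (hz : 0 < (z : ℝ)) : ℓ e (diag z z * g) = (ω z : ℂ) * ℓ e g := by
    rw [diag_self_mul_comm, ← expGL_one_log hz, h.mul_expGL_one hs, hpos z hz]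
  rcases lt_or_gt_of_ne z.ne_zero with hz | hz
  · rw [← neg_neg z, diag_self_neg, neg_mul, h.neg_mul_left hneg,
      hpos' (-z) (by rwa [Units.val_neg, neg_pos]), ← mul_assoc, ← Units.val_mul, ← map_mul,
      neg_one_mul]
  · exact hpos' z hz

theorem isWhittaker (h : IsWhittakerMap π ψ ℓ) {ω : ℝˣ →* ℂˣ} (hω : π.HasCentralChar ω) (e : E) :
    IsWhittaker ψ ω (ℓ e) := fun z x g => by
  rw [mul_assoc, h.diag_self_mul hω, h.unip_mul, mul_assoc]

open scoped FourierTransform in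
theorem elem_zero_one_torus (h : IsWhittakerMap π ψ ℓ) {α : ℝ} (hα : ∀ x, ψ x = 𝐞 (α * x))
    (e : E) (u : ℝ) : ℓ (π.elem 0 1 e) (torus u) =
      Real.exp u • (2 * Real.pi * α * Complex.I) • ℓ e (torus u) := by
  have hderiv := h.hasDerivAt_zero e (single 0 1 1) (torus u)
  simp only [expGL_single_zero_one, torus_mul_unip, h.unip_mul, hα] at hderiv
  have hchar : HasDerivAt (fun t : ℝ => (𝐞 (α * (Real.exp u * t)) : ℂ))
      (2 * Real.pi * Complex.I * (α * Real.exp u)) 0 := by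
    have := (Real.hasDerivAt_fourierChar (α * (Real.exp u * 0))).scomp (0 : ℝ)
      (((hasDerivAt_id (0 : ℝ)).const_mul (Real.exp u)).const_mul α)
    simpa [Function.comp_def, mul_comm, mul_assoc, mul_left_comm] using this
  rw [elem, hderiv.unique (hchar.mul_const _), Complex.real_smul, smul_eq_mul]
  ring

open scoped FourierTransform in
theorem elem_zero_zero_elem_zero_zero_torus (h : IsWhittakerMap π ψ ℓ) {α : ℝ}
    (hα : ∀ x, ψ x = 𝐞 (α * x)) {s c : ℂ} (hs : ∀ e, π.lie 1 e = s • e)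
    (hc : ∀ e, π.casimir e = c • e) (e : E) (u : ℝ) :
    ℓ (π.elem 0 0 (π.elem 0 0 e)) (torus u) = (s + 1) • ℓ (π.elem 0 0 e) (torus u) +
      (2 * Real.pi * α * Real.exp u) ^ 2 • ℓ e (torus u) +
      ((c - s ^ 2 - s) / 2) • ℓ e (torus u) +
      Real.exp u • (2 * Real.pi * α * Complex.I) • ℓ (π.lie rotGen e) (torus u) := by
  rw [elem_zero_zero_elem_zero_zero hs hc]
  simp only [map_add, map_sub, map_smul, Pi.add_apply, Pi.sub_apply, Pi.smul_apply,
    h.elem_zero_one_torus hα, Complex.real_smul, smul_eq_mul]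
  generalize Real.exp u = r
  push_cast
  linear_combination -(2 * Real.pi * α * r : ℂ) ^ 2 * ℓ e (torus u) * Complex.I_sq

theorem exists_isBigO_torus_exp (h : IsWhittakerMap π ψ ℓ) {n : ℕ} (f : Fin n → E) :
    ∃ N : ℝ, ∀ i, (fun u => ℓ (f i) (torus u)) =O[Filter.atTop] fun u => Real.exp (N * u) := by
  choose C hC₀ N hC using fun i => (h.growth (f i)).exists_norm_le
  refine ⟨(Finset.univ.sup N : ℕ), fun i => Asymptotics.IsBigO.of_bound (C i) ?_⟩
  filter_upwards [Filter.eventually_ge_atTop 0] with u hu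
  refine (hC i _ _ (torus_mem_boundedGL u)).trans (mul_le_mul_of_nonneg_left ?_ (hC₀ i))
  rw [Real.norm_of_nonneg (Real.exp_pos _).le, abs_of_nonneg hu, ← Real.exp_nat_mul]
  gcongr
  exact Finset.le_sup (Finset.mem_univ i)

theorem isBigO_torus_exp_neg (h : IsWhittakerMap π ψ ℓ) (hψ : Continuous ψ) (hψ1 : ψ ≠ 1)
    {s c : ℂ} (hs : ∀ e, π.lie 1 e = s • e) (hc : ∀ e, π.casimir e = c • e) {n : ℕ} {f : Fin n → E}
    {A : Matrix (Fin n) (Fin n) ℂ} (hA : ∀ i, π.lie rotGen (f i) = ∑ j, A i j • f j) (M : ℝ)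
    (i : Fin n) :
    (fun u => ℓ (f i) (torus u)) =O[Filter.atTop] fun u => Real.exp (-(M * u)) := by
  obtain ⟨α, hα₀, hα⟩ := exists_eq_fourierChar hψ hψ1
  let y (T : Module.End ℂ E) (u : ℝ) : EuclideanSpace ℂ (Fin n) :=
    WithLp.toLp 2 fun i => ℓ (T (f i)) (torus u)
  have hy (T : Module.End ℂ E) (u : ℝ) : HasDerivAt (y T) (y (π.elem 0 0 * T) u) u :=
    (PiLp.hasFDerivAt_toLp (𝕜 := ℝ) 2 _).comp_hasDerivAt u
      (hasDerivAt_pi.mpr fun i => h.hasDerivAt_torus (T (f i)) u)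
  obtain ⟨N, hN⟩ := h.exists_isBigO_torus_exp f
  have hgrow : y 1 =O[Filter.atTop] fun u => Real.exp (N * u) :=
    ((PiLp.continuousLinearEquiv 2 ℂ fun _ : Fin n => ℂ).symm.isBigO_comp _ _).trans
      (Asymptotics.isBigO_pi.mpr hN)
  have hode (u : ℝ) : y (π.elem 0 0 * (π.elem 0 0 * 1)) u = (s + 1) • y (π.elem 0 0 * 1) u +
      (2 * Real.pi * α * Real.exp u) ^ 2 • y 1 u + ((c - s ^ 2 - s) / 2) • y 1 u +
      Real.exp u • (2 * Real.pi * α * Complex.I) • toEuclideanCLM (𝕜 := ℂ) A (y 1 u) := by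
    ext j
    have hmulVec : (A *ᵥ fun i => ℓ (f i) (torus u)) j = ℓ (π.lie rotGen (f j)) (torus u) := by
      simp only [hA, mulVec, dotProduct, map_sum, map_smul, Finset.sum_apply, Pi.smul_apply,
        smul_eq_mul]
    refine (h.elem_zero_zero_elem_zero_zero_torus hα hs hc (f j) u).trans ?_
    rw [← hmulVec]
    rfl
  exact (Asymptotics.IsBigO.of_norm_le fun u => PiLp.norm_apply_le (y 1 u) i).trans
    (isBigO_exp_neg_of_second_deriv_eq (hy 1) (hy _) (toEuclideanCLM (𝕜 := ℂ) A)
      (by positivity) hode hgrow M).norm_left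

end GKModule.IsWhittakerMap

namespace GKModule

variable {E : Type*} [AddCommGroup E] [Module ℂ E]

theorem exists_bound_apply_rep (π : GKModule E) (e : E) (l : E →ₗ[ℂ] ℂ) :
    ∃ B, ∀ k, ‖l (π.rep k e)‖ ≤ B := by
  obtain ⟨B, hB⟩ := (isCompact_range (π.continuous e l)).isBounded.exists_norm_le
  exact ⟨B, fun k => hB _ ⟨k, rfl⟩⟩

theorem exists_fin_rep_eq_sum (π : GKModule E) (e : E) :
    ∃ (n : ℕ) (f : Fin n → E) (A : Matrix (Fin n) (Fin n) ℂ) (c : O2 → Fin n → ℂ) (B : ℝ),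
      (∀ i, π.lie rotGen (f i) = ∑ j, A i j • f j) ∧ (∀ k, π.rep k e = ∑ i, c k i • f i) ∧
      ∀ k i, ‖c k i‖ ≤ B := by
  let b := Module.finBasis ℂ (π.orbitSpan e).toSubmodule
  have hsum (v : E) (hv : v ∈ (π.orbitSpan e).toSubmodule) :
      v = ∑ i, b.repr ⟨v, hv⟩ i • (b i : E) := by
    simpa only [Submodule.coe_sum, Submodule.coe_smul, eq_comm] using
      congrArg Subtype.val (b.sum_repr ⟨v, hv⟩)
  choose l hl using fun i => LinearMap.exists_extend (b.coord i)
  have hrepr (i) (v : E) (hv : v ∈ (π.orbitSpan e).toSubmodule) : b.repr ⟨v, hv⟩ i = l i v :=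
    (LinearMap.congr_fun (hl i) ⟨v, hv⟩).symm
  choose B hB using fun i => π.exists_bound_apply_rep e (l i)
  refine ⟨_, fun i => b i, fun i j => l j (π.lie rotGen (b i)), fun k i => l i (π.rep k e),
    ∑ i, |B i|, fun i => ?_, fun k => ?_, fun k i => (hB i k).trans ?_⟩
  · simp only [← hrepr _ _ (π.lie_mem_of_transpose_eq_neg (π.orbitSpan e) rotGen_transpose (b i).2)]
    exact hsum _ _
  · simp only [← hrepr _ _ ((π.orbitSpan e).apply_mem_toSubmodule k (π.mem_orbitSpan e))]
    exact hsum _ _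
  · exact (le_abs_self _).trans
      (Finset.single_le_sum (f := fun i => |B i|) (fun _ _ => abs_nonneg _) (Finset.mem_univ i))

theorem IsWhittakerMap.exists_norm_torus_mul_le {π : GKModule E} {ψ : AddChar ℝ Circle}
    {ℓ : E →ₗ[ℂ] (GL (Fin 2) ℝ → ℂ)} (h : IsWhittakerMap π ψ ℓ) (hψ : Continuous ψ) (hψ1 : ψ ≠ 1)
    {s c : ℂ} (hs : ∀ e, π.lie 1 e = s • e) (hc : ∀ e, π.casimir e = c • e) (e : E) (M : ℝ) :
    ∃ C : ℝ, ∀ u, 0 ≤ u → ∀ k : O2,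
      ‖ℓ e (torus u * Unitary.toUnits k)‖ ≤ C * Real.exp (-(M * u)) := by
  obtain ⟨n, f, A, a, B, hA, hrep, hB⟩ := π.exists_fin_rep_eq_sum e
  have hcont (e : E) : Continuous fun u => ℓ e (torus u) :=
    continuous_iff_continuousAt.mpr fun u => (h.hasDerivAt_torus e u).continuousAt
  choose C hC using fun i => exists_forall_ge_norm_le_of_isBigO (hcont (f i))
    (by fun_prop) (fun u => Real.exp_pos (-(M * u)))
    (h.isBigO_torus_exp_neg hψ hψ1 hs hc hA M i) 0
  refine ⟨∑ i, B * C i, fun u hu k => ?_⟩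
  rw [← h.rep, hrep, map_sum, Finset.sum_apply, Finset.sum_mul]
  refine (norm_sum_le _ _).trans (Finset.sum_le_sum fun i _ => ?_)
  rw [map_smul, Pi.smul_apply, norm_smul, mul_assoc]
  exact mul_le_mul (hB k i) (hC i u hu) (norm_nonneg _) ((norm_nonneg _).trans (hB k i))

end GKModule

/-! ### Volume growth and integrability -/

section Volume

theorem IsInvariantMeasure.measure_image_mk_le {F : Type*} [Field F] [TopologicalSpace F]
    {μ : Measure (NHatQuot F)} (hμ : IsInvariantMeasure μ) {A S : Set (DetPairs F)} {ι : Type*}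
    [Fintype ι] (c : DetPairs F → ι) (hc : ∀ h ∈ A, ∀ b ∈ A, c h = c b → h * b⁻¹ ∈ S) :
    μ (NHatQuot.mk F '' A) ≤ Fintype.card ι * μ (NHatQuot.mk F '' S) := by
  let b : ι → DetPairs F := Function.invFunOn c A
  let T := toMeasurable μ (NHatQuot.mk F '' S)
  have hcover : NHatQuot.mk F '' A ⊆ ⋃ i, NHatQuot.rightMul F (b i)⁻¹ ⁻¹' T := by
    rintro _ ⟨h, hh, rfl⟩
    have hex : ∃ a ∈ A, c a = c h := ⟨h, hh, rfl⟩
    exact Set.mem_iUnion.mpr ⟨c h, subset_toMeasurable μ _ ⟨h * (b (c h))⁻¹,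
      hc h hh _ (Function.invFunOn_mem hex) (Function.invFunOn_eq hex).symm, rfl⟩⟩
  calc μ (NHatQuot.mk F '' A) ≤ ∑ i, μ (NHatQuot.rightMul F (b i)⁻¹ ⁻¹' T) :=
        (measure_mono hcover).trans (measure_iUnion_fintype_le _ _)
    _ = Fintype.card ι * μ (NHatQuot.mk F '' S) := by
      simp only [hμ.invariant _ _ (measurableSet_toMeasurable _ _), T, measure_toMeasurable,
        Finset.sum_const, Finset.card_univ, nsmul_eq_mul]

theorem exists_fin_code {n : ℕ} (hn : 0 < n) :
    ∃ c : ℝ → Fin (3 * n ^ 2), ∀ x y : ℝ, |x| ≤ n → |y| ≤ n → c x = c y → |x - y| ≤ (n : ℝ)⁻¹ := by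
  have hcard : Fintype.card (Set.Icc (-(n ^ 2 : ℤ)) (n ^ 2)) ≤ Fintype.card (Fin (3 * n ^ 2)) := by
    have hpos : (0 : ℤ) < n ^ 2 := by positivity
    rw [← Set.toFinset_card, Set.toFinset_Icc, Int.card_Icc, Fintype.card_fin, Int.toNat_le]
    push_cast
    linarith
  obtain ⟨e⟩ := Function.Embedding.nonempty_of_card_le hcard
  have hn0 : (0 : ℝ) < n := Nat.cast_pos.mpr hn
  have hmem : ∀ x : ℝ, |x| ≤ n → ⌊n * x⌋ ∈ Set.Icc (-(n ^ 2 : ℤ)) (n ^ 2) := fun x hx => by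
    obtain ⟨hlow, hup⟩ := abs_le.mp hx
    refine ⟨Int.le_floor.mpr ?_, Int.floor_le_iff.mpr ?_⟩ <;> push_cast <;> nlinarith
  have hle : -(n ^ 2 : ℤ) ≤ n ^ 2 := neg_le_self (by positivity)
  refine ⟨fun x => e (Set.projIcc _ _ hle ⌊n * x⌋), fun x y hx hy hxy => ?_⟩
  have hfloor : ⌊n * x⌋ = ⌊n * y⌋ := by
    simpa only [Set.projIcc_of_mem hle (hmem x hx), Set.projIcc_of_mem hle (hmem y hy),
      Subtype.mk.injEq] using e.injective hxy
  have hlt := Int.abs_sub_lt_one_of_floor_eq_floor hfloor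
  rw [← mul_sub, abs_mul, Nat.abs_cast] at hlt
  rw [← one_div, le_div_iff₀' hn0]
  exact hlt.le

open scoped Matrix.Norms.Elementwise

theorem mul_inv_mem_boundedGL {F : Type*} [NormedField F] {R : ℝ} (hR : 0 < R)
    {g b : GL (Fin 2) F} (hg : g ∈ boundedGL F R) (hb : b ∈ boundedGL F R)
    (hgb : ‖(g : Matrix (Fin 2) (Fin 2) F) - b‖ ≤ R⁻¹) : g * b⁻¹ ∈ boundedGL F 3 := by
  have near : ∀ x y : GL (Fin 2) F, y ∈ boundedGL F R →
      ‖(x : Matrix (Fin 2) (Fin 2) F) - y‖ ≤ R⁻¹ →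
      ‖((x * y⁻¹ : GL (Fin 2) F) : Matrix (Fin 2) (Fin 2) F)‖ ≤ 3 := fun x y hy hxy => by
    have hsplit : ((x * y⁻¹ : GL (Fin 2) F) : Matrix (Fin 2) (Fin 2) F) =
        1 + ((x : Matrix (Fin 2) (Fin 2) F) - y) *
          ((y⁻¹ : GL (Fin 2) F) : Matrix (Fin 2) (Fin 2) F) := by
      rw [Matrix.sub_mul, Units.mul_inv, Units.val_mul, add_sub_cancel]
    have hone : ‖(1 : Matrix (Fin 2) (Fin 2) F)‖ ≤ 1 :=
      (Matrix.norm_le_iff zero_le_one).mpr fun i j => by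
        fin_cases i <;> fin_cases j <;> simp
    calc ‖((x * y⁻¹ : GL (Fin 2) F) : Matrix (Fin 2) (Fin 2) F)‖
        ≤ ‖(1 : Matrix (Fin 2) (Fin 2) F)‖ + 2 * (‖(x : Matrix (Fin 2) (Fin 2) F) - y‖ *
          ‖((y⁻¹ : GL (Fin 2) F) : Matrix (Fin 2) (Fin 2) F)‖) := by
          rw [hsplit]
          exact norm_add_le_of_le le_rfl (norm_matrix_mul_le _ _)
      _ ≤ 1 + 2 * (R⁻¹ * R) := by gcongr; exact hy.2
      _ = 3 := by rw [inv_mul_cancel₀ hR.ne']; norm_num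
  refine ⟨near g b hb hgb, ?_⟩
  rw [_root_.mul_inv_rev, inv_inv]
  exact near b g hg (by rwa [norm_sub_rev])

theorem IsInvariantMeasure.exists_measure_boundedPairs_le {μ : Measure (NHatQuot ℝ)}
    (hμ : IsInvariantMeasure μ) :
    ∃ K : ENNReal, K ≠ ⊤ ∧ ∀ n : ℕ, 0 < n →
      μ (NHatQuot.mk ℝ '' boundedPairs ℝ n) ≤ (n : ENNReal) ^ 16 * K := by
  refine ⟨3 ^ 8 * μ (NHatQuot.mk ℝ '' boundedPairs ℝ 3), ENNReal.mul_ne_top (by norm_num)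
    (hμ.finite_on_compacts _
      ((isCompact_boundedPairs 3).image NHatQuot.isQuotientMap_mk.continuous)).ne, fun n hn => ?_⟩
  obtain ⟨c, hc⟩ := exists_fin_code hn
  have hn0 : (0 : ℝ) < n := Nat.cast_pos.mpr hn
  let code : DetPairs ℝ → (Fin 2 → Fin 2 → Fin (3 * n ^ 2)) × (Fin 2 → Fin 2 → Fin (3 * n ^ 2)) :=
    fun h => (fun i j => c (h.1.1 i j), fun i j => c (h.1.2 i j))
  have near : ∀ g ∈ boundedGL ℝ n, ∀ b ∈ boundedGL ℝ n,
      (fun i j => c (g i j)) = (fun i j => c (b i j)) → g * b⁻¹ ∈ boundedGL ℝ 3 :=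
    fun g hg b hb hgb => mul_inv_mem_boundedGL hn0 hg hb <|
      (Matrix.norm_le_iff (inv_nonneg.mpr hn0.le)).mpr fun i j => hc _ _
        ((Matrix.norm_entry_le_entrywise_sup_norm _).trans hg.1)
        ((Matrix.norm_entry_le_entrywise_sup_norm _).trans hb.1) (congr_fun₂ hgb i j)
  refine (hμ.measure_image_mk_le (S := boundedPairs ℝ 3) code fun h hh b hb hhb =>
    ⟨near _ hh.1 _ hb.1 (congr_arg Prod.fst hhb),
      near _ hh.2 _ hb.2 (congr_arg Prod.snd hhb)⟩).trans_eq ?_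
  simp only [Fintype.card_prod, Fintype.card_pi, Fintype.card_fin, Finset.prod_const,
    Finset.card_univ]
  push_cast
  ring

end Volume

section Integrability

theorem integrable_of_norm_mul_pow_le {X E : Type*} [MeasurableSpace X] [NormedAddCommGroup E]
    {μ : Measure X} {A : ℕ → Set X} {d : ℕ} {K : ENNReal} (hK : K ≠ ⊤)
    (hA : ∀ n, 0 < n → μ (A n) ≤ (n : ENNReal) ^ d * K) {f : X → E}
    (hf : AEStronglyMeasurable f μ) {C : ℝ}
    (hC : ∀ x, ∃ n, 0 < n ∧ x ∈ A n ∧ ‖f x‖ * n ^ (d + 2) ≤ C) : Integrable f μ := by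
  let a : ℕ → ENNReal := fun n => ENNReal.ofReal (C / n ^ (d + 2))
  let T : ℕ → Set X := fun n => toMeasurable μ (A n)
  have hbound : ∀ x, ‖f x‖ₑ ≤ ∑' n, (T n).indicator (fun _ => a n) x := fun x => by
    obtain ⟨n, hn, hx, hfx⟩ := hC x
    refine le_trans ?_ (ENNReal.le_tsum n)
    rw [Set.indicator_of_mem (subset_toMeasurable μ _ hx), ← ofReal_norm]
    exact ENNReal.ofReal_le_ofReal ((le_div_iff₀ (by positivity)).mpr hfx)
  have hterm : ∀ n, a n * μ (T n) ≤ ENNReal.ofReal (C * (1 / n ^ 2)) * K := fun n => by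
    rcases n.eq_zero_or_pos with rfl | hn
    · simp [a]
    have hn0 : (0 : ℝ) < n := Nat.cast_pos.mpr hn
    calc a n * μ (T n) ≤ a n * ((n : ENNReal) ^ d * K) := by
          rw [measure_toMeasurable]
          gcongr
          exact hA n hn
      _ = ENNReal.ofReal (C / n ^ (d + 2) * n ^ d) * K := by
        rw [← mul_assoc, ENNReal.ofReal_mul' (by positivity), ENNReal.ofReal_pow hn0.le,
          ENNReal.ofReal_natCast]
      _ = ENNReal.ofReal (C * (1 / n ^ 2)) * K := by
        congr 2
        field_simp
        ring
  refine ⟨hf, hasFiniteIntegral_iff_enorm.mpr ?_⟩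
  calc ∫⁻ x, ‖f x‖ₑ ∂μ ≤ ∫⁻ x, ∑' n, (T n).indicator (fun _ => a n) x ∂μ := lintegral_mono hbound
    _ = ∑' n, a n * μ (T n) := by
      rw [lintegral_tsum fun n => (measurable_const.indicator
        (measurableSet_toMeasurable _ _)).aemeasurable]
      exact tsum_congr fun n => lintegral_indicator_const (measurableSet_toMeasurable _ _) _
    _ ≤ ∑' n : ℕ, ENNReal.ofReal (C * (1 / n ^ 2)) * K := ENNReal.tsum_le_tsum hterm
    _ < ⊤ := by
      rw [ENNReal.tsum_mul_right]
      exact ENNReal.mul_lt_top ((Real.summable_one_div_nat_pow.mpr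
        one_lt_two).mul_left C).tsum_ofReal_lt_top hK.lt_top

theorem IsInvariantMeasure.integrable_of_norm_mul_pow_le {μ : Measure (NHatQuot ℝ)}
    (hμ : IsInvariantMeasure μ) {Φ : NHatQuot ℝ → ℂ} (hΦ : Continuous Φ) {C : ℝ}
    (hC : ∀ q, ∃ R, 1 ≤ R ∧ ∃ h ∈ boundedPairs ℝ R, NHatQuot.mk ℝ h = q ∧ ‖Φ q‖ * R ^ 18 ≤ C) :
    Integrable Φ μ := by
  obtain ⟨K, hK, hvol⟩ := hμ.exists_measure_boundedPairs_le
  refine ThetaWhittaker.integrable_of_norm_mul_pow_le (C := C * 2 ^ 18) hK hvol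
    hΦ.measurable.aestronglyMeasurable fun q => ?_
  obtain ⟨R, hR, h, hh, rfl, hle⟩ := hC q
  have hceil : (⌈R⌉₊ : ℝ) ≤ 2 * R := by linarith [Nat.ceil_lt_add_one (zero_le_one.trans hR)]
  refine ⟨⌈R⌉₊, Nat.ceil_pos.mpr (zero_lt_one.trans_le hR),
    ⟨h, ⟨boundedGL_mono (Nat.le_ceil R) hh.1, boundedGL_mono (Nat.le_ceil R) hh.2⟩, rfl⟩, ?_⟩
  calc ‖Φ (NHatQuot.mk ℝ h)‖ * (⌈R⌉₊ : ℝ) ^ (16 + 2)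
      ≤ ‖Φ (NHatQuot.mk ℝ h)‖ * (2 * R) ^ (16 + 2) := by gcongr
    _ = ‖Φ (NHatQuot.mk ℝ h)‖ * R ^ 18 * 2 ^ 18 := by ring
    _ ≤ C * 2 ^ 18 := by gcongr

end Integrability

/-! ### Convergence over the real field -/

section Iwasawa

theorem rotation_mem_orthogonalGroup {σ c s : ℝ} (hσ : σ ^ 2 = 1) (hcs : c ^ 2 + s ^ 2 = 1) :
    !![σ * c, -(σ * s); s, c] ∈ Matrix.orthogonalGroup (Fin 2) ℝ := by
  rw [Matrix.mem_orthogonalGroup_iff]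
  ext i j
  fin_cases i <;> fin_cases j <;> simp [Matrix.mul_apply, Fin.sum_univ_two]
  · linear_combination hσ + σ ^ 2 * hcs
  · ring
  · ring
  · linear_combination hcs

theorem exists_iwasawa (g : GL (Fin 2) ℝ) : ∃ (z : ℝˣ) (x u : ℝ) (k : O2),
    diag z z * unip x * g = torus u * Unitary.toUnits k := by
  obtain ⟨D, hD⟩ : ∃ D, D = (g : gl2).det := ⟨_, rfl⟩
  have hD0 : D ≠ 0 := hD ▸ g.det_ne_zero
  rw [Matrix.det_fin_two] at hD
  have hbottom : 0 < g 1 0 ^ 2 + g 1 1 ^ 2 := by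
    by_contra! h
    have h0 : g 1 0 = 0 := by nlinarith
    have h1 : g 1 1 = 0 := by nlinarith
    exact hD0 (by rw [hD, h0, h1]; ring)
  obtain ⟨p, hp, hpp⟩ : ∃ p > 0, p ^ 2 = g 1 0 ^ 2 + g 1 1 ^ 2 :=
    ⟨_, Real.sqrt_pos.mpr hbottom, Real.sq_sqrt hbottom.le⟩
  obtain ⟨σ, hσ, hσD⟩ : ∃ σ : ℝ, σ ^ 2 = 1 ∧ 0 < σ * D :=
    ⟨|D| / D, by rw [div_pow, sq_abs, div_self (pow_ne_zero 2 hD0)],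
      by rw [div_mul_cancel₀ _ hD0]; exact abs_pos.mpr hD0⟩
  let k : O2 := ⟨!![σ * (g 1 1 / p), -(σ * (g 1 0 / p)); g 1 0 / p, g 1 1 / p],
    rotation_mem_orthogonalGroup hσ (by field_simp; linarith)⟩
  have hexp : Real.exp (Real.log (σ * D / p ^ 2)) = σ * D / p ^ 2 :=
    Real.exp_log (by positivity)
  refine ⟨Units.mk0 p⁻¹ (inv_ne_zero hp.ne'), -((g 0 0 * g 1 0 + g 0 1 * g 1 1) / p ^ 2),
    Real.log (σ * D / p ^ 2), k, ?_⟩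
  ext i j
  fin_cases i <;> fin_cases j <;>
    simp [torus, diag, unip, Matrix.mul_apply, Fin.sum_univ_two, k, hexp] <;> field_simp
  · linear_combination g 0 0 * hpp - g 1 1 * D * hσ - g 1 1 * hD
  · linear_combination g 0 1 * hpp + g 1 0 * D * hσ + g 1 0 * hD

end Iwasawa

section RealField

open scoped Matrix.Norms.Elementwise

theorem exp_neg_le_norm_conjNilp (u : ℝ) (k : O2) :
    Real.exp (-u) ≤ 4 * ‖conjNilp (torus u * Unitary.toUnits k)‖ := by
  have hk := orthogonal_mem_boundedGL k
  generalize Unitary.toUnits k = κ at hk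
  have hconj : conjNilp (torus u) =
      (κ : gl2) * conjNilp (torus u * κ) * ((κ⁻¹ : GL (Fin 2) ℝ) : gl2) := by
    simp only [conjNilp, _root_.mul_inv_rev, Units.val_mul, Matrix.mul_assoc,
      Units.mul_inv_cancel_left, Units.mul_inv, Matrix.mul_one]
  have htorus : ‖conjNilp (torus u)‖ = Real.exp (-u) := by
    rw [norm_conjNilp, Real.exp_neg]
    simp [torus, diag]
  calc Real.exp (-u) = ‖(κ : gl2) * conjNilp (torus u * κ) * ((κ⁻¹ : GL (Fin 2) ℝ) : gl2)‖ := by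
        rw [← hconj, htorus]
    _ ≤ 2 * (2 * (‖(κ : gl2)‖ * ‖conjNilp (torus u * κ)‖) *
          ‖((κ⁻¹ : GL (Fin 2) ℝ) : gl2)‖) := by
        refine (norm_matrix_mul_le _ _).trans ?_
        gcongr
        exact norm_matrix_mul_le _ _
    _ ≤ 2 * (2 * (1 * ‖conjNilp (torus u * κ)‖) * 1) := by
        gcongr
        exacts [hk.1, hk.2]
    _ = 4 * ‖conjNilp (torus u * κ)‖ := by ring

theorem exp_neg_le_of_snd_eq {h : DetPairs ℝ} {u : ℝ} {k : O2}
    (hk : h.1.2 = torus u * Unitary.toUnits k) :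
    Real.exp (-u) ≤ 8 * (1 + ‖invAct h.1.1 h.1.2 (basePoint ℝ)‖) ^ 2 := by
  have hexp := exp_neg_le_norm_conjNilp u k
  rw [← hk] at hexp
  nlinarith [norm_conjNilp_le h, norm_nonneg (invAct h.1.1 h.1.2 (basePoint ℝ))]

theorem mem_boundedPairs_of_snd_eq {h : DetPairs ℝ} {u : ℝ} {k : O2}
    (hk : h.1.2 = torus u * Unitary.toUnits k) :
    h ∈ boundedPairs ℝ
      (4 * Real.exp |u| * (1 + ‖invAct h.1.1 h.1.2 (basePoint ℝ)‖)) := by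
  have hsnd : h.1.2 ∈ boundedGL ℝ (2 * (Real.exp |u| * 1)) :=
    hk ▸ mul_mem_boundedGL (torus_mem_boundedGL u) (orthogonal_mem_boundedGL k)
  have hmem := mem_boundedPairs_of_snd_mem hsnd
    (le_add_of_nonneg_right (norm_nonneg (invAct h.1.1 h.1.2 (basePoint ℝ))))
    (le_add_of_nonneg_left zero_le_one)
  convert hmem using 2
  ring

theorem exists_norm_mul_norm_mul_pow_le {W : GL (Fin 2) ℝ → ℂ} {φ : VSq ℝ → ℂ}
    (hW : GKModule.ModerateGrowth W)
    (hdecay : ∀ M : ℝ, ∃ C : ℝ, ∀ u, 0 ≤ u → ∀ k : O2,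
      ‖W (torus u * Unitary.toUnits k)‖ ≤ C * Real.exp (-(M * u)))
    (hφ : IsRealSchwartz φ) (P : ℕ) :
    ∃ C, ∀ (h : DetPairs ℝ) (u : ℝ) (k : O2), h.1.2 = torus u * Unitary.toUnits k →
      ‖W h.1.2‖ * ‖φ (invAct h.1.1 h.1.2 (basePoint ℝ))‖ *
        (4 * Real.exp |u| * (1 + ‖invAct h.1.1 h.1.2 (basePoint ℝ)‖)) ^ P ≤ C := by
  obtain ⟨C₀, hC₀, N, hgrowth⟩ := hW.exists_norm_le
  obtain ⟨C₁, hC₁⟩ := hdecay P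
  obtain ⟨C₂, hC₂⟩ := hφ.exists_decay P
  obtain ⟨C₃, hC₃⟩ := hφ.exists_decay (3 * (N + P))
  refine ⟨max (4 ^ P * (|C₁| * C₂)) (C₀ * 32 ^ (N + P) * C₃), fun h u k hk => ?_⟩
  have hexp := exp_neg_le_of_snd_eq hk
  have hWh := hgrowth _ _ (mem_boundedPairs_of_snd_eq hk).2
  have hφ₂ := hC₂ (invAct h.1.1 h.1.2 (basePoint ℝ))
  have hφ₃ := hC₃ (invAct h.1.1 h.1.2 (basePoint ℝ))
  have hb := norm_nonneg (φ (invAct h.1.1 h.1.2 (basePoint ℝ)))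
  have hρ : 0 ≤ 1 + ‖invAct h.1.1 h.1.2 (basePoint ℝ)‖ := by positivity
  generalize ‖φ (invAct h.1.1 h.1.2 (basePoint ℝ))‖ = b at hφ₂ hφ₃ hb ⊢
  generalize 1 + ‖invAct h.1.1 h.1.2 (basePoint ℝ)‖ = ρ at hexp hWh hφ₂ hφ₃ hρ ⊢
  rcases le_total 0 u with hu | hu
  · refine le_max_of_le_left ?_
    rw [abs_of_nonneg hu, hk]
    have hcancel : Real.exp (-(P * u)) * Real.exp u ^ P = 1 := by
      rw [← Real.exp_nat_mul, ← Real.exp_add, neg_add_cancel, Real.exp_zero]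
    calc ‖W (torus u * Unitary.toUnits k)‖ * b * (4 * Real.exp u * ρ) ^ P
        ≤ |C₁| * Real.exp (-(P * u)) * b * (4 * Real.exp u * ρ) ^ P := by
          gcongr
          exact (hC₁ u hu k).trans (by gcongr; exact le_abs_self _)
      _ = 4 ^ P * (|C₁| * (ρ ^ P * b)) * (Real.exp (-(P * u)) * Real.exp u ^ P) := by ring
      _ ≤ 4 ^ P * (|C₁| * C₂) := by
          rw [hcancel, mul_one]
          gcongr
  · refine le_max_of_le_right ?_
    rw [abs_of_nonpos hu] at hWh ⊢
    have hR : 4 * Real.exp (-u) * ρ ≤ 32 * ρ ^ 3 :=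
      calc 4 * Real.exp (-u) * ρ ≤ 4 * (8 * ρ ^ 2) * ρ := by gcongr
        _ = 32 * ρ ^ 3 := by ring
    calc ‖W h.1.2‖ * b * (4 * Real.exp (-u) * ρ) ^ P
        ≤ C₀ * (4 * Real.exp (-u) * ρ) ^ N * b * (4 * Real.exp (-u) * ρ) ^ P := by gcongr
      _ = C₀ * (4 * Real.exp (-u) * ρ) ^ (N + P) * b := by ring
      _ ≤ C₀ * (32 * ρ ^ 3) ^ (N + P) * b := by gcongr
      _ = C₀ * 32 ^ (N + P) * (ρ ^ (3 * (N + P)) * b) := by rw [pow_mul ρ]; ring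
      _ ≤ C₀ * 32 ^ (N + P) * C₃ := by gcongr

theorem exists_mem_boundedGL {F : Type*} [NormedField F] (g : GL (Fin 2) F) :
    ∃ R, g ∈ boundedGL F R :=
  ⟨_, le_max_left _ _, le_max_right _ _⟩

theorem exists_norm_eps_mul_mul_le {W : GL (Fin 2) ℝ → ℂ} (hW : GKModule.ModerateGrowth W)
    (d : GL (Fin 2) ℝ) :
    ∃ C, 0 ≤ C ∧ ∃ N : ℕ, ∀ R, ∀ g ∈ boundedGL ℝ R, ‖W (eps * g * d)‖ ≤ C * R ^ N := by
  obtain ⟨C, hC, N, hCN⟩ := hW.exists_norm_le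
  obtain ⟨A, hA⟩ := exists_mem_boundedGL (eps : GL (Fin 2) ℝ)
  obtain ⟨B, hB⟩ := exists_mem_boundedGL d
  have hA0 : 0 ≤ A := (norm_nonneg _).trans hA.1
  have hB0 : 0 ≤ B := (norm_nonneg _).trans hB.1
  refine ⟨C * (4 * A * B) ^ N, by positivity, N, fun R g hg => ?_⟩
  calc ‖W (eps * g * d)‖ ≤ C * (2 * (2 * (A * R) * B)) ^ N :=
        hCN _ _ (mul_mem_boundedGL (mul_mem_boundedGL hA hg) hB)
    _ = C * (4 * A * B) ^ N * R ^ N := by ring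

theorem convergesAbsolutely_integrand_real {ψ : AddChar ℝ Circle} (hψ : Continuous ψ)
    (hψ1 : ψ ≠ 1) {E₁ E₂ : Type*} [AddCommGroup E₁] [Module ℂ E₁] [AddCommGroup E₂] [Module ℂ E₂]
    {π₁ : GKModule E₁} {π₂ : GKModule E₂} (hπ₂ : ∃ c : ℂ, ∀ e, π₂.casimir e = c • e)
    {ω₁ ω₂ : ℝˣ →* ℂˣ} (hω₁ : π₁.HasCentralChar ω₁) (hω₂ : π₂.HasCentralChar ω₂)
    (hω : ω₁ * ω₂ = 1) {W₁ W₂ : GL (Fin 2) ℝ → ℂ} (hW₁ : W₁ ∈ π₁.whittakerModel ψ)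
    (hW₂ : W₂ ∈ π₂.whittakerModel ψ) {f : VSq ℝ → ℂ} (hf : IsRealSchwartz f) (g : GSp4 ℝ)
    {m : Measure (VSq ℝ)} (hm : IsSelfDual ψ m) {μ : Measure (NHatQuot ℝ)}
    (hμ : IsInvariantMeasure μ) : ConvergesAbsolutely μ (integrand ψ m W₁ W₂ f g) := by
  have := hm.haar
  obtain ⟨ℓ₁, h₁, e₁, rfl⟩ := GKModule.exists_isWhittakerMap hW₁
  obtain ⟨ℓ₂, h₂, e₂, rfl⟩ := GKModule.exists_isWhittakerMap hW₂
  obtain ⟨φ, hφ, Φ, hΦcont, hΦint, hΦ⟩ := (isTestSpace_realSchwartz hψ hψ1 m).exists_continuous_lift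
    hm hf g (h₁.continuous e₁) (h₂.continuous e₂) (h₁.isWhittaker hω₁ e₁) (h₂.isWhittaker hω₂ e₂) hω
  obtain ⟨c, hc⟩ := hπ₂
  obtain ⟨s, hs, -⟩ := hω₂.2
  obtain ⟨C₁, hC₁, N, hgrowth⟩ := exists_norm_eps_mul_mul_le (h₁.growth e₁) (diag g.nu 1)
  obtain ⟨C₂, hC₂⟩ := exists_norm_mul_norm_mul_pow_le (h₂.growth e₂)
    (h₂.exists_norm_torus_mul_le hψ hψ1 hs hc e₂) hφ (N + 18)
  refine ⟨Φ, hΦint, hμ.integrable_of_norm_mul_pow_le hΦcont (C := C₁ * C₂) fun q => ?_⟩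
  obtain ⟨h, rfl⟩ := NHatQuot.mk_surjective q
  obtain ⟨z, x, u, k, hk⟩ := exists_iwasawa h.1.2
  let n : DetPairs ℝ := ⟨(diag z z * unip x, diag z z * unip x), rfl⟩
  rw [← NHatQuot.mk_eq (n := n) ⟨z, x, rfl⟩ h]
  have hnh : (n * h).1.2 = torus u * Unitary.toUnits k := hk
  have hdecay := hC₂ (n * h) u k hnh
  have hmem := mem_boundedPairs_of_snd_eq hnh
  have hR : 1 ≤ 4 * Real.exp |u| *
      (1 + ‖invAct (n * h).1.1 (n * h).1.2 (basePoint ℝ)‖) := by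
    nlinarith [Real.one_le_exp (abs_nonneg u),
      norm_nonneg (invAct (n * h).1.1 (n * h).1.2 (basePoint ℝ))]
  refine ⟨_, hR, n * h, hmem, rfl, ?_⟩
  generalize 4 * Real.exp |u| * (1 + ‖invAct (n * h).1.1 (n * h).1.2 (basePoint ℝ)‖) = R
    at hdecay hmem hR ⊢
  rw [hΦ, norm_mul, norm_mul]
  calc ‖ℓ₁ e₁ (eps * (n * h).1.1 * diag g.nu 1)‖ * ‖ℓ₂ e₂ (n * h).1.2‖ *
        ‖φ (invAct (n * h).1.1 (n * h).1.2 (basePoint ℝ))‖ * R ^ 18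
      ≤ C₁ * R ^ N * ‖ℓ₂ e₂ (n * h).1.2‖ *
        ‖φ (invAct (n * h).1.1 (n * h).1.2 (basePoint ℝ))‖ * R ^ 18 := by
        gcongr
        exact hgrowth R _ hmem.1
    _ = C₁ * (‖ℓ₂ e₂ (n * h).1.2‖ * ‖φ (invAct (n * h).1.1 (n * h).1.2 (basePoint ℝ))‖ *
        R ^ (N + 18)) := by ring
    _ ≤ C₁ * C₂ := by gcongr

end RealField

end ThetaWhittaker

theorem mainTheorem10_general :
    (∀ (F : Type*) [Field F] [ValuativeRel F] [TopologicalSpace F] [IsNonarchimedeanLocalField F]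
        (ψ : AddChar F Circle), (2 : F) ≠ 0 → Continuous ψ → ψ ≠ 1 →
      ∀ (E₁ E₂ : Type*) [AddCommGroup E₁] [Module ℂ E₁] [AddCommGroup E₂] [Module ℂ E₂]
        (π₁ : Representation ℂ (Matrix.GeneralLinearGroup (Fin 2) F) E₁)
        (π₂ : Representation ℂ (Matrix.GeneralLinearGroup (Fin 2) F) E₂),
        (∀ e, IsOpen {g | π₁ g e = e}) → (∀ e, IsOpen {g | π₂ g e = e}) →
      ∀ ω₁ ω₂ : Fˣ →* ℂˣ, HasCentralChar π₁ ω₁ → HasCentralChar π₂ ω₂ → ω₁ * ω₂ = 1 →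
      ∀ W₁ ∈ whittakerModel π₁ ψ, ∀ W₂ ∈ whittakerModel π₂ ψ,
      ∀ f : VSq F → ℂ, IsSchwartzBruhat f →
      ∀ g : GSp4 F,
      ∀ m : MeasureTheory.Measure (VSq F), IsSelfDual ψ m →
      ∀ μ : MeasureTheory.Measure (NHatQuot F), IsInvariantMeasure μ →
        ConvergesAbsolutely μ (integrand ψ m W₁ W₂ f g)) ∧
    (∀ ψ : AddChar ℝ Circle, Continuous ψ → ψ ≠ 1 →
      ∀ (E₁ E₂ : Type*) [AddCommGroup E₁] [Module ℂ E₁] [AddCommGroup E₂] [Module ℂ E₂]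
        (π₁ : GKModule E₁) (π₂ : GKModule E₂),
        (∃ c : ℂ, ∀ e, π₂.casimir e = c • e) →
      ∀ ω₁ ω₂ : ℝˣ →* ℂˣ, π₁.HasCentralChar ω₁ → π₂.HasCentralChar ω₂ → ω₁ * ω₂ = 1 →
      ∀ W₁ ∈ π₁.whittakerModel ψ, ∀ W₂ ∈ π₂.whittakerModel ψ,
      ∀ f : VSq ℝ → ℂ, IsRealSchwartz f →
      ∀ g : GSp4 ℝ,
      ∀ m : MeasureTheory.Measure (VSq ℝ), IsSelfDual ψ m →
      ∀ μ : MeasureTheory.Measure (NHatQuot ℝ), IsInvariantMeasure μ →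
        ConvergesAbsolutely μ (integrand ψ m W₁ W₂ f g)) := by
  constructor
  · intro _ _ _ _ _ _ _ hψ hψ1 _ _ _ _ _ _ _ _ hπ₁ hπ₂ _ _ hω₁ hω₂ hω _ hW₁ _ hW₂ _ hf g _ hm _ hμ
    exact convergesAbsolutely_integrand_nonarch hψ hψ1 hπ₁ hπ₂ hω₁ hω₂ hω hW₁ hW₂ hf g hm hμ
  · intro _ hψ hψ1 _ _ _ _ _ _ _ _ hπ₂ _ _ hω₁ hω₂ hω _ hW₁ _ hW₂ _ hf g _ hm _ hμ
    exact convergesAbsolutely_integrand_real hψ hψ1 hπ₂ hω₁ hω₂ hω hW₁ hW₂ hf g hm hμ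

theorem mainTheorem10 :
    -- non-archimedean local fields of characteristic zero
    (∀ (F : Type*) [Field F] [ValuativeRel F] [TopologicalSpace F] [IsNonarchimedeanLocalField F]
        [CharZero F]
        (ψ : AddChar F Circle), Continuous ψ → ψ ≠ 1 →
      ∀ (E₁ E₂ : Type*) [AddCommGroup E₁] [Module ℂ E₁] [AddCommGroup E₂] [Module ℂ E₂]
        (π₁ : Representation ℂ (Matrix.GeneralLinearGroup (Fin 2) F) E₁)
        (π₂ : Representation ℂ (Matrix.GeneralLinearGroup (Fin 2) F) E₂),
        IsIrredAdmissible π₁ → IsIrredAdmissible π₂ →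
      ∀ ω₁ ω₂ : Fˣ →* ℂˣ, HasCentralChar π₁ ω₁ → HasCentralChar π₂ ω₂ → ω₁ * ω₂ = 1 →
      ∀ W₁ ∈ whittakerModel π₁ ψ, ∀ W₂ ∈ whittakerModel π₂ ψ,
      ∀ f : VSq F → ℂ, IsSchwartzBruhat f →
      ∀ g : GSp4 F,
      ∀ m : MeasureTheory.Measure (VSq F), IsSelfDual ψ m →
      ∀ μ : MeasureTheory.Measure (NHatQuot F), IsInvariantMeasure μ →
        ConvergesAbsolutely μ (integrand ψ m W₁ W₂ f g)) ∧
    -- the real field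
    (∀ ψ : AddChar ℝ Circle, Continuous ψ → ψ ≠ 1 →
      ∀ (E₁ E₂ : Type*) [AddCommGroup E₁] [Module ℂ E₁] [AddCommGroup E₂] [Module ℂ E₂]
        (π₁ : GKModule E₁) (π₂ : GKModule E₂),
        π₁.IsIrredAdmissible → π₂.IsIrredAdmissible →
      ∀ ω₁ ω₂ : ℝˣ →* ℂˣ, π₁.HasCentralChar ω₁ → π₂.HasCentralChar ω₂ → ω₁ * ω₂ = 1 →
      ∀ W₁ ∈ π₁.whittakerModel ψ, ∀ W₂ ∈ π₂.whittakerModel ψ,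
      ∀ f : VSq ℝ → ℂ, IsRealSchwartz f →
      ∀ g : GSp4 ℝ,
      ∀ m : MeasureTheory.Measure (VSq ℝ), IsSelfDual ψ m →
      ∀ μ : MeasureTheory.Measure (NHatQuot ℝ), IsInvariantMeasure μ →
        ConvergesAbsolutely μ (integrand ψ m W₁ W₂ f g)) := by
  obtain ⟨nonarch, real⟩ := mainTheorem10_general
  exact ⟨fun F _ _ _ _ _ ψ hψ hψ1 E₁ E₂ _ _ _ _ π₁ π₂ hπ₁ hπ₂ =>
      nonarch F ψ two_ne_zero hψ hψ1 E₁ E₂ π₁ π₂ hπ₁.smooth hπ₂.smooth,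
    fun ψ hψ hψ1 E₁ E₂ _ _ _ _ π₁ π₂ _ hπ₂ =>
      real ψ hψ hψ1 E₁ E₂ π₁ π₂ hπ₂.exists_casimir_eq⟩
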